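/- There are a randomized word-RAM program for a fully dynamic algorithm and constants $K\in\mathbb N$, $C>0$ such that the following holds for all $n\ge 1$, all integers $W\ge 2$, all reals $\varepsilon>0$ and $0<p'<1$, every word length $w$ with $2^w\ge (n+W+\lceil 1/\varepsilon\rceil+\lceil 1/p'\rceil)^K$, every simple graph $G_0$ on $n$ vertices with edge weights in $[W]=\{1,\dots,W\}$, and every adaptive adversary. The program receives $n$, $W$, $\lceil 1/\varepsilon\rceil$, $\lceil 1/p'\rceil$ and $G_0$, preprocesses them in finite time, and then processes the adversary's updates one by one; an update inserts an absent edge with a weight in $[W]$ or deletes a present edge. Let $G_i$ be the graph after $i$ updates. After the preprocessing and after each update the program holds a rational number $\overline M$ (numerator and denominator in two fixed registers). The adversary may be randomized and chooses each update knowing all previous updates and all previous values of $\overline M$. (1) For every $t\ge 0$, with probability at least $1-p'$ the value $\overline M$ after $t$ updates is a $(1+\varepsilon)$-approximation of the weight $M$ of a minimum spanning forest of $G_t$, that is, $(1-\varepsilon)M\le\overline M\le(1+\varepsilon)M$. (2) For every $t\ge 1$, whatever the random choices, the $t$-th update takes at most $$C\cdot\max\left\{1,\ \frac{W^3\,\log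 W\,\log\left(\frac{W}{\varepsilon}\right)\,\log\left(\frac{\log W}{\varepsilon p'}\right)}{\varepsilon^4\cdot\mathrm{nis}^*}\right\}$$ steps, where $\mathrm{nis}^*$ is the maximum of $1$ and the minimum number of non-isolated vertices in $G_0,\dots,G_t$. Here a program is a fixed finite structured program over registers and arrays of $w$-bit words (initially $0$ apart from the input), with unit-cost commands: assignments and tests using arithmetic modulo $2^w$ (addition, truncated subtraction, multiplication, division, remainder, comparisons) and indirect addressing, and the choice of a uniformly random element of $\{0,\dots,m-1\}$ for a given word $m$. -/

import Mathlib

/-! ## Weighted graphs, spanning forests and updates -/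

/-- Edge weights of a graph on the vertices `0, …, n - 1`; weight `0` means that the edge is
absent. -/
abbrev WGraph (n : ℕ) := Sym2 (Fin n) → ℕ

namespace WGraph

/-- A simple graph with edge weights in `{1, …, W}`. -/
def WeightsIn {n : ℕ} (G : WGraph n) (W : ℕ) : Prop :=
  (∀ v, G s(v, v) = 0) ∧ ∀ e, G e ≤ W

/-- The underlying simple graph. -/
def graph {n : ℕ} (G : WGraph n) : SimpleGraph (Fin n) where
  Adj u v := u ≠ v ∧ 0 < G s(u, v)
  symm := ⟨fun u v h => ⟨h.1.symm, by rw [Sym2.eq_swap]; exact h.2⟩⟩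
  loopless := ⟨fun _ h => h.1 rfl⟩

/-- The number of non-isolated vertices. -/
noncomputable def nis {n : ℕ} (G : WGraph n) : ℕ :=
  {v : Fin n | ∃ u, G.graph.Adj v u}.ncard

/-- `F` is a spanning forest of `G`: an acyclic subgraph with the same connected components. -/
def IsSpanningForest {n : ℕ} (G : WGraph n) (F : SimpleGraph (Fin n)) : Prop :=
  F ≤ G.graph ∧ F.IsAcyclic ∧ ∀ u v, F.Reachable u v ↔ G.graph.Reachable u v

open Classical in
/-- The total weight of the edges of `F`. -/
noncomputable def weightOf {n : ℕ} (G : WGraph n) (F : SimpleGraph (Fin n)) : ℕ :=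
  ∑ e ∈ F.edgeFinset, G e

/-- The weight of a minimum spanning forest. -/
noncomputable def msfWeight {n : ℕ} (G : WGraph n) : ℕ :=
  sInf {x | ∃ F, G.IsSpanningForest F ∧ x = G.weightOf F}

theorem exists_minimum_spanningForest {n : ℕ} (G : WGraph n) :
    ∃ F, G.IsSpanningForest F ∧ G.weightOf F = G.msfWeight ∧
      ∀ F', G.IsSpanningForest F' → G.weightOf F ≤ G.weightOf F' := by
  have hne : {x | ∃ F, G.IsSpanningForest F ∧ x = G.weightOf F}.Nonempty := by
    obtain ⟨F, hF, ha, hr⟩ := G.graph.exists_isAcyclic_reachable_eq_le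
    exact ⟨_, F, ⟨hF, ha, fun u v => by rw [hr]⟩, rfl⟩
  obtain ⟨F, hF, hx⟩ := Nat.sInf_mem hne
  refine ⟨F, hF, hx.symm, fun F' hF' => ?_⟩
  rw [← hx]
  exact Nat.sInf_le ⟨F', hF', rfl⟩

end WGraph

/-- The update operations of a fully dynamic graph algorithm. -/
inductive Update (n : ℕ) where
  | insert (u v : Fin n) (c : ℕ)
  | delete (u v : Fin n)

namespace Update

/-- An insertion concerns an absent edge and has a weight in `{1, …, W}`; a deletion concerns a
present edge. -/
def Legal {n : ℕ} (W : ℕ) (G : WGraph n) : Update n → Prop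
  | insert u v c => u ≠ v ∧ G s(u, v) = 0 ∧ 1 ≤ c ∧ c ≤ W
  | delete u v => u ≠ v ∧ 0 < G s(u, v)

/-- The graph after the update. -/
def apply {n : ℕ} (G : WGraph n) : Update n → WGraph n
  | insert u v c => Function.update G s(u, v) c
  | delete u v => Function.update G s(u, v) 0

/-- The graph after a list of updates, the most recent of which comes first. -/
def applyAll {n : ℕ} (G : WGraph n) : List (Update n) → WGraph n
  | [] => G
  | u :: us => apply (applyAll G us) u

/-- The minimum number of non-isolated vertices in the initial graph `G` and in the graphs after
each of the updates (most recent first). -/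
noncomputable def minNis {n : ℕ} (G : WGraph n) : List (Update n) → ℕ
  | [] => G.nis
  | u :: us => min (applyAll G (u :: us)).nis (minNis G us)

end Update

/-! ## A randomized word RAM

Programs work on registers and on arrays of `w`-bit words; every result of an arithmetic operation
is reduced modulo `2 ^ w`. Executing one command (an assignment, a random choice, or the
evaluation of one test) is one step. Each program contains finitely many expressions of fixed size,
so evaluating an expression takes a constant number of machine operations. -/

namespace RAM

inductive Op where
  | add | sub | mul | div | mod | lt | eq

/-- Subtraction is truncated at `0`, division is the floor of the quotient, and comparisons return
`1` for true and `0` for false. -/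
def Op.eval : Op → ℕ → ℕ → ℕ
  | add, a, b => a + b
  | sub, a, b => a - b
  | mul, a, b => a * b
  | div, a, b => a / b
  | mod, a, b => a % b
  | lt, a, b => if a < b then 1 else 0
  | eq, a, b => if a = b then 1 else 0

/-- `reg x` is the content of register `x`, and `arr a i` the entry `i` of array `a`. -/
structure Store where
  reg : ℕ → ℕ
  arr : ℕ → ℕ → ℕ

def Store.setReg (s : Store) (x v : ℕ) : Store :=
  { s with reg := Function.update s.reg x v }

def Store.setArr (s : Store) (a i v : ℕ) : Store :=
  { s with arr := Function.update s.arr a (Function.update (s.arr a) i v) }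

inductive Expr where
  | const (c : ℕ)
  | reg (x : ℕ)
  | read (a : ℕ) (i : Expr)
  | op (o : Op) (e₁ e₂ : Expr)

/-- The value of an expression on a machine with `w`-bit words. -/
def Expr.eval (w : ℕ) (s : Store) : Expr → ℕ
  | const c => c % 2 ^ w
  | reg x => s.reg x
  | read a i => s.arr a (i.eval w s)
  | op o e₁ e₂ => o.eval (e₁.eval w s) (e₂.eval w s) % 2 ^ w

inductive Cmd where
  /-- register `x` := `e` -/
  | assign (x : ℕ) (e : Expr)
  /-- entry `i` of array `a` := `e` -/
  | write (a : ℕ) (i e : Expr)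
  /-- register `x` := a uniformly random element of `{0, …, e - 1}` (`0` if `e = 0`) -/
  | rand (x : ℕ) (e : Expr)
  | seq (c d : Cmd)
  /-- run `c` if `e ≠ 0`, and `d` otherwise -/
  | ite (e : Expr) (c d : Cmd)
  /-- run `c` as long as `e ≠ 0` -/
  | loop (e : Expr) (c : Cmd)

/-- The commands that remain to be executed, and the current store. -/
abbrev Config := List Cmd × Store

/-- The uniform distribution on `{0, …, m - 1}` (the point mass at `0` if `m = 0`). -/
noncomputable def uniformBelow (m : ℕ) : PMF ℕ :=
  if h : m = 0 then PMF.pure 0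
  else PMF.uniformOfFinset (Finset.range m) (Finset.nonempty_range_iff.mpr h)

/-- One step of the machine; a configuration without remaining commands has halted. -/
noncomputable def step (w : ℕ) : Config → PMF Config
  | ([], s) => PMF.pure ([], s)
  | (.assign x e :: k, s) => PMF.pure (k, s.setReg x (e.eval w s))
  | (.write a i e :: k, s) => PMF.pure (k, s.setArr a (i.eval w s) (e.eval w s))
  | (.rand x e :: k, s) => (uniformBelow (e.eval w s)).map fun v => (k, s.setReg x v)
  | (.seq c d :: k, s) => PMF.pure (c :: d :: k, s)
  | (.ite e c d :: k, s) => PMF.pure ((if e.eval w s ≠ 0 then c else d) :: k, s)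
  | (.loop e c :: k, s) => PMF.pure (if e.eval w s ≠ 0 then c :: .loop e c :: k else k, s)

/-- The distribution of the configuration after `T` steps. -/
noncomputable def run (w : ℕ) : ℕ → Config → PMF Config
  | 0, x => PMF.pure x
  | T + 1, x => (step w x).bind (run w T)

/-- Started on `s`, the program `c` halts after at most `T` steps, whatever the random choices. -/
def HaltsWithin (w : ℕ) (c : Cmd) (s : Store) (T : ℕ) : Prop :=
  ∀ x ∈ (run w T ([c], s)).support, x.1 = []

/-- The worst-case running time of `c` on `s` (over the random choices); meaningful if `c` halts
within some number of steps. -/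
noncomputable def haltTime (w : ℕ) (c : Cmd) (s : Store) : ℕ :=
  sInf {T | HaltsWithin w c s T}

/-- The distribution of the final store of `c` started on `s`. -/
noncomputable def exec (w : ℕ) (c : Cmd) (s : Store) : PMF Store :=
  (run w (haltTime w c s) ([c], s)).map Prod.snd

end RAM

/-! ## Dynamic algorithms and adaptive adversaries -/

/-- A fully dynamic algorithm: a program for the preprocessing of the initial graph, and a program
that is run for each update. Registers and arrays persist between the runs. -/
structure DynAlg where
  prep : RAM.Cmd
  upd : RAM.Cmd

/-- The input of the preprocessing: `n`, `W` and the two parameters `a`, `b` in the registers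
`0, 1, 2, 3`, and the weighted adjacency matrix, row by row, in array `0`. All else is `0`. -/
def inputStore {n : ℕ} (W a b : ℕ) (G : WGraph n) : RAM.Store where
  reg x := if x = 0 then n else if x = 1 then W else if x = 2 then a else if x = 3 then b else 0
  arr x i := if h : x = 0 ∧ i < n * n then
      G s(⟨i / n, Nat.div_lt_of_lt_mul h.2⟩,
        ⟨i % n, Nat.mod_lt _ (Nat.pos_of_ne_zero fun h0 => by simp [h0] at h)⟩)
    else 0

/-- The update is passed in the registers `0, 1` (endpoints) and `2` (the weight of an inserted
edge, or `0` for a deletion). -/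
def feed {n : ℕ} (s : RAM.Store) : Update n → RAM.Store
  | .insert u v c => ((s.setReg 0 u).setReg 1 v).setReg 2 c
  | .delete u v => ((s.setReg 0 u).setReg 1 v).setReg 2 0

/-- The maintained value, readable in constant time at the end of each run: the fraction whose
numerator and denominator are in the registers `0` and `1`. -/
def output (s : RAM.Store) : ℚ := (s.reg 0 : ℚ) / (s.reg 1 : ℚ)

/-- An adaptive (and possibly randomized) adversary chooses the next update knowing all earlier
updates and all values output so far (both most recent first). -/
abbrev Adversary (n : ℕ) := List (Update n) → List ℚ → PMF (Update n)

/-- In each of the first `t` rounds the adversary chooses a legal update. -/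
def Adversary.LegalFor {n : ℕ} (A : Adversary n) (W : ℕ) (G₀ : WGraph n) (t : ℕ) : Prop :=
  ∀ us outs, us.length < t → ∀ u ∈ (A us outs).support, u.Legal W (Update.applyAll G₀ us)

/-- A state of the interaction: the updates and the outputs so far (most recent first), and the
store of the algorithm. -/
structure Play (n : ℕ) where
  upds : List (Update n)
  outs : List ℚ
  store : RAM.Store

/-- The distribution of the interaction of an algorithm with an adversary after the preprocessing
of the initial store `s₀` and the given number of updates. -/
noncomputable def play {n : ℕ} (w : ℕ) (alg : DynAlg) (s₀ : RAM.Store) (A : Adversary n) :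
    ℕ → PMF (Play n)
  | 0 => (RAM.exec w alg.prep s₀).map fun s => ⟨[], [output s], s⟩
  | t + 1 => (play w alg s₀ A t).bind fun π => (A π.upds π.outs).bind fun u =>
      (RAM.exec w alg.upd (feed π.store u)).map fun s => ⟨u :: π.upds, output s :: π.outs, s⟩

/-- `x` is a `(1 + ε)`-approximation of `M`. -/
def IsApprox (ε x M : ℝ) : Prop := (1 - ε) * M ≤ x ∧ x ≤ (1 + ε) * M

/-- The claimed update time, up to a constant factor, for `m` non-isolated vertices. -/
noncomputable def timeBound (W : ℕ) (ε p : ℝ) (m : ℕ) : ℝ :=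
  max 1 ((W : ℝ) ^ 3 * Real.log W * Real.log (W / ε) * Real.log (Real.log W / (ε * p)) /
    (ε ^ 4 * m))

open scoped ENNReal

/-! ## Forests and component counts -/

/-! The weight as a sum of local terms. Let G_i consist of the edges of weight at most i, and let
C_i(v) be the component of v in G_i. Counting the edges of a Kruskal forest level by level gives M +
W·cc(G_W) = Σ_{i<W} cc(G_i) (`WGraph.msfWeight_add`). Since the number of components is Σ_v
1/|C(v)|, it follows that M = Σ_v Σ_{i<W} (1/|C_i(v)| − 1/|C_W(v)|), where only the N non-isolated
vertices matter (`WGraph.msfWeight_eq_sum_nonIsolated`). Each of these contributes at least 1/2, so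
M ≥ N/2. One update changes M by at most 2W and N by at most 2.

The estimator. With a = ⌈1/ε⌉ and Γ = 16Wa, draw a random non-isolated v and a random level i < W,
and use the threshold X = ⌊Γ/(j+1)⌋, where j runs cyclically and deterministically through 0, …,
Γ−1. The sample is a hit if |C_i(v)| ≤ X < |C_W(v)|, which a search stopped after X+1 vertices
decides. Exactly ⌊Γ/C⌋ values of j have C ≤ X, so a cycle of Γ samples has expected number of hits
Γ·M/(NW) up to an error of 1 (`WGraph.sum_hitProb`). As M/N ≥ 1/2, this bias is relatively small,
and after 16al cycles a Chernoff bound gives relative error 1/(2a) except with probability 2e^{-3l}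
(`WGraph.le_estVal`); l is about log(1/p'). A search costs O((X+1)(X+W)) = O(Wa·X), and the
thresholds sum to a harmonic series, so all samples together cost T = O(W² a³ l log Γ)
(`RAM.tot_le`).

The dynamic algorithm. The estimator runs on a frozen copy of the graph, spread evenly over an epoch
of updates, which are only logged. When the run ends, its estimate is published; then two logged
updates are replayed per new update, and once the log is exhausted the next epoch starts. Epochs
have length about N/(160Wa), so while an estimate is in use M drifts by at most M/(8a)
(`RAM.goodFor_of_count`), and the work per update is about T·160Wa/N, within the claimed bound. The
preprocessing completes the first run. For ε ≥ 1 the constant answer 0 suffices.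

Adaptivity. The length of each epoch is fixed when the preceding one starts. Hence at the start of a
run, before its coins are tossed, it is known which later updates its estimate will serve. For a
fixed target update, `RAM.potential` is a lower bound for the conditional probability of a correct
value there: the indicator that the published value is robust, the expected success of the current
run, or q = 1 − p' for a run still to come. It does not decrease in expectation under any legal
update (`RAM.updCmd_spec`), so even an adversary that sees the whole store gains nothing
(`RAM.play_invariant`).

The machine side uses triples `RAM.Tr`, which bound the time, constrain all outcomes and bound an
expectation simultaneously. -/

open Classical in
-- Each component is a tree, so its degrees sum to twice its number of vertices minus two. Sum over
-- the components and use the handshake lemma.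
theorem SimpleGraph.IsAcyclic.card_edgeFinset_add_card {V : Type*} [Fintype V]
    {F : SimpleGraph V} (hF : F.IsAcyclic) :
    F.edgeFinset.card + Nat.card F.ConnectedComponent = Fintype.card V := by
  have h1 : ∀ c : F.ConnectedComponent,
      ∑ v : c.supp, F.degree v + 2 = 2 * Fintype.card c.supp := by
    intro c
    have ht := hF.isTree_connectedComponent c
    have h2 := ht.card_edgeFinset
    have h3 := c.toSimpleGraph.sum_degrees_eq_twice_card_edges
    have h4 : ∑ v : c.supp, F.degree v = ∑ v : c.supp, c.toSimpleGraph.degree v := by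
      refine Finset.sum_congr rfl fun v _ => ?_
      have := SimpleGraph.degree_induce_of_neighborSet_subset (G := F) (v := v) (s := c.supp)
        (fun w hw => by
          have hv : F.connectedComponentMk v = c := v.2
          have : F.Adj v w := hw
          change F.connectedComponentMk w = c
          rw [← hv]
          exact SimpleGraph.ConnectedComponent.sound this.symm.reachable)
      rw [← this, ← SimpleGraph.card_neighborSet_eq_degree, ← SimpleGraph.card_neighborSet_eq_degree,
        ← Nat.card_eq_fintype_card, ← Nat.card_eq_fintype_card]
      rfl
    have h5 : Fintype.card c = Fintype.card c.supp := by convert! rfl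
    have h6 : ∑ v : c.supp, c.toSimpleGraph.degree v = ∑ v : c, c.toSimpleGraph.degree v := by
      convert! rfl
    rw [h4, h6, h3, ← h5]
    omega
  have key : ∀ f : V → ℕ, ∑ v, f v = ∑ c : F.ConnectedComponent, ∑ v : c.supp, f v := by
    intro f
    rw [← Finset.sum_fiberwise Finset.univ F.connectedComponentMk f]
    refine Finset.sum_congr rfl fun c _ => ?_
    rw [← Finset.sum_subtype]
    intro x
    simp [SimpleGraph.ConnectedComponent.mem_supp_iff]
  have hd := F.sum_degrees_eq_twice_card_edges
  have hn : ∑ c : F.ConnectedComponent, Fintype.card c.supp = Fintype.card V := by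
    have := key (fun _ => 1)
    simpa using this.symm
  have hs : ∑ c : F.ConnectedComponent, (∑ v : c.supp, F.degree v + 2)
      = ∑ c : F.ConnectedComponent, 2 * Fintype.card c.supp :=
    Finset.sum_congr rfl fun c _ => h1 c
  rw [Finset.sum_add_distrib, ← key fun v => F.degree v, ← Finset.mul_sum, hn, hd] at hs
  simp at hs
  rw [Nat.card_eq_fintype_card]
  omega

/-- The number of connected components. -/
noncomputable def SimpleGraph.cc {V : Type*} (G : SimpleGraph V) : ℕ := Nat.card G.ConnectedComponent

theorem SimpleGraph.cc_le_of_le {V : Type*} [Finite V] {G H : SimpleGraph V} (h : G ≤ H) :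
    H.cc ≤ G.cc := SimpleGraph.ConnectedComponent.card_le_card_of_le h

theorem SimpleGraph.cc_congr {V : Type*} {G H : SimpleGraph V}
    (h : ∀ u v, G.Reachable u v ↔ H.Reachable u v) : G.cc = H.cc :=
  Nat.card_congr (Quot.congr (Equiv.refl V) (by simpa using h))

open Classical in
theorem SimpleGraph.IsAcyclic.card_add_cc_le {V : Type*} [Fintype V] {F G : SimpleGraph V}
    (hF : F.IsAcyclic) (h : F ≤ G) : F.edgeFinset.card + G.cc ≤ Fintype.card V := by
  have := hF.card_edgeFinset_add_card
  have := SimpleGraph.cc_le_of_le h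
  unfold SimpleGraph.cc at *
  omega

open Classical in
-- A spanning forest of the larger graph loses at most one edge when restricted to `G`, and what
-- remains is acyclic in `G`, hence has at most |V| − cc(G) edges.
theorem SimpleGraph.cc_le_sup_edge {V : Type*} [Fintype V] {G : SimpleGraph V} {u v : V} :
    G.cc ≤ (G ⊔ SimpleGraph.edge u v).cc + 1 := by
  obtain ⟨F, hle, hF, hr⟩ := (G ⊔ SimpleGraph.edge u v).exists_isAcyclic_reachable_eq_le
  have h1 := hF.card_edgeFinset_add_card
  have h2 : Nat.card F.ConnectedComponent = (G ⊔ SimpleGraph.edge u v).cc :=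
    SimpleGraph.cc_congr fun a b => by rw [hr]
  have h3 : (F ⊓ G).IsAcyclic := hF.anti inf_le_left
  have h4 : (F ⊓ G).edgeFinset.card + G.cc ≤ Fintype.card V := by
    convert! h3.card_add_cc_le inf_le_right
  have h5 : F.edgeFinset ⊆ insert s(u, v) (F ⊓ G).edgeFinset := by
    intro e he
    induction e with | _ a b =>
    simp only [SimpleGraph.mem_edgeFinset, SimpleGraph.mem_edgeSet] at he
    have := hle he
    simp only [SimpleGraph.sup_adj, SimpleGraph.edge_adj] at this
    simp only [Finset.mem_insert, SimpleGraph.mem_edgeFinset, SimpleGraph.mem_edgeSet,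
      SimpleGraph.inf_adj]
    rcases this with h | ⟨⟨rfl, rfl⟩ | ⟨rfl, rfl⟩, _⟩
    · exact Or.inr ⟨he, h⟩
    · exact Or.inl rfl
    · exact Or.inl Sym2.eq_swap
  have h6 := (Finset.card_le_card h5).trans (Finset.card_insert_le _ _)
  have h7 : (G ⊔ SimpleGraph.edge u v).cc + F.edgeFinset.card = Fintype.card V := by
    rw [← h2, ← h1, add_comm]
  omega

/-- The number of vertices in the component of `v`. -/
noncomputable def SimpleGraph.compCard {V : Type*} (G : SimpleGraph V) (v : V) : ℕ :=
  {y | G.Reachable v y}.ncard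

theorem SimpleGraph.compCard_pos {V : Type*} [Finite V] (G : SimpleGraph V) (v : V) :
    0 < G.compCard v := by
  refine (Set.ncard_pos (Set.toFinite _)).2 ⟨v, SimpleGraph.Reachable.refl v⟩

theorem SimpleGraph.compCard_mono {V : Type*} [Finite V] {G H : SimpleGraph V} (h : G ≤ H) (v : V) :
    G.compCard v ≤ H.compCard v :=
  Set.ncard_le_ncard (fun _ hy => SimpleGraph.Reachable.mono h hy) (Set.toFinite _)

open Classical in
theorem SimpleGraph.cc_eq_sum {V : Type*} [Fintype V] (G : SimpleGraph V) :
    (G.cc : ℝ) = ∑ v, 1 / (G.compCard v : ℝ) := by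
  rw [← Finset.sum_fiberwise Finset.univ G.connectedComponentMk]
  have : ∀ c : G.ConnectedComponent,
      ∑ v with G.connectedComponentMk v = c, 1 / (G.compCard v : ℝ) = 1 := by
    intro c
    obtain ⟨v₀, rfl⟩ := c.exists_rep
    have h1 : ∀ v ∈ Finset.univ.filter
        (fun v => G.connectedComponentMk v = Quot.mk G.Reachable v₀),
        1 / (G.compCard v : ℝ) = 1 / (G.compCard v₀ : ℝ) := by
      intro v hv
      have : G.Reachable v v₀ := SimpleGraph.ConnectedComponent.exact (Finset.mem_filter.1 hv).2
      have h0 : G.compCard v = G.compCard v₀ := by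
        unfold SimpleGraph.compCard
        congr 1
        ext y
        exact ⟨fun h => this.symm.trans h, fun h => this.trans h⟩
      rw [h0]
    rw [Finset.sum_congr rfl h1, Finset.sum_const, nsmul_eq_mul]
    have h2 : (Finset.univ.filter
        (fun v => G.connectedComponentMk v = Quot.mk G.Reachable v₀)).card = G.compCard v₀ := by
      rw [SimpleGraph.compCard, ← Set.ncard_coe_finset]
      congr 1
      ext y
      simp only [Finset.coe_filter, Finset.mem_univ, true_and, Set.mem_ofPred_eq]
      exact ⟨fun h => (SimpleGraph.ConnectedComponent.exact h).symm,
        fun h => SimpleGraph.ConnectedComponent.sound h.symm⟩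
    rw [h2]
    have := G.compCard_pos v₀
    field_simp
  rw [Finset.sum_congr rfl fun c _ => this c]
  simp [SimpleGraph.cc, Nat.card_eq_fintype_card]

/-! ### Level graphs and the component formula for the weight of a minimum spanning forest -/

namespace WGraph

variable {n : ℕ}

/-- The graph of the edges of weight at most `i`. -/
def level (G : WGraph n) (i : ℕ) : SimpleGraph (Fin n) where
  Adj u v := u ≠ v ∧ 0 < G s(u, v) ∧ G s(u, v) ≤ i
  symm := ⟨fun u v h => ⟨h.1.symm, by rw [Sym2.eq_swap]; exact h.2⟩⟩
  loopless := ⟨fun _ h => h.1 rfl⟩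

theorem level_mono (G : WGraph n) {i j : ℕ} (h : i ≤ j) : G.level i ≤ G.level j :=
  fun _ _ ha => ⟨ha.1, ha.2.1, ha.2.2.trans h⟩

theorem level_eq_graph {G : WGraph n} {W : ℕ} (hG : G.WeightsIn W) : G.level W = G.graph := by
  ext u v
  exact ⟨fun h => ⟨h.1, h.2.1⟩, fun h => ⟨h.1, h.2, hG.2 _⟩⟩

theorem level_le_graph (G : WGraph n) (i : ℕ) : G.level i ≤ G.graph := fun _ _ h => ⟨h.1, h.2.1⟩

open Classical in
-- Double counting: an edge `e` of `F` lies in exactly `W - G e` of the levels 0, …, W − 1.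
theorem weightOf_add_sum {G : WGraph n} {W : ℕ} (hG : G.WeightsIn W) {F : SimpleGraph (Fin n)}
    (hF : F ≤ G.graph) :
    G.weightOf F + ∑ i ∈ Finset.range W, (F ⊓ G.level i).edgeFinset.card
      = W * F.edgeFinset.card := by
  have h1 : ∀ i, (F ⊓ G.level i).edgeFinset = F.edgeFinset.filter (fun e => G e ≤ i) := by
    intro i
    ext e
    induction e with | _ a b =>
    simp only [SimpleGraph.mem_edgeFinset, SimpleGraph.mem_edgeSet, SimpleGraph.inf_adj,
      Finset.mem_filter]
    exact ⟨fun h => ⟨h.1, h.2.2.2⟩, fun h => ⟨h.1, (hF h.1).1, (hF h.1).2, h.2⟩⟩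
  have h2 : ∀ i, (F ⊓ G.level i).edgeFinset.card
      = ∑ e ∈ F.edgeFinset, if G e ≤ i then 1 else 0 := by
    intro i
    rw [h1, Finset.card_filter]
  rw [Finset.sum_congr rfl fun i _ => h2 i, Finset.sum_comm, weightOf, ← Finset.sum_add_distrib]
  rw [Finset.sum_congr rfl (g := fun _ => W), Finset.sum_const, smul_eq_mul, mul_comm]
  intro e _
  rw [← Finset.card_filter]
  have : (Finset.range W).filter (fun i => G e ≤ i) = Finset.Ico (G e) W := by
    ext i; simp [and_comm]
  rw [this, Nat.card_Ico]
  have := hG.2 e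
  omega

/-- Kruskal's algorithm: a forest that spans all levels up to `k` extends to a spanning forest of
level `k + 1`, and enlarging it cannot spoil the lower levels. -/
theorem exists_level_forest (G : WGraph n) (k : ℕ) : ∃ F ≤ G.level k, F.IsAcyclic ∧
    ∀ i ≤ k, (F ⊓ G.level i).Reachable = (G.level i).Reachable := by
  induction k with
  | zero =>
    obtain ⟨F, h1, h2, h3⟩ := (G.level 0).exists_isAcyclic_reachable_eq_le
    refine ⟨F, h1, h2, fun i hi => ?_⟩
    obtain rfl : i = 0 := by omega
    rw [inf_eq_left.2 h1, h3]
  | succ k ih =>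
    obtain ⟨F, h1, h2, h3⟩ := ih
    obtain ⟨F', h4, h5, h6, h7⟩ :=
      SimpleGraph.exists_isAcyclic_reachable_eq_le_of_le_of_isAcyclic
        (h1.trans (G.level_mono (Nat.le_succ k))) h2
    refine ⟨F', h5, h6, fun i hi => ?_⟩
    rcases Nat.lt_or_ge k i with h | h
    · obtain rfl : i = k + 1 := by omega
      rw [inf_eq_left.2 h5, h7]
    · ext u v
      refine ⟨fun hr => hr.mono inf_le_right, fun hr => ?_⟩
      rw [← h3 i h] at hr
      exact hr.mono (inf_le_inf_right _ h4)

/-- For a spanning forest `F`, the part of `F` in level i is acyclic and so has at most n − cc(G_i)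
edges. By `weightOf_add_sum` this bounds the weight of `F` from below, with equality if `F` spans
every level, as the forest of `exists_level_forest` does. -/
theorem msfWeight_add {G : WGraph n} {W : ℕ} (hG : G.WeightsIn W) :
    G.msfWeight + W * (G.level W).cc = ∑ i ∈ Finset.range W, (G.level i).cc := by
  classical
  have key : ∀ F, G.IsSpanningForest F →
      ∑ i ∈ Finset.range W, (G.level i).cc ≤ G.weightOf F + W * (G.level W).cc ∧
      ((∀ i < W, (F ⊓ G.level i).Reachable = (G.level i).Reachable) →
      ∑ i ∈ Finset.range W, (G.level i).cc = G.weightOf F + W * (G.level W).cc) := by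
    intro F hF
    have h1 := weightOf_add_sum hG hF.1
    have h2 := hF.2.1.card_edgeFinset_add_card
    have h3 : Nat.card F.ConnectedComponent = (G.level W).cc :=
      SimpleGraph.cc_congr fun u v => by rw [hF.2.2, level_eq_graph hG]
    rw [h3, Fintype.card_fin] at h2
    have h4 : ∑ i ∈ Finset.range W, n = W * n := by simp
    rw [← h2, mul_add, ← h1] at h4
    have hac : ∀ i, (F ⊓ G.level i).IsAcyclic := fun i => hF.2.1.anti inf_le_left
    constructor
    · have h5 : ∑ i ∈ Finset.range W, ((F ⊓ G.level i).edgeFinset.card + (G.level i).cc)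
          ≤ ∑ i ∈ Finset.range W, n := by
        refine Finset.sum_le_sum fun i _ => ?_
        simpa using (hac i).card_add_cc_le inf_le_right
      rw [Finset.sum_add_distrib] at h5
      rw [h2] at h4
      omega
    · intro h
      have h5 : ∑ i ∈ Finset.range W, ((F ⊓ G.level i).edgeFinset.card + (G.level i).cc)
          = ∑ i ∈ Finset.range W, n := by
        refine Finset.sum_congr rfl fun i hi => ?_
        have := (hac i).card_edgeFinset_add_card
        rw [Fintype.card_fin] at this
        have h6 : (F ⊓ G.level i).cc = (G.level i).cc :=
          SimpleGraph.cc_congr fun u v => by rw [h i (Finset.mem_range.1 hi)]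
        rw [← h6]
        convert! this
      rw [Finset.sum_add_distrib] at h5
      rw [h2] at h4
      omega
  obtain ⟨F₀, hF₀, hw, hmin⟩ := G.exists_minimum_spanningForest
  obtain ⟨F, hle, hac, hr⟩ := G.exists_level_forest W
  have hsp : G.IsSpanningForest F := by
    refine ⟨hle.trans (G.level_le_graph W), hac, fun u v => ?_⟩
    have := hr W le_rfl
    rw [inf_eq_left.2 hle, level_eq_graph hG] at this
    rw [this]
  have h1 := (key F₀ hF₀).1
  have h2 := (key F hsp).2 fun i hi => hr i hi.le
  have h3 := hmin F hsp
  omega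

/-- The contribution of a vertex to the weight of a minimum spanning forest. -/
noncomputable def contrib (G : WGraph n) (W : ℕ) (v : Fin n) : ℝ :=
  ∑ i ∈ Finset.range W, (1 / ((G.level i).compCard v : ℝ) - 1 / ((G.level W).compCard v : ℝ))

theorem msfWeight_eq_sum {G : WGraph n} {W : ℕ} (hG : G.WeightsIn W) :
    (G.msfWeight : ℝ) = ∑ v, G.contrib W v := by
  have h := congrArg (Nat.cast (R := ℝ)) (msfWeight_add hG)
  push_cast at h
  rw [← eq_sub_iff_add_eq] at h
  rw [h]
  simp only [contrib, SimpleGraph.cc_eq_sum, Finset.sum_sub_distrib]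
  rw [Finset.sum_comm]
  simp [Finset.mul_sum]

theorem contrib_term_nonneg (G : WGraph n) {W i : ℕ} (hi : i ≤ W) (v : Fin n) :
    0 ≤ 1 / ((G.level i).compCard v : ℝ) - 1 / ((G.level W).compCard v : ℝ) := by
  rw [sub_nonneg]
  have := (G.level i).compCard_pos v
  exact one_div_le_one_div_of_le (by positivity)
    (by exact_mod_cast SimpleGraph.compCard_mono (G.level_mono hi) v)

/-- The term i = 0 suffices: level 0 has no edges, so there the component is a single vertex, while
at level W it has at least two vertices. -/
theorem half_le_contrib {G : WGraph n} {W : ℕ} (hW : 1 ≤ W) (hG : G.WeightsIn W) {v : Fin n}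
    (hv : ∃ u, G.graph.Adj v u) : 1 / 2 ≤ G.contrib W v := by
  have h0 : (G.level 0).compCard v = 1 := by
    rw [SimpleGraph.compCard, Set.ncard_eq_one]
    refine ⟨v, ?_⟩
    have : G.level 0 = ⊥ := by
      ext a b
      simp only [level, SimpleGraph.bot_adj, iff_false]
      omega
    ext y
    simp [this, eq_comm]
  have h1 : 2 ≤ (G.level W).compCard v := by
    obtain ⟨u, hu⟩ := hv
    rw [level_eq_graph hG]
    have : ({v, u} : Set (Fin n)) ⊆ {y | G.graph.Reachable v y} := by
      rintro y (rfl | rfl)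
      · exact SimpleGraph.Reachable.refl _
      · exact hu.reachable
    calc 2 = ({v, u} : Set (Fin n)).ncard := (Set.ncard_pair hu.1).symm
      _ ≤ _ := Set.ncard_le_ncard this (Set.toFinite _)
  have h2 := Finset.single_le_sum (f := fun i =>
      1 / ((G.level i).compCard v : ℝ) - 1 / ((G.level W).compCard v : ℝ))
    (fun i hi => G.contrib_term_nonneg (Finset.mem_range.1 hi).le v) (Finset.mem_range.2 hW)
  refine le_trans ?_ h2
  simp only [h0]
  have : (1 : ℝ) / ((G.level W).compCard v : ℝ) ≤ 1 / 2 :=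
    one_div_le_one_div_of_le (by norm_num) (by exact_mod_cast h1)
  norm_num at *
  linarith

open Classical in
/-- The set of non-isolated vertices. -/
noncomputable def nonIsolated (G : WGraph n) : Finset (Fin n) :=
  Finset.univ.filter fun v => ∃ u, G.graph.Adj v u

theorem mem_nonIsolated {G : WGraph n} {v : Fin n} :
    v ∈ G.nonIsolated ↔ ∃ u, G.graph.Adj v u := by simp [nonIsolated]

theorem nis_eq_card (G : WGraph n) : G.nis = G.nonIsolated.card := by
  rw [nis, ← Set.ncard_coe_finset]
  congr 1
  ext v
  simp [mem_nonIsolated]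

theorem contrib_eq_zero {G : WGraph n} {W : ℕ} {v : Fin n}
    (hv : v ∉ G.nonIsolated) : G.contrib W v = 0 := by
  have h : ∀ i, (G.level i).compCard v = 1 := by
    intro i
    rw [SimpleGraph.compCard, Set.ncard_eq_one]
    refine ⟨v, ?_⟩
    ext y
    simp only [Set.mem_ofPred_eq, Set.mem_singleton_iff]
    refine ⟨fun h => ?_, fun h => h ▸ SimpleGraph.Reachable.refl _⟩
    by_contra hne
    obtain ⟨w⟩ := h
    cases w with
    | nil => exact hne rfl
    | cons ha _ => exact hv (mem_nonIsolated.2 ⟨_, G.level_le_graph i ha⟩)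
  simp [contrib, h]

theorem msfWeight_eq_sum_nonIsolated {G : WGraph n} {W : ℕ} (hG : G.WeightsIn W) :
    (G.msfWeight : ℝ) = ∑ v ∈ G.nonIsolated, G.contrib W v := by
  rw [msfWeight_eq_sum hG]
  exact (Finset.sum_subset (Finset.subset_univ _) fun v _ hv => contrib_eq_zero hv).symm

theorem nis_le_two_mul_msfWeight {G : WGraph n} {W : ℕ} (hW : 1 ≤ W) (hG : G.WeightsIn W) :
    (G.nis : ℝ) ≤ 2 * G.msfWeight := by
  rw [msfWeight_eq_sum_nonIsolated hG, nis_eq_card]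
  have : ∑ v ∈ G.nonIsolated, (1 / 2 : ℝ) ≤ ∑ v ∈ G.nonIsolated, G.contrib W v :=
    Finset.sum_le_sum fun v hv => half_le_contrib hW hG (mem_nonIsolated.1 hv)
  simp at this
  linarith

theorem msfWeight_eq_zero {G : WGraph n} {W : ℕ} (hG : G.WeightsIn W) (h : G.nis = 0) :
    G.msfWeight = 0 := by
  have := msfWeight_eq_sum_nonIsolated hG
  rw [nis_eq_card, Finset.card_eq_zero] at h
  simpa [h] using this

/-- The weighted graphs `G` and `H` differ in the edge `ab` only. -/
def DiffAt (G H : WGraph n) (a b : Fin n) : Prop := ∀ e, e ≠ s(a, b) → G e = H e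

theorem DiffAt.symm {G H : WGraph n} {a b : Fin n} (h : DiffAt G H a b) : DiffAt H G a b :=
  fun e he => (h e he).symm

theorem DiffAt.level_le {G H : WGraph n} {a b : Fin n} (h : DiffAt G H a b) (i : ℕ) :
    H.level i ≤ G.level i ⊔ SimpleGraph.edge a b := by
  intro u v huv
  rw [SimpleGraph.sup_adj, SimpleGraph.edge_adj]
  by_cases he : s(u, v) = s(a, b)
  · right
    rcases Sym2.eq_iff.1 he with ⟨rfl, rfl⟩ | ⟨rfl, rfl⟩
    · exact ⟨Or.inl ⟨rfl, rfl⟩, huv.1⟩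
    · exact ⟨Or.inr ⟨rfl, rfl⟩, huv.1⟩
  · left
    have := h _ he
    simp only [level] at huv ⊢
    rw [this]
    exact huv

theorem DiffAt.cc_le {G H : WGraph n} {a b : Fin n} (h : DiffAt G H a b) (i : ℕ) :
    (G.level i).cc ≤ (H.level i).cc + 1 :=
  SimpleGraph.cc_le_sup_edge.trans
    (Nat.add_le_add_right (SimpleGraph.cc_le_of_le (h.level_le i)) 1)

/-- In `msfWeight_add` one edge changes each of the `W` counts on the right, and the count
multiplied by `W` on the left, by at most one. -/
theorem DiffAt.msfWeight_le {G H : WGraph n} {a b : Fin n} {W : ℕ} (h : DiffAt G H a b)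
    (hG : G.WeightsIn W) (hH : H.WeightsIn W) : G.msfWeight ≤ H.msfWeight + 2 * W := by
  have h1 := msfWeight_add hG
  have h2 := msfWeight_add hH
  have h3 : ∑ i ∈ Finset.range W, (G.level i).cc ≤ ∑ i ∈ Finset.range W, ((H.level i).cc + 1) :=
    Finset.sum_le_sum fun i _ => h.cc_le i
  rw [Finset.sum_add_distrib] at h3
  simp only [Finset.sum_const, Finset.card_range, smul_eq_mul, mul_one] at h3
  have h4 := Nat.mul_le_mul_left W (h.symm.cc_le W)
  rw [mul_add] at h4
  omega

theorem DiffAt.nis_le {G H : WGraph n} {a b : Fin n} (h : DiffAt G H a b) :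
    G.nis ≤ H.nis + 2 := by
  classical
  rw [nis_eq_card, nis_eq_card]
  have : G.nonIsolated ⊆ insert a (insert b H.nonIsolated) := by
    intro v hv
    obtain ⟨u, hu⟩ := mem_nonIsolated.1 hv
    simp only [Finset.mem_insert, mem_nonIsolated]
    by_cases he : s(v, u) = s(a, b)
    · rcases Sym2.eq_iff.1 he with ⟨rfl, rfl⟩ | ⟨rfl, rfl⟩ <;> simp
    · refine Or.inr (Or.inr ⟨u, hu.1, ?_⟩)
      rw [← h _ he]
      exact hu.2
  have h1 := Finset.card_le_card this
  have h2 := Finset.card_insert_le a (insert b H.nonIsolated)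
  have h3 := Finset.card_insert_le b H.nonIsolated
  omega

end WGraph

theorem Update.diffAt_apply {n : ℕ} (G : WGraph n) (u : Update n) :
    ∃ a b, WGraph.DiffAt G (u.apply G) a b := by
  cases u with
  | insert a b c => exact ⟨a, b, fun e he => by simp [Update.apply, Function.update_of_ne he]⟩
  | delete a b => exact ⟨a, b, fun e he => by simp [Update.apply, Function.update_of_ne he]⟩

/-! ## Expectations and the big-step semantics of the word RAM -/

namespace PMF

variable {α β : Type*}

/-- The expectation of a nonnegative function. -/
noncomputable def expect (μ : PMF α) (f : α → ℝ≥0∞) : ℝ≥0∞ := ∑' a, μ a * f a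

theorem expect_pure (a : α) (f : α → ℝ≥0∞) : (PMF.pure a).expect f = f a := by
  classical
  rw [expect, tsum_eq_single a]
  · simp
  · intro b hb; simp [PMF.pure_apply, hb]

theorem expect_bind (μ : PMF α) (ν : α → PMF β) (f : β → ℝ≥0∞) :
    (μ.bind ν).expect f = μ.expect fun a => (ν a).expect f := by
  simp only [expect, PMF.bind_apply, ← ENNReal.tsum_mul_right, ← ENNReal.tsum_mul_left]
  rw [ENNReal.tsum_comm]
  simp [mul_assoc]

theorem expect_map (μ : PMF α) (g : α → β) (f : β → ℝ≥0∞) :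
    (μ.map g).expect f = μ.expect fun a => f (g a) := by
  simp [PMF.map, expect_bind, expect_pure]

theorem expect_mono {μ : PMF α} {f g : α → ℝ≥0∞} (h : ∀ a ∈ μ.support, f a ≤ g a) :
    μ.expect f ≤ μ.expect g := by
  refine ENNReal.tsum_le_tsum fun a => ?_
  by_cases ha : a ∈ μ.support
  · exact mul_le_mul_right (h a ha) _
  · simp [(PMF.apply_eq_zero_iff μ a).2 ha]

theorem expect_const (μ : PMF α) (c : ℝ≥0∞) : (μ.expect fun _ => c) = c := by
  simp [expect, ENNReal.tsum_mul_right, PMF.tsum_coe]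

theorem le_expect {μ : PMF α} {f : α → ℝ≥0∞} {c : ℝ≥0∞} (h : ∀ a ∈ μ.support, c ≤ f a) :
    c ≤ μ.expect f := by
  rw [← expect_const μ c]
  exact expect_mono h

theorem bind_congr_support {μ : PMF α} {f g : α → PMF β} (h : ∀ a ∈ μ.support, f a = g a) :
    μ.bind f = μ.bind g := by
  ext b
  simp only [PMF.bind_apply]
  refine tsum_congr fun a => ?_
  by_cases ha : a ∈ μ.support
  · rw [h a ha]
  · simp [(PMF.apply_eq_zero_iff μ a).2 ha]

theorem expect_indicator (μ : PMF α) (s : Set α) [DecidablePred (· ∈ s)] :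
    (μ.expect fun a => if a ∈ s then 1 else 0) = μ.toOuterMeasure s := by
  rw [PMF.toOuterMeasure_apply, expect]
  refine tsum_congr fun a => ?_
  by_cases h : a ∈ s <;> simp [h]

end PMF

/-! ### Rules for running time, possible outcomes and expectations of commands -/

namespace RAM

variable {w : ℕ}

theorem run_halted (T : ℕ) (s : Store) : run w T ([], s) = PMF.pure ([], s) := by
  induction T with
  | zero => rfl
  | succ T ih => simp [run, step, ih]

theorem run_add (T m : ℕ) (x : Config) : run w (T + m) x = (run w T x).bind (run w m) := by
  induction T generalizing x with
  | zero => simp [run]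
  | succ T ih =>
    rw [Nat.succ_add, run, run, PMF.bind_bind]
    congr 1
    funext y
    exact ih y

/-- The configuration `x` halts within `T` steps, with a final store distributed as `ν`. -/
def Settles (w : ℕ) (x : Config) (T : ℕ) (ν : PMF Store) : Prop :=
  run w T x = ν.map fun s => ([], s)

theorem settles_nil (s : Store) (T : ℕ) : Settles w ([], s) T (PMF.pure s) := by
  rw [Settles, run_halted, PMF.pure_map]

theorem Settles.mono {x : Config} {T T' : ℕ} {ν : PMF Store} (h : Settles w x T ν) (hT : T ≤ T') :
    Settles w x T' ν := by
  obtain ⟨m, rfl⟩ := Nat.exists_eq_add_of_le hT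
  rw [Settles, run_add, h, PMF.bind_map, PMF.map]
  congr 1
  funext s
  simp [run_halted]

theorem settles_step {x : Config} {κ : PMF Config} {T : ℕ} {ν : Config → PMF Store}
    (hx : step w x = κ) (h : ∀ y ∈ κ.support, Settles w y T (ν y)) :
    Settles w x (T + 1) (κ.bind ν) := by
  rw [Settles, run, hx, PMF.map_bind]
  exact PMF.bind_congr_support h

theorem settles_step_pure {x y : Config} {T : ℕ} {ν : PMF Store}
    (hx : step w x = PMF.pure y) (h : Settles w y T ν) : Settles w x (T + 1) ν := by
  have := settles_step (ν := fun _ => ν) hx (T := T) (by simpa using h)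
  simpa using this

/-- Started on `s`, the command `c` halts within `T` steps, with a final store distributed
as `μ`. -/
def Big (w : ℕ) (c : Cmd) (s : Store) (T : ℕ) (μ : PMF Store) : Prop :=
  ∀ k m (ν : Store → PMF Store), (∀ s' ∈ μ.support, Settles w (k, s') m (ν s')) →
    Settles w (c :: k, s) (T + m) (μ.bind ν)

theorem Big.mono {c : Cmd} {s : Store} {T T' : ℕ} {μ : PMF Store} (h : Big w c s T μ)
    (hT : T ≤ T') : Big w c s T' μ := fun k m ν hν =>
  (h k m ν hν).mono (Nat.add_le_add_right hT m)

theorem big_of_step_pure {c : Cmd} {s s' : Store}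
    (h : ∀ k, step w (c :: k, s) = PMF.pure (k, s')) : Big w c s 1 (PMF.pure s') := by
  intro k m ν hν
  rw [PMF.pure_bind, add_comm]
  exact settles_step_pure (h k) (hν s' (by simp))

theorem big_assign (x : ℕ) (e : Expr) (s : Store) :
    Big w (.assign x e) s 1 (PMF.pure (s.setReg x (e.eval w s))) :=
  big_of_step_pure fun _ => rfl

theorem big_write (a : ℕ) (i e : Expr) (s : Store) :
    Big w (.write a i e) s 1 (PMF.pure (s.setArr a (i.eval w s) (e.eval w s))) :=
  big_of_step_pure fun _ => rfl

theorem big_rand (x : ℕ) (e : Expr) (s : Store) :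
    Big w (.rand x e) s 1 ((uniformBelow (e.eval w s)).map fun v => s.setReg x v) := by
  intro k m ν hν
  rw [add_comm, PMF.bind_map]
  have h : step w (.rand x e :: k, s)
      = (uniformBelow (e.eval w s)).map fun v => (k, s.setReg x v) := rfl
  have := settles_step (T := m) (ν := fun y => ν y.2) h (by
    intro y hy
    rw [PMF.support_map] at hy
    obtain ⟨v, hv, rfl⟩ := hy
    refine hν _ ?_
    rw [PMF.support_map]
    exact ⟨v, hv, rfl⟩)
  rwa [PMF.bind_map] at this

/-- Since `Big` quantifies over all continuations, `d` can simply be absorbed into the continuation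
of `c`. -/
theorem big_seq {c d : Cmd} {s : Store} {T₁ T₂ : ℕ} {μ : PMF Store} {ν : Store → PMF Store}
    (hc : Big w c s T₁ μ) (hd : ∀ s' ∈ μ.support, Big w d s' T₂ (ν s')) :
    Big w (.seq c d) s (T₁ + T₂ + 1) (μ.bind ν) := by
  intro k m ξ hξ
  have h1 := hc (d :: k) (T₂ + m) (fun s' => (ν s').bind ξ) fun s' hs' =>
    hd s' hs' k m ξ fun s'' hs'' => hξ s'' (by
      rw [PMF.support_bind]
      exact Set.mem_iUnion₂.2 ⟨s', hs', hs''⟩)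
  rw [PMF.bind_bind]
  have h2 := settles_step_pure (w := w) (x := (.seq c d :: k, s)) rfl h1
  exact h2.mono (by omega)

theorem big_ite {e : Expr} {c d : Cmd} {s : Store} {T : ℕ} {μ : PMF Store}
    (h : Big w (if e.eval w s ≠ 0 then c else d) s T μ) : Big w (.ite e c d) s (T + 1) μ := by
  intro k m ξ hξ
  exact (settles_step_pure (w := w) (x := (.ite e c d :: k, s)) rfl (h k m ξ hξ)).mono (by omega)

theorem big_loop_of_eq {e : Expr} {c : Cmd} {s : Store} (he : e.eval w s = 0) :
    Big w (.loop e c) s 1 (PMF.pure s) :=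
  big_of_step_pure fun k => by simp [step, he]

theorem big_loop_of_ne {e : Expr} {c : Cmd} {s : Store} (he : e.eval w s ≠ 0) {T₁ T₂ : ℕ}
    {μ : PMF Store} {ν : Store → PMF Store}
    (hc : Big w c s T₁ μ) (hd : ∀ s' ∈ μ.support, Big w (.loop e c) s' T₂ (ν s')) :
    Big w (.loop e c) s (T₁ + T₂ + 1) (μ.bind ν) := by
  intro k m ξ hξ
  have h1 := hc (.loop e c :: k) (T₂ + m) (fun s' => (ν s').bind ξ) fun s' hs' =>
    hd s' hs' k m ξ fun s'' hs'' => hξ s'' (by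
      rw [PMF.support_bind]
      exact Set.mem_iUnion₂.2 ⟨s', hs', hs''⟩)
  rw [PMF.bind_bind]
  refine Settles.mono (settles_step_pure (y := (c :: .loop e c :: k, s)) ?_ h1) (by omega)
  simp [step, he]

/-- A halted configuration no longer changes, so running for `haltTime` steps and for the possibly
larger `T` steps gives the same distribution. -/
theorem Big.halts_exec {c : Cmd} {s : Store} {T : ℕ} {μ : PMF Store} (h : Big w c s T μ) :
    HaltsWithin w c s T ∧ exec w c s = μ := by
  have h1 : run w T ([c], s) = μ.map fun s => ([], s) := by
    have := h [] 0 PMF.pure fun s' _ => settles_nil s' 0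
    rwa [PMF.bind_pure] at this
  have h2 : HaltsWithin w c s T := by
    intro x hx
    rw [h1, PMF.support_map] at hx
    obtain ⟨s', _, rfl⟩ := hx
    rfl
  refine ⟨h2, ?_⟩
  have h3 : HaltsWithin w c s (haltTime w c s) := Nat.sInf_mem (s := {T | HaltsWithin w c s T}) ⟨T, h2⟩
  have h4 : haltTime w c s ≤ T := Nat.sInf_le h2
  obtain ⟨m, hm⟩ := Nat.exists_eq_add_of_le h4
  have h5 : run w T ([c], s) = run w (haltTime w c s) ([c], s) := by
    rw [hm, run_add]
    conv_rhs => rw [← PMF.bind_pure (run w (haltTime w c s) ([c], s))]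
    refine PMF.bind_congr_support fun x hx => ?_
    have := h3 x hx
    obtain ⟨l, s'⟩ := x
    obtain rfl : l = [] := this
    exact run_halted m s'
  rw [exec, ← h5, h1, PMF.map_comp]
  exact PMF.map_id μ

/-- From the store `s`, the command `c` runs for at most `T` steps, ends in stores that satisfy `P`,
and the final expectation of `f` is at least `v`. -/
def Tr (w : ℕ) (c : Cmd) (s : Store) (T : ℕ) (P : Store → Prop) (f : Store → ℝ≥0∞) (v : ℝ≥0∞) :
    Prop :=
  ∃ μ, Big w c s T μ ∧ (∀ s' ∈ μ.support, P s') ∧ v ≤ μ.expect f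

theorem Tr.mono {c : Cmd} {s : Store} {T T' : ℕ} {P P' : Store → Prop} {f f' : Store → ℝ≥0∞}
    {v v' : ℝ≥0∞} (h : Tr w c s T P f v) (hT : T ≤ T') (hP : ∀ s, P s → P' s)
    (hf : ∀ s, P s → f s ≤ f' s) (hv : v' ≤ v) : Tr w c s T' P' f' v' := by
  obtain ⟨μ, h1, h2, h3⟩ := h
  exact ⟨μ, h1.mono hT, fun s' hs' => hP _ (h2 s' hs'),
    hv.trans (h3.trans (PMF.expect_mono fun s' hs' => hf _ (h2 s' hs')))⟩

theorem Big.tr {c : Cmd} {s s' : Store} {T : ℕ} {P : Store → Prop} {f : Store → ℝ≥0∞} {v : ℝ≥0∞}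
    (h : Big w c s T (PMF.pure s')) (hP : P s') (hf : v ≤ f s') : Tr w c s T P f v :=
  ⟨_, h, by simpa using hP, by rwa [PMF.expect_pure]⟩

theorem exists_bind_of_tr {d : Cmd} {T₂ : ℕ} {μ : PMF Store} {P Q : Store → Prop}
    {f g : Store → ℝ≥0∞} (hP : ∀ s' ∈ μ.support, P s')
    (hd : ∀ s', P s' → Tr w d s' T₂ Q g (f s')) :
    ∃ ν : Store → PMF Store, (∀ s' ∈ μ.support, Big w d s' T₂ (ν s')) ∧
      (∀ s' ∈ (μ.bind ν).support, Q s') ∧ μ.expect f ≤ (μ.bind ν).expect g := by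
  classical
  choose! ν h1 h2 h3 using hd
  refine ⟨ν, fun s' hs' => h1 s' (hP s' hs'), fun s' hs' => ?_, ?_⟩
  · rw [PMF.support_bind] at hs'
    obtain ⟨s'', h, h'⟩ := Set.mem_iUnion₂.1 hs'
    exact h2 s'' (hP _ h) s' h'
  · rw [PMF.expect_bind]
    exact PMF.expect_mono fun s' hs' => h3 s' (hP s' hs')

theorem Tr.seq {c d : Cmd} {s : Store} {T₁ T₂ : ℕ} {P Q : Store → Prop}
    {f g : Store → ℝ≥0∞} {v : ℝ≥0∞} (hc : Tr w c s T₁ P f v)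
    (hd : ∀ s', P s' → Tr w d s' T₂ Q g (f s')) : Tr w (.seq c d) s (T₁ + T₂ + 1) Q g v := by
  obtain ⟨μ, h1, h2, h3⟩ := hc
  obtain ⟨ν, h4, h5, h6⟩ := exists_bind_of_tr h2 hd
  exact ⟨_, big_seq h1 h4, h5, h3.trans h6⟩

theorem Tr.ite {e : Expr} {c d : Cmd} {s : Store} {T : ℕ} {P : Store → Prop}
    {f : Store → ℝ≥0∞} {v : ℝ≥0∞} (h1 : e.eval w s ≠ 0 → Tr w c s T P f v)
    (h2 : e.eval w s = 0 → Tr w d s T P f v) : Tr w (.ite e c d) s (T + 1) P f v := by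
  by_cases h : e.eval w s = 0
  · obtain ⟨μ, a, b⟩ := h2 h
    exact ⟨μ, big_ite (by simpa [h] using a), b⟩
  · obtain ⟨μ, a, b⟩ := h1 h
    exact ⟨μ, big_ite (by simpa [h] using a), b⟩

theorem uniformBelow_support {m : ℕ} (hm : 0 < m) {v : ℕ} (hv : v ∈ (uniformBelow m).support) :
    v < m := by
  rw [uniformBelow, dif_neg hm.ne'] at hv
  simpa using hv

theorem expect_uniformBelow {m : ℕ} (hm : 0 < m) (f : ℕ → ℝ≥0∞) :
    (uniformBelow m).expect f = (∑ v ∈ Finset.range m, f v) / m := by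
  rw [uniformBelow, dif_neg hm.ne', PMF.expect, tsum_eq_sum (s := Finset.range m)]
  · rw [div_eq_mul_inv, Finset.sum_mul]
    refine Finset.sum_congr rfl fun v hv => ?_
    rw [PMF.uniformOfFinset_apply_of_mem _ hv, Finset.card_range, mul_comm]
  · intro v hv
    rw [PMF.uniformOfFinset_apply_of_notMem _ hv, zero_mul]

theorem tr_rand {x : ℕ} {e : Expr} {s : Store} {P : Store → Prop} {f : Store → ℝ≥0∞} {v : ℝ≥0∞}
    (hm : 0 < e.eval w s) (hP : ∀ i < e.eval w s, P (s.setReg x i))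
    (hv : v ≤ (∑ i ∈ Finset.range (e.eval w s), f (s.setReg x i)) / (e.eval w s : ℕ)) :
    Tr w (.rand x e) s 1 P f v := by
  refine ⟨_, big_rand x e s, ?_, ?_⟩
  · intro s' hs'
    rw [PMF.support_map] at hs'
    obtain ⟨i, hi, rfl⟩ := hs'
    exact hP i (uniformBelow_support hm hi)
  · rw [PMF.expect_map, expect_uniformBelow hm]
    exact hv

/-- Run `c` as many times as register `x` says, counting down in `x`. -/
def Cmd.repeat (x : ℕ) (c : Cmd) : Cmd :=
  .loop (.reg x) (.seq (.assign x (.op .sub (.reg x) (.const 1))) c)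

/-- Each round keeps the expectation of one fixed function `f` from dropping, so the bound passes
through all rounds. A round costs three extra steps, for the test, the sequencing and the decrement;
the last test costs one more. -/
theorem tr_repeat {x : ℕ} {c : Cmd} {T : ℕ} {I : ℕ → Store → Prop} {f : Store → ℝ≥0∞}
    (hc : ∀ m s, m + 1 < 2 ^ w → s.reg x = m + 1 → I (m + 1) s →
      Tr w c (s.setReg x m) T (fun s' => I m s' ∧ s'.reg x = m) f (f s))
    (m : ℕ) (hm : m < 2 ^ w) (s : Store) (hs : s.reg x = m) (hI : I m s) :
    Tr w (c.repeat x) s (m * (T + 3) + 1) (fun s' => I 0 s' ∧ s'.reg x = 0) f (f s) := by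
  induction m generalizing s with
  | zero =>
    exact ((big_loop_of_eq (by simpa [Expr.eval] using hs)).mono (by omega)).tr ⟨hI, hs⟩ le_rfl
  | succ m ih =>
    have h1 : (Expr.op .sub (.reg x) (.const 1)).eval w s = m := by
      have : 1 % 2 ^ w = 1 := Nat.mod_eq_of_lt (by omega)
      simp [Expr.eval, Op.eval, hs, this]
      exact Nat.mod_eq_of_lt (by omega)
    have h2 : Tr w (.seq (.assign x (.op .sub (.reg x) (.const 1))) c) s (1 + T + 1)
        (fun s' => I m s' ∧ s'.reg x = m) f (f s) := by
      refine Tr.seq (P := fun s' => s' = s.setReg x m) (f := fun _ => f s)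
        ((big_assign x _ s).tr (by rw [h1]) le_rfl) ?_
      rintro s' rfl
      exact hc m s hm hs hI
    obtain ⟨μ, h3, h4, h5⟩ := h2
    obtain ⟨ν, h6, h7, h8⟩ := exists_bind_of_tr h4 fun s' hs' => ih (by omega) s' hs'.2 hs'.1
    refine ⟨_, (big_loop_of_ne (by simp [Expr.eval, hs]) h3 h6).mono ?_, h7, h5.trans h8⟩
    rw [Nat.succ_mul]
    omega

/-! ### Straight-line code -/

/-- The command contains no loops and no random choices. -/
def Cmd.IsDet : Cmd → Bool
  | .assign _ _ => true
  | .write _ _ _ => true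
  | .rand _ _ => false
  | .seq c d => c.IsDet && d.IsDet
  | .ite _ c d => c.IsDet && d.IsDet
  | .loop _ _ => false

/-- The effect of a command without loops and random choices. -/
def Cmd.det (w : ℕ) : Cmd → Store → Store
  | .assign x e, s => s.setReg x (e.eval w s)
  | .write a i e, s => s.setArr a (i.eval w s) (e.eval w s)
  | .rand _ _, s => s
  | .seq c d, s => d.det w (c.det w s)
  | .ite e c d, s => if e.eval w s ≠ 0 then c.det w s else d.det w s
  | .loop _ _, s => s

theorem Cmd.det_seq (w : ℕ) (c d : Cmd) (s : Store) :
    (Cmd.seq c d).det w s = d.det w (c.det w s) := rfl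

/-- A bound for the running time of a command without loops. -/
def Cmd.cost : Cmd → ℕ
  | .assign _ _ => 1
  | .write _ _ _ => 1
  | .rand _ _ => 1
  | .seq c d => c.cost + d.cost + 1
  | .ite _ c d => max c.cost d.cost + 1
  | .loop _ _ => 0

theorem big_det {c : Cmd} (hc : c.IsDet = true) (s : Store) :
    Big w c s c.cost (PMF.pure (c.det w s)) := by
  induction c generalizing s with
  | assign x e => exact big_assign x e s
  | write a i e => exact big_write a i e s
  | rand x e => simp [Cmd.IsDet] at hc
  | seq c d ihc ihd =>
    simp only [Cmd.IsDet, Bool.and_eq_true] at hc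
    have := big_seq (ν := fun s' => PMF.pure (d.det w s')) (ihc hc.1 s) fun s' _ => ihd hc.2 s'
    rwa [PMF.pure_bind] at this
  | ite e c d ihc ihd =>
    simp only [Cmd.IsDet, Bool.and_eq_true] at hc
    refine big_ite ?_
    by_cases h : e.eval w s = 0
    · simpa [Cmd.det, h] using (ihd hc.2 s).mono (le_max_right _ _)
    · simpa [Cmd.det, h] using (ihc hc.1 s).mono (le_max_left _ _)
  | loop e c => simp [Cmd.IsDet] at hc

theorem tr_det {c : Cmd} (hc : c.IsDet = true) {s : Store} {P : Store → Prop}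
    {f : Store → ℝ≥0∞} {v : ℝ≥0∞} (hP : P (c.det w s)) (hf : v ≤ f (c.det w s)) :
    Tr w c s c.cost P f v := (big_det hc s).tr hP hf

/-- Does the command assign to register `r`? -/
def Cmd.modReg (r : ℕ) : Cmd → Bool
  | .assign x _ => x == r
  | .write _ _ _ => false
  | .rand x _ => x == r
  | .seq c d => c.modReg r || d.modReg r
  | .ite _ c d => c.modReg r || d.modReg r
  | .loop _ c => c.modReg r

/-- Does the command write to array `a`? -/
def Cmd.modArr (a : ℕ) : Cmd → Bool
  | .assign _ _ => false
  | .write x _ _ => x == a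
  | .rand _ _ => false
  | .seq c d => c.modArr a || d.modArr a
  | .ite _ c d => c.modArr a || d.modArr a
  | .loop _ c => c.modArr a

@[simp] theorem Store.setReg_reg (s : Store) (x v r : ℕ) :
    (s.setReg x v).reg r = if r = x then v else s.reg r := by
  simp [Store.setReg, Function.update_apply]

@[simp] theorem Store.setReg_arr (s : Store) (x v : ℕ) : (s.setReg x v).arr = s.arr := rfl

@[simp] theorem Store.setArr_reg (s : Store) (a i v : ℕ) : (s.setArr a i v).reg = s.reg := rfl

@[simp] theorem Store.setArr_arr (s : Store) (a i v b j : ℕ) :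
    (s.setArr a i v).arr b j = if b = a ∧ j = i then v else s.arr b j := by
  by_cases h : b = a
  · subst h
    simp [Store.setArr, Function.update_apply]
  · simp [Store.setArr, h]

theorem Cmd.det_reg {c : Cmd} {r : ℕ} (hc : c.modReg r = false) (s : Store) :
    (c.det w s).reg r = s.reg r := by
  induction c generalizing s with
  | assign x e =>
    simp only [Cmd.modReg, beq_eq_false_iff_ne] at hc
    simp [Cmd.det, Ne.symm hc]
  | write a i e => simp [Cmd.det]
  | rand x e => rfl
  | seq c d ihc ihd =>
    simp only [Cmd.modReg, Bool.or_eq_false_iff] at hc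
    simp [Cmd.det, ihc hc.1, ihd hc.2]
  | ite e c d ihc ihd =>
    simp only [Cmd.modReg, Bool.or_eq_false_iff] at hc
    simp only [Cmd.det]
    split_ifs
    · exact ihc hc.1 s
    · exact ihd hc.2 s
  | loop e c => rfl

theorem Cmd.det_arr {c : Cmd} {a : ℕ} (hc : c.modArr a = false) (s : Store) :
    (c.det w s).arr a = s.arr a := by
  induction c generalizing s with
  | assign x e => rfl
  | write b i e =>
    simp only [Cmd.modArr, beq_eq_false_iff_ne] at hc
    funext j
    simp [Cmd.det, Ne.symm hc]
  | rand x e => rfl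
  | seq c d ihc ihd =>
    simp only [Cmd.modArr, Bool.or_eq_false_iff] at hc
    simp [Cmd.det, ihc hc.1, ihd hc.2]
  | ite e c d ihc ihd =>
    simp only [Cmd.modArr, Bool.or_eq_false_iff] at hc
    simp only [Cmd.det]
    split_ifs
    · exact ihc hc.1 s
    · exact ihd hc.2 s
  | loop e c => rfl

end RAM

/-! ## A family of sets with constant-time operations

The buckets `b < n * (W + 1) + 2` are subsets of `{0, …, n - 1}`. Array `1` holds their sizes, array
`2` lists the elements of bucket `b` from position `b * n` on, and array `3` holds the position of
each element in the list. Register `4` contains `n`, register `5` contains `W`, and the registers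
`30` and `31` contain the bucket and the element of an operation. -/

namespace RAM

instance : Add Expr := ⟨.op .add⟩
instance : Sub Expr := ⟨.op .sub⟩
instance : Mul Expr := ⟨.op .mul⟩
instance : Div Expr := ⟨.op .div⟩
instance : Mod Expr := ⟨.op .mod⟩

section eval

variable {w : ℕ} {s : Store}

@[simp] theorem eval_const (c : ℕ) : (Expr.const c).eval w s = c % 2 ^ w := rfl
@[simp] theorem eval_reg (x : ℕ) : (Expr.reg x).eval w s = s.reg x := rfl
@[simp] theorem eval_read (a : ℕ) (i : Expr) :
    (Expr.read a i).eval w s = s.arr a (i.eval w s) := rfl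
@[simp] theorem eval_add (e f : Expr) :
    (e + f).eval w s = (e.eval w s + f.eval w s) % 2 ^ w := rfl
@[simp] theorem eval_sub (e f : Expr) :
    (e - f).eval w s = (e.eval w s - f.eval w s) % 2 ^ w := rfl
@[simp] theorem eval_mul (e f : Expr) :
    (e * f).eval w s = (e.eval w s * f.eval w s) % 2 ^ w := rfl
@[simp] theorem eval_div (e f : Expr) :
    (e / f).eval w s = (e.eval w s / f.eval w s) % 2 ^ w := rfl
@[simp] theorem eval_mod (e f : Expr) :
    (e % f).eval w s = (e.eval w s % f.eval w s) % 2 ^ w := rfl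
@[simp] theorem eval_lt (e f : Expr) :
    (Expr.op .lt e f).eval w s = (if e.eval w s < f.eval w s then 1 else 0) % 2 ^ w := rfl
@[simp] theorem eval_eq (e f : Expr) :
    (Expr.op .eq e f).eval w s = (if e.eval w s = f.eval w s then 1 else 0) % 2 ^ w := rfl

end eval

/-- The `k`-th element of bucket `b`. -/
def item (n : ℕ) (s : Store) (b k : ℕ) : ℕ := s.arr 2 (b * n + k)

/-- Membership in bucket `b`. -/
def Mem (n : ℕ) (s : Store) (b x : ℕ) : Prop := ∃ k < s.arr 1 b, item n s b k = x

/-- The lists and the positions of the first `B` buckets are consistent. -/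
def WF (n B : ℕ) (s : Store) : Prop :=
  ∀ b < B, s.arr 1 b ≤ n ∧ ∀ k < s.arr 1 b, item n s b k < n ∧ s.arr 3 (b * n + item n s b k) = k

theorem Mem.lt {n B b x : ℕ} {s : Store} (h : Mem n s b x) (hs : WF n B s) (hb : b < B) : x < n := by
  obtain ⟨k, hk, rfl⟩ := h
  exact ((hs b hb).2 k hk).1

theorem WF.item_inj {n B b k k' : ℕ} {s : Store} (hs : WF n B s) (hb : b < B)
    (hk : k < s.arr 1 b) (hk' : k' < s.arr 1 b) (h : item n s b k = item n s b k') : k = k' := by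
  rw [← ((hs b hb).2 k hk).2, h, ((hs b hb).2 k' hk').2]

theorem row_inj {n b k b' k' : ℕ} (hk : k < n) (hk' : k' < n) (h : b * n + k = b' * n + k') :
    b = b' ∧ k = k' := by
  have h1 : (b * n + k) / n = b := by
    rw [add_comm, Nat.add_mul_div_right _ _ (by omega), Nat.div_eq_of_lt hk, zero_add]
  have h2 : (b' * n + k') / n = b' := by
    rw [add_comm, Nat.add_mul_div_right _ _ (by omega), Nat.div_eq_of_lt hk', zero_add]
  have : b = b' := by rw [← h1, h, h2]
  subst this
  exact ⟨rfl, by omega⟩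

theorem row_lt {n B b k : ℕ} (hb : b < B) (hk : k < n) : b * n + k < B * n := by
  calc b * n + k < b * n + n := by omega
    _ = (b + 1) * n := by ring
    _ ≤ B * n := Nat.mul_le_mul_right n hb

theorem card_mem {n B b : ℕ} {s : Store} (hs : WF n B s) (hb : b < B) (A : Finset ℕ)
    (hA : ∀ x, Mem n s b x ↔ x ∈ A) : s.arr 1 b = A.card := by
  have : A = (Finset.range (s.arr 1 b)).image (item n s b) := by
    ext x
    rw [← hA]
    simp [Mem]
  rw [this, Finset.card_image_of_injOn, Finset.card_range]
  intro k hk k' hk' h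
  exact hs.item_inj hb (by simpa using hk) (by simpa using hk') h

/-- Guarantees that an appended element stays within the row of its bucket in array `2`. -/
theorem WF.len_lt {n B b x : ℕ} {s : Store} (hs : WF n B s) (hb : b < B) (hx : x < n)
    (h : ¬ Mem n s b x) : s.arr 1 b < n := by
  classical
  have h1 := card_mem hs hb ((Finset.range n).filter (Mem n s b)) (fun y => by
    simp only [Finset.mem_filter, Finset.mem_range]
    exact ⟨fun hy => ⟨hy.lt hs hb, hy⟩, fun hy => hy.2⟩)
  rw [h1]
  have : (Finset.range n).filter (Mem n s b) ⊂ Finset.range n :=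
    Finset.filter_ssubset.2 ⟨x, by simpa using hx, h⟩
  simpa using Finset.card_lt_card this

/-- The membership test for the element in register `31` and the bucket in register `30`. -/
def memE : Expr :=
  .op .lt (.read 3 (.reg 30 * .reg 4 + .reg 31)) (.read 1 (.reg 30)) *
  .op .eq (.read 2 (.reg 30 * .reg 4 + .read 3 (.reg 30 * .reg 4 + .reg 31))) (.reg 31)

def skip : Cmd := .assign 39 (.const 0)

/-- Insert the element in register `31` into the bucket in register `30`. -/
def addCmd : Cmd :=
  .ite memE skip
    (.seq (.write 2 (.reg 30 * .reg 4 + .read 1 (.reg 30)) (.reg 31))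
    (.seq (.write 3 (.reg 30 * .reg 4 + .reg 31) (.read 1 (.reg 30)))
    (.write 1 (.reg 30) (.read 1 (.reg 30) + .const 1))))

/-- Remove the element in register `31` from the bucket in register `30`. -/
def removeCmd : Cmd :=
  .ite memE
    (.seq (.assign 32 (.read 3 (.reg 30 * .reg 4 + .reg 31)))
    (.seq (.assign 33 (.read 2 (.reg 30 * .reg 4 + (.read 1 (.reg 30) - .const 1))))
    (.seq (.write 2 (.reg 30 * .reg 4 + .reg 32) (.reg 33))
    (.seq (.write 3 (.reg 30 * .reg 4 + .reg 33) (.reg 32))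
    (.write 1 (.reg 30) (.read 1 (.reg 30) - .const 1))))))
    skip

section

variable {w n B b x : ℕ} {s : Store}

/-- For a non-member array `3` may hold anything. The test therefore accepts the stored position
only if it is below the size of the bucket and the list entry there points back to the element. -/
theorem memE_eval (hw : B * n < 2 ^ w) (hs : WF n B s) (h4 : s.reg 4 = n)
    (h30 : s.reg 30 = b) (h31 : s.reg 31 = x) (hb : b < B) (hx : x < n) :
    memE.eval w s ≠ 0 ↔ Mem n s b x := by
  have h1 := row_lt hb hx
  have h1w : 1 < 2 ^ w := by
    have : 1 * 1 ≤ B * n := Nat.mul_le_mul (by omega) (by omega)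
    omega
  have e1 : (b * n % 2 ^ w + x) % 2 ^ w = b * n + x := by
    rw [Nat.mod_eq_of_lt (a := b * n) (by omega), Nat.mod_eq_of_lt (by omega)]
  have hp : ∀ p < n, (b * n % 2 ^ w + p) % 2 ^ w = b * n + p := by
    intro p hp
    have := row_lt hb hp
    rw [Nat.mod_eq_of_lt (a := b * n) (by omega), Nat.mod_eq_of_lt (by omega)]
  simp only [memE, eval_mul, eval_lt, eval_eq, eval_read, eval_add, eval_reg, h4, h30, h31, e1]
  constructor
  · intro h
    have hlt : s.arr 3 (b * n + x) < s.arr 1 b := by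
      by_contra hc
      rw [if_neg hc] at h
      simp at h
    rw [hp _ (by have := (hs b hb).1; omega)] at h
    refine ⟨_, hlt, ?_⟩
    by_contra hc
    rw [item] at hc
    rw [if_neg hc] at h
    simp at h
  · rintro ⟨k, hk, rfl⟩
    have h2 := (hs b hb).2 k hk
    rw [h2.2, hp k (by have := (hs b hb).1; omega), if_pos hk,
      if_pos (show s.arr 2 (b * n + k) = item n s b k from rfl)]
    simp [Nat.mod_eq_of_lt h1w]

/-- Insertion appends, so existing entries keep their positions. A search relies on this when it
scans the list of visited vertices while that list grows. -/
theorem add_spec (hw : B * n < 2 ^ w) (hs : WF n B s) (h4 : s.reg 4 = n)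
    (h30 : s.reg 30 = b) (h31 : s.reg 31 = x) (hb : b < B) (hx : x < n) {s' : Store}
    (hs' : s' = addCmd.det w s) :
    WF n B s' ∧ (∀ b' < B, ∀ y, Mem n s' b' y ↔ Mem n s b' y ∨ (b' = b ∧ y = x)) ∧
    (∀ b' < B, ∀ k < s.arr 1 b', item n s' b' k = item n s b' k) ∧
    (Mem n s b x → s'.arr = s.arr) ∧
    (¬ Mem n s b x → ∀ b', s'.arr 1 b' = if b' = b then s.arr 1 b + 1 else s.arr 1 b') := by
  have hE := memE_eval hw hs h4 h30 h31 hb hx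
  by_cases hm : Mem n s b x
  · have : s'.arr = s.arr := by
      rw [hs', addCmd, Cmd.det, if_pos (hE.2 hm)]
      rfl
    have hi : ∀ b' k, item n s' b' k = item n s b' k := by simp [item, this]
    refine ⟨?_, ?_, fun b' _ k _ => hi b' k, fun _ => this,
      fun h => absurd hm h⟩
    · simpa [WF, hi, this] using hs
    · intro b' _ y
      simp only [Mem, hi, this]
      refine ⟨Or.inl, ?_⟩
      rintro (h | ⟨rfl, rfl⟩)
      · exact h
      · exact hm
  · have hl := hs.len_lt hb hx hm
    have h1 := row_lt hb hx
    have h2 := row_lt hb hl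
    have hBn : n ≤ B * n := Nat.le_mul_of_pos_left n (by omega)
    have e0 : (b * n) % 2 ^ w = b * n := Nat.mod_eq_of_lt (by omega)
    have e1 : (b * n + x) % 2 ^ w = b * n + x := Nat.mod_eq_of_lt (by omega)
    have e2 : (b * n + s.arr 1 b) % 2 ^ w = b * n + s.arr 1 b := Nat.mod_eq_of_lt (by omega)
    have e3 : (s.arr 1 b + 1 % 2 ^ w) % 2 ^ w = s.arr 1 b + 1 := by
      rw [Nat.mod_eq_of_lt (a := 1) (by omega), Nat.mod_eq_of_lt (by omega)]
    have ha1 : ∀ j, s'.arr 1 j = if j = b then s.arr 1 b + 1 else s.arr 1 j := by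
      intro j
      rw [hs', addCmd, Cmd.det, if_neg (fun h => hm (hE.1 h))]
      simp [Cmd.det, h4, h30, e3]
    have ha2 : ∀ j, s'.arr 2 j = if j = b * n + s.arr 1 b then x else s.arr 2 j := by
      intro j
      rw [hs', addCmd, Cmd.det, if_neg (fun h => hm (hE.1 h))]
      simp [Cmd.det, h4, h30, h31, e0, e2]
    have ha3 : ∀ j, s'.arr 3 j = if j = b * n + x then s.arr 1 b else s.arr 3 j := by
      intro j
      rw [hs', addCmd, Cmd.det, if_neg (fun h => hm (hE.1 h))]
      simp [Cmd.det, h4, h30, h31, e0, e1]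
    have hi : ∀ b' k, k < n → item n s' b' k =
        if b' = b ∧ k = s.arr 1 b then x else item n s b' k := by
      intro b' k hk
      simp only [item, ha2]
      refine if_congr ⟨fun h => row_inj hk hl h, ?_⟩ rfl rfl
      rintro ⟨rfl, rfl⟩; rfl
    have hold : ∀ b' < B, ∀ k < s.arr 1 b', item n s' b' k = item n s b' k := by
      intro b' hb' k hk
      rw [hi _ _ (hk.trans_le (hs b' hb').1), if_neg]
      rintro ⟨rfl, rfl⟩
      exact absurd hk (lt_irrefl _)
    refine ⟨?_, ?_, hold, fun h => absurd h hm, fun _ => ha1⟩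
    · intro b' hb'
      rw [ha1]
      by_cases hbb : b' = b
      · subst hbb
        rw [if_pos rfl]
        refine ⟨by omega, fun k hk => ?_⟩
        rcases Nat.lt_succ_iff_lt_or_eq.1 hk with hk | rfl
        · rw [hold _ hb' _ hk, ha3, if_neg]
          · exact (hs b' hb').2 k hk
          · intro h
            exact hm ⟨k, hk, by omega⟩
        · rw [hi _ _ hl, if_pos ⟨rfl, rfl⟩, ha3, if_pos rfl]
          exact ⟨hx, rfl⟩
      · rw [if_neg hbb]
        refine ⟨(hs b' hb').1, fun k hk => ?_⟩
        rw [hold _ hb' _ hk, ha3, if_neg]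
        · exact (hs b' hb').2 k hk
        · intro h
          exact hbb (row_inj ((hs b' hb').2 k hk).1 hx h).1
    · intro b' hb' y
      by_cases hbb : b' = b
      · subst hbb
        simp only [Mem, ha1, if_true, true_and]
        constructor
        · rintro ⟨k, hk, rfl⟩
          rcases Nat.lt_succ_iff_lt_or_eq.1 hk with hk | rfl
          · exact Or.inl ⟨k, hk, (hold _ hb' _ hk).symm⟩
          · right
            rw [hi _ _ hl, if_pos ⟨rfl, rfl⟩]
        · rintro (⟨k, hk, rfl⟩ | rfl)
          · exact ⟨k, by omega, hold _ hb' _ hk⟩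
          · exact ⟨s.arr 1 b', by omega, by rw [hi _ _ hl, if_pos ⟨rfl, rfl⟩]⟩
      · simp only [Mem, ha1, hbb, false_and, or_false, if_false]
        refine exists_congr fun k => and_congr_right fun hk => ?_
        rw [hold _ hb' _ hk]

/-- The last element `y` of the list is moved into the gap at position `q`; the case `y = x` needs
no separate treatment in the program. -/
theorem remove_spec (hw : B * n < 2 ^ w) (hs : WF n B s) (h4 : s.reg 4 = n)
    (h30 : s.reg 30 = b) (h31 : s.reg 31 = x) (hb : b < B) (hx : x < n) {s' : Store}
    (hs' : s' = removeCmd.det w s) :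
    WF n B s' ∧ ∀ b' < B, ∀ y, Mem n s' b' y ↔ Mem n s b' y ∧ ¬ (b' = b ∧ y = x) := by
  have hE := memE_eval hw hs h4 h30 h31 hb hx
  by_cases hm : Mem n s b x
  swap
  · have : s'.arr = s.arr := by
      rw [hs', removeCmd, Cmd.det, if_neg (fun h => hm (hE.1 h))]
      rfl
    have hi : ∀ b' k, item n s' b' k = item n s b' k := by simp [item, this]
    refine ⟨by simpa [WF, hi, this] using hs, ?_⟩
    intro b' _ y
    simp only [Mem, hi, this]
    refine ⟨fun h => ⟨h, ?_⟩, And.left⟩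
    rintro ⟨rfl, rfl⟩
    exact hm h
  · obtain ⟨q, hq, hqx⟩ := id hm
    have hqx3 : s.arr 3 (b * n + x) = q := by rw [← hqx]; exact ((hs b hb).2 q hq).2
    have hln := (hs b hb).1
    obtain ⟨l, hl⟩ : ∃ l, s.arr 1 b = l + 1 := ⟨s.arr 1 b - 1, by omega⟩
    have hlb : l < s.arr 1 b := by omega
    have hy := (hs b hb).2 l hlb
    set y := item n s b l with hydef
    have h1 := row_lt hb hx
    have h2 := row_lt hb (show l < n by omega)
    have h3 := row_lt hb (show q < n by omega)
    have h5 := row_lt hb hy.1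
    have hBn : n ≤ B * n := Nat.le_mul_of_pos_left n (by omega)
    have e0 : (b * n) % 2 ^ w = b * n := Nat.mod_eq_of_lt (by omega)
    have e1 : (b * n + x) % 2 ^ w = b * n + x := Nat.mod_eq_of_lt (by omega)
    have e2 : (b * n + l) % 2 ^ w = b * n + l := Nat.mod_eq_of_lt (by omega)
    have e3 : (b * n + q) % 2 ^ w = b * n + q := Nat.mod_eq_of_lt (by omega)
    have e4 : (b * n + y) % 2 ^ w = b * n + y := Nat.mod_eq_of_lt (by omega)
    have e6 : 1 % 2 ^ w = 1 := Nat.mod_eq_of_lt (by omega)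
    have e7 : l % 2 ^ w = l := Nat.mod_eq_of_lt (by omega)
    have hy2 : s.arr 2 (b * n + l) = y := rfl
    have ha1 : ∀ j, s'.arr 1 j = if j = b then l else s.arr 1 j := by
      intro j
      rw [hs', removeCmd, Cmd.det, if_pos (hE.2 hm)]
      simp [Cmd.det, h30, e6, e7, hl]
    have ha2 : ∀ j, s'.arr 2 j = if j = b * n + q then y else s.arr 2 j := by
      intro j
      rw [hs', removeCmd, Cmd.det, if_pos (hE.2 hm)]
      simp [Cmd.det, h4, h30, h31, e0, e1, e2, e3, e6, e7, hqx3, hl, hy2]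
    have ha3 : ∀ j, s'.arr 3 j = if j = b * n + y then q else s.arr 3 j := by
      intro j
      rw [hs', removeCmd, Cmd.det, if_pos (hE.2 hm)]
      simp [Cmd.det, h4, h30, h31, e0, e1, e2, e4, e6, e7, hqx3, hl, hy2]
    have hi : ∀ b' k, k < n → item n s' b' k =
        if b' = b ∧ k = q then y else item n s b' k := by
      intro b' k hk
      simp only [item, ha2]
      refine if_congr ⟨fun h => row_inj hk (by omega) h, ?_⟩ rfl rfl
      rintro ⟨rfl, rfl⟩; rfl
    have hother : ∀ b' < B, b' ≠ b → ∀ k < s.arr 1 b', item n s' b' k = item n s b' k := by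
      intro b' hb' hne k hk
      rw [hi _ _ (hk.trans_le (hs b' hb').1), if_neg (fun h => hne h.1)]
    have hthis : ∀ k < l, item n s' b k = if k = q then y else item n s b k := by
      intro k hk
      rw [hi _ _ (by omega)]
      simp
    refine ⟨?_, ?_⟩
    · intro b' hb'
      rw [ha1]
      by_cases hbb : b' = b
      · subst hbb
        rw [if_pos rfl]
        refine ⟨by omega, fun k hk => ?_⟩
        rw [hthis k hk]
        by_cases hkq : k = q
        · rw [if_pos hkq, ha3, if_pos rfl]
          exact ⟨hy.1, hkq.symm⟩
        · have hk' := (hs b' hb').2 k (by omega)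
          rw [if_neg hkq, ha3, if_neg]
          · exact hk'
          · intro h
            have h6 : item n s b' k = item n s b' l := by omega
            have := hs.item_inj hb' (by omega) hlb h6
            omega
      · rw [if_neg hbb]
        refine ⟨(hs b' hb').1, fun k hk => ?_⟩
        rw [hother _ hb' hbb _ hk, ha3, if_neg]
        · exact (hs b' hb').2 k hk
        · intro h
          exact hbb (row_inj ((hs b' hb').2 k hk).1 hy.1 h).1
    · intro b' hb' z
      by_cases hbb : b' = b
      · subst hbb
        simp only [Mem, ha1, if_true, true_and]
        constructor
        · rintro ⟨k, hk, rfl⟩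
          rw [hthis k hk]
          by_cases hkq : k = q
          · rw [if_pos hkq]
            refine ⟨⟨l, by omega, rfl⟩, ?_⟩
            intro h
            have := hs.item_inj hb' hlb hq (h.trans hqx.symm)
            omega
          · rw [if_neg hkq]
            refine ⟨⟨k, by omega, rfl⟩, ?_⟩
            intro h
            exact hkq (hs.item_inj hb' (by omega) hq (h.trans hqx.symm))
        · rintro ⟨⟨k, hk, rfl⟩, hne⟩
          by_cases hkl : k = l
          · subst hkl
            have hqk : q ≠ k := by
              rintro rfl
              exact hne hqx
            exact ⟨q, by omega, by rw [hthis q (by omega), if_pos rfl]⟩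
          · refine ⟨k, by omega, ?_⟩
            rw [hthis k (by omega), if_neg]
            rintro rfl
            exact hne hqx
      · simp only [Mem, ha1, hbb, false_and, not_false_eq_true, and_true, if_false]
        refine exists_congr fun k => and_congr_right fun hk => ?_
        rw [hother _ hb' hbb _ hk]

end

/-! ## The stored graph -/

/-- The store holds the directed weighted graph `H` on `{0, …, n - 1}`: array `4` is its weight
matrix, bucket `u * (W + 1) + c` the set of the out-neighbors of `u` along edges of weight `c ≥ 1`,
bucket `u * (W + 1)` the set of all out-neighbors of `u`, and bucket `n * (W + 1)` the set of all
vertices with an out-neighbor. -/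
structure IsDS (n W : ℕ) (s : Store) (H : ℕ → ℕ → ℕ) : Prop where
  wf : WF n (n * (W + 1) + 2) s
  wt : ∀ u < n, ∀ v < n, s.arr 4 (u * n + v) = H u v
  le : ∀ u < n, ∀ v < n, H u v ≤ W
  mem_class : ∀ u < n, ∀ c, 1 ≤ c → c ≤ W → ∀ v,
    Mem n s (u * (W + 1) + c) v ↔ v < n ∧ H u v = c
  mem_nbr : ∀ u < n, ∀ v, Mem n s (u * (W + 1)) v ↔ v < n ∧ H u v ≠ 0
  mem_nis : ∀ u, Mem n s (n * (W + 1)) u ↔ u < n ∧ ∃ v < n, H u v ≠ 0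

theorem IsDS.congr {n W : ℕ} {s s' : Store} {H : ℕ → ℕ → ℕ} (h : IsDS n W s H)
    (h1 : s'.arr 1 = s.arr 1) (h2 : s'.arr 2 = s.arr 2) (h3 : s'.arr 3 = s.arr 3)
    (h4 : s'.arr 4 = s.arr 4) : IsDS n W s' H := by
  have hm : ∀ b x, Mem n s' b x ↔ Mem n s b x := by simp [Mem, item, h1, h2]
  refine ⟨?_, by simpa [h4] using h.wt, h.le, by simpa [hm] using h.mem_class,
    by simpa [hm] using h.mem_nbr, by simpa [hm] using h.mem_nis⟩
  simpa [WF, item, h1, h2, h3] using h.wf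

/-- The registers `4`, `5`, `12` and `13` contain `n`, `W` and the numbers of the last two
buckets. -/
def IsCfg (n W : ℕ) (s : Store) : Prop :=
  s.reg 4 = n ∧ s.reg 5 = W ∧ s.reg 12 = n * (W + 1) ∧ s.reg 13 = n * (W + 1) + 1

/-- Set the weight of the arc from register `34` to register `35` to the value of register `36`. -/
def halfSet : Cmd :=
  .seq (.seq (.assign 31 (.reg 35))
    (.assign 30 (.reg 34 * (.reg 5 + .const 1) + .read 4 (.reg 34 * .reg 4 + .reg 35))))
  (.seq removeCmd
  (.seq (.assign 30 (.reg 34 * (.reg 5 + .const 1) + .reg 36))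
  (.seq addCmd
  (.seq (.assign 30 (.reg 34 * (.reg 5 + .const 1)))
  (.seq (.ite (.reg 36) addCmd removeCmd)
  (.seq (.seq (.write 4 (.reg 34 * .reg 4 + .reg 35) (.reg 36)) (.assign 31 (.reg 34)))
  (.ite (.read 1 (.reg 30)) (.seq (.assign 30 (.reg 12)) addCmd)
    (.seq (.assign 30 (.reg 12)) removeCmd))))))))

/-- The weight function with the weight of the arc `(u, v)` replaced by `c`. -/
def setArc (H : ℕ → ℕ → ℕ) (u v c : ℕ) : ℕ → ℕ → ℕ :=
  fun a b => if a = u ∧ b = v then c else H a b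

set_option maxHeartbeats 1000000 in
-- Bucket `u * (W + 1)` is both the class of weight 0 and the list of all out-neighbors. If the old
-- weight is 0, the removal finds nothing there; if the new weight is 0, the insertion puts `v`
-- there by mistake, which the subsequent correction of the neighbor list undoes.
theorem halfSet_spec {w n W u v c : ℕ} {s : Store} {H : ℕ → ℕ → ℕ}
    (hw : (n * (W + 1) + 2) * n < 2 ^ w) (hw' : n * (W + 1) + 2 < 2 ^ w)
    (hs : IsDS n W s H) (hc : IsCfg n W s) (h34 : s.reg 34 = u) (h35 : s.reg 35 = v)
    (h36 : s.reg 36 = c) (hu : u < n) (hv : v < n) (hcW : c ≤ W) :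
    IsDS n W (halfSet.det w s) (setArc H u v c) := by
  classical
  obtain ⟨h4, h5, h12, h13⟩ := hc
  have hH := hs.le u hu v hv
  have hb : ∀ u' < n, ∀ c' ≤ W, u' * (W + 1) + c' < n * (W + 1) := fun u' hu' c' hc' =>
    row_lt hu' (by omega)
  have e0 : u * n + v < (n * (W + 1) + 2) * n := row_lt (by have := hb u hu 0 (by omega); nlinarith) hv
  have hbu := hb u hu (H u v) hH
  have hbc := hb u hu c hcW
  have e1 : ∀ x, x < 2 ^ w → x % 2 ^ w = x := fun x hx => Nat.mod_eq_of_lt hx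
  have hn1 : 1 ≤ n := by omega
  have hW1 : W + 1 ≤ n * (W + 1) := Nat.le_mul_of_pos_left _ (by omega)
  have e2 : u * n ≤ u * n + v := by omega
  -- the old class
  set s1 := Cmd.det w (.seq (.assign 31 (.reg 35))
    (.assign 30 (.reg 34 * (.reg 5 + .const 1) + .read 4 (.reg 34 * .reg 4 + .reg 35)))) s with hs1
  have a1 : s1.arr = s.arr := rfl
  have r1_30 : s1.reg 30 = u * (W + 1) + H u v := by
    have := hs.wt u hu v hv
    rw [← this] at hbu ⊢
    simp [hs1, Cmd.det, h34, h35, h4, h5]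
    rw [e1 (u * n + v) (by omega), e1 _ (by omega)]
  have r1_31 : s1.reg 31 = v := by simp [hs1, Cmd.det, h35]
  have r1 : ∀ r, r ≠ 30 → r ≠ 31 → s1.reg r = s.reg r := by
    intro r h h'; simp [hs1, Cmd.det, h, h']
  have wf1 : WF n (n * (W + 1) + 2) s1 := by simpa [WF, item, a1] using hs.wf
  have m1 : ∀ b x, Mem n s1 b x ↔ Mem n s b x := by simp [Mem, item, a1]
  obtain ⟨wf2, m2⟩ := remove_spec hw wf1 (by rw [r1 4 (by decide) (by decide), h4]) r1_30 r1_31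
    (by omega) hv rfl
  set s2 := removeCmd.det w s1 with hs2
  have r2 : ∀ r, removeCmd.modReg r = false → s2.reg r = s1.reg r := fun r hr => Cmd.det_reg hr s1
  -- the new class
  set s3 := Cmd.det w (.assign 30 (.reg 34 * (.reg 5 + .const 1) + .reg 36)) s2 with hs3
  have a3 : s3.arr = s2.arr := rfl
  have r3_30 : s3.reg 30 = u * (W + 1) + c := by
    simp [hs3, Cmd.det, r2 34 rfl, r2 5 rfl, r2 36 rfl, r1, h34, h5, h36]
    exact e1 _ (by omega)
  have r3 : ∀ r, r ≠ 30 → s3.reg r = s2.reg r := by intro r h; simp [hs3, Cmd.det, h]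
  have r3_31 : s3.reg 31 = v := by rw [r3 31 (by decide), r2 31 rfl, r1_31]
  have r3_4 : s3.reg 4 = n := by rw [r3 4 (by decide), r2 4 rfl, r1 4 (by decide) (by decide), h4]
  have wf3 : WF n (n * (W + 1) + 2) s3 := by simpa [WF, item, a3] using wf2
  have m3 : ∀ b x, Mem n s3 b x ↔ Mem n s2 b x := by simp [Mem, item, a3]
  obtain ⟨wf4, m4, -⟩ := add_spec hw wf3 r3_4 r3_30 r3_31 (by omega) hv rfl
  set s4 := addCmd.det w s3 with hs4
  have r4 : ∀ r, addCmd.modReg r = false → s4.reg r = s3.reg r := fun r hr => Cmd.det_reg hr s3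
  -- the neighbors
  set s5 := Cmd.det w (.assign 30 (.reg 34 * (.reg 5 + .const 1))) s4 with hs5
  have a5 : s5.arr = s4.arr := rfl
  have r5_30 : s5.reg 30 = u * (W + 1) := by
    simp [hs5, Cmd.det, r4 34 rfl, r4 5 rfl, r3, r2 34 rfl, r2 5 rfl, r1, h34, h5]
    exact e1 _ (by omega)
  have r5 : ∀ r, r ≠ 30 → s5.reg r = s4.reg r := by intro r h; simp [hs5, Cmd.det, h]
  have r5' : ∀ r, r ≠ 30 → r ≠ 31 → addCmd.modReg r = false → removeCmd.modReg r = false →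
      s5.reg r = s.reg r := by
    intro r h h' h'' h'''
    rw [r5 r h, r4 r h'', r3 r h, r2 r h''', r1 r h h']
  have r5_31 : s5.reg 31 = v := by rw [r5 31 (by decide), r4 31 rfl, r3_31]
  have r5_4 : s5.reg 4 = n := by rw [r5' 4 (by decide) (by decide) rfl rfl, h4]
  have r5_36 : s5.reg 36 = c := by rw [r5' 36 (by decide) (by decide) rfl rfl, h36]
  have wf5 : WF n (n * (W + 1) + 2) s5 := by simpa [WF, item, a5] using wf4
  have m5 : ∀ b x, Mem n s5 b x ↔ Mem n s4 b x := by simp [Mem, item, a5]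
  set s6 := Cmd.det w (.ite (.reg 36) addCmd removeCmd) s5 with hs6
  have h6 : WF n (n * (W + 1) + 2) s6 ∧ ∀ b < n * (W + 1) + 2, ∀ y, Mem n s6 b y ↔
      (if c ≠ 0 then Mem n s5 b y ∨ (b = u * (W + 1) ∧ y = v)
        else Mem n s5 b y ∧ ¬ (b = u * (W + 1) ∧ y = v)) := by
    by_cases hc0 : c = 0
    · have : s6 = removeCmd.det w s5 := by simp [hs6, Cmd.det, r5_36, hc0]
      obtain ⟨x1, x2⟩ := remove_spec hw wf5 r5_4 r5_30 r5_31 (by omega) hv this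
      exact ⟨x1, by simpa [hc0] using x2⟩
    · have : s6 = addCmd.det w s5 := by simp [hs6, Cmd.det, r5_36, hc0]
      obtain ⟨x1, x2, -⟩ := add_spec hw wf5 r5_4 r5_30 r5_31 (by omega) hv this
      exact ⟨x1, by simpa [hc0] using x2⟩
  obtain ⟨wf6, m6⟩ := h6
  have r6 : ∀ r, (Cmd.ite (.reg 36) addCmd removeCmd).modReg r = false → s6.reg r = s5.reg r :=
    fun r hr => Cmd.det_reg hr s5
  set s7 := Cmd.det w (.seq (.write 4 (.reg 34 * .reg 4 + .reg 35) (.reg 36))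
    (.assign 31 (.reg 34))) s6 with hs7
  have a7 : ∀ i, i ≠ 4 → s7.arr i = s6.arr i := fun i hi => by
    funext j; simp [hs7, Cmd.det, hi]
  have r6_34 : s6.reg 34 = u := by rw [r6 34 rfl, r5' 34 (by decide) (by decide) rfl rfl, h34]
  have r6_35 : s6.reg 35 = v := by rw [r6 35 rfl, r5' 35 (by decide) (by decide) rfl rfl, h35]
  have r6_36 : s6.reg 36 = c := by rw [r6 36 rfl, r5_36]
  have r6_4 : s6.reg 4 = n := by rw [r6 4 rfl, r5_4]
  have a7' : ∀ j, s7.arr 4 j = if j = u * n + v then c else s.arr 4 j := by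
    intro j
    have : s6.arr 4 = s.arr 4 := by
      rw [hs6, Cmd.det_arr rfl, a5, hs4, Cmd.det_arr rfl, a3, hs2, Cmd.det_arr rfl, a1]
    simp only [hs7, Cmd.det, Store.setReg_arr, Store.setArr_arr, eval_reg, eval_add, eval_mul,
      r6_34, r6_35, r6_36, r6_4, this, true_and]
    rw [e1 (u * n) (by omega), e1 (u * n + v) (by omega)]
  have r7_31 : s7.reg 31 = u := by simp [hs7, Cmd.det, r6_34]
  have r7 : ∀ r, r ≠ 31 → s7.reg r = s6.reg r := by intro r h; simp [hs7, Cmd.det, h]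
  have r7_30 : s7.reg 30 = u * (W + 1) := by rw [r7 30 (by decide), r6 30 rfl, r5_30]
  have r7_12 : s7.reg 12 = n * (W + 1) := by
    rw [r7 12 (by decide), r6 12 rfl, r5' 12 (by decide) (by decide) rfl rfl, h12]
  have r7_4 : s7.reg 4 = n := by rw [r7 4 (by decide), r6_4]
  have wf7 : WF n (n * (W + 1) + 2) s7 := by simpa [WF, item, a7] using wf6
  have m7 : ∀ b x, Mem n s7 b x ↔ Mem n s6 b x := by simp [Mem, item, a7]
  set s8 := Cmd.det w (.ite (.read 1 (.reg 30)) (.seq (.assign 30 (.reg 12)) addCmd)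
    (.seq (.assign 30 (.reg 12)) removeCmd)) s7 with hs8
  set s7b := s7.setReg 30 (n * (W + 1)) with hs7b
  have wf7b : WF n (n * (W + 1) + 2) s7b := wf7
  have m7b : ∀ b x, Mem n s7b b x ↔ Mem n s6 b x := m7
  have h8 : WF n (n * (W + 1) + 2) s8 ∧ ∀ b < n * (W + 1) + 2, ∀ y, Mem n s8 b y ↔
      (if (∃ z, Mem n s6 (u * (W + 1)) z) then Mem n s6 b y ∨ (b = n * (W + 1) ∧ y = u)
        else Mem n s6 b y ∧ ¬ (b = n * (W + 1) ∧ y = u)) := by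
    by_cases hl : s7.arr 1 (u * (W + 1)) = 0
    · have : s8 = removeCmd.det w s7b := by simp [hs8, Cmd.det, r7_30, hl, r7_12, hs7b]
      obtain ⟨x1, x2⟩ := remove_spec hw wf7b (b := n * (W + 1)) (x := u) (by simp [hs7b, r7_4])
        (by simp [hs7b]) (by simp [hs7b, r7_31]) (by omega) hu this
      have hne : ¬ ∃ z, Mem n s6 (u * (W + 1)) z := by
        rintro ⟨z, hz⟩
        obtain ⟨k, hk, _⟩ := (m7 _ _).2 hz
        omega
      refine ⟨x1, fun b hb' y => ?_⟩
      rw [if_neg hne, x2 b hb', m7b]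
    · have : s8 = addCmd.det w s7b := by simp [hs8, Cmd.det, r7_30, hl, r7_12, hs7b]
      obtain ⟨x1, x2, -⟩ := add_spec hw wf7b (b := n * (W + 1)) (x := u) (by simp [hs7b, r7_4])
        (by simp [hs7b]) (by simp [hs7b, r7_31]) (by omega) hu this
      have hne : ∃ z, Mem n s6 (u * (W + 1)) z :=
        ⟨item n s7 (u * (W + 1)) 0, (m7 _ _).1 ⟨0, by omega, rfl⟩⟩
      refine ⟨x1, fun b hb' y => ?_⟩
      rw [if_pos hne, x2 b hb', m7b]
  obtain ⟨wf8, m8⟩ := h8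
  have hfin : halfSet.det w s = s8 := by
    rw [halfSet, Cmd.det_seq, ← hs1, Cmd.det_seq, ← hs2, Cmd.det_seq, ← hs3, Cmd.det_seq, ← hs4,
      Cmd.det_seq, ← hs5, Cmd.det_seq, ← hs6, Cmd.det_seq, ← hs7]
  rw [hfin]
  have key : ∀ u' < n, ∀ c' ≤ W, ∀ y, Mem n s8 (u' * (W + 1) + c') y ↔
      Mem n s6 (u' * (W + 1) + c') y := by
    intro u' hu' c' hc' y
    have := hb u' hu' c' hc'
    rw [m8 _ (by omega)]
    split_ifs <;> simp [this.ne]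
  -- The case c' = 0 is included: it describes the neighbor lists.
  have key6 : ∀ u' < n, ∀ c' ≤ W, ∀ y, Mem n s6 (u' * (W + 1) + c') y ↔
      if c ≠ 0 then ((Mem n s (u' * (W + 1) + c') y ∧ ¬ (u' = u ∧ c' = H u v ∧ y = v)) ∨
        (u' = u ∧ c' = c ∧ y = v)) ∨ (u' = u ∧ c' = 0 ∧ y = v)
      else ((Mem n s (u' * (W + 1) + c') y ∧ ¬ (u' = u ∧ c' = H u v ∧ y = v)) ∨
        (u' = u ∧ c' = c ∧ y = v)) ∧ ¬ (u' = u ∧ c' = 0 ∧ y = v) := by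
    intro u' hu' c' hc' y
    have h1 := hb u' hu' c' hc'
    have hinj : ∀ c'' ≤ W, (u' * (W + 1) + c' = u * (W + 1) + c'' ↔ u' = u ∧ c' = c'') := by
      intro c'' hc''
      refine ⟨fun h => row_inj (by omega) (by omega) h, ?_⟩
      rintro ⟨rfl, rfl⟩; rfl
    have hinj0 := hinj 0 (by omega)
    rw [add_zero] at hinj0
    rw [m6 _ (by omega), m5, m4 _ (by omega), m3, m2 _ (by omega), m1, hinj _ hH, hinj _ hcW, hinj0]
    simp only [and_assoc]
  have memNbr : ∀ u' < n, ∀ y, Mem n s6 (u' * (W + 1)) y ↔ y < n ∧ setArc H u v c u' y ≠ 0 := by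
    intro u' hu' y
    have h1 := key6 u' hu' 0 (by omega) y
    have h2 := hs.mem_nbr u' hu' y
    rw [add_zero] at h1
    rw [h1, h2, setArc]
    by_cases huy : u' = u ∧ y = v
    · obtain ⟨rfl, rfl⟩ := huy
      by_cases hc0 : c = 0 <;> simp [hc0, hv]
    · rw [if_neg huy]
      by_cases huu : u' = u
      · have : y ≠ v := fun h => huy ⟨huu, h⟩
        simp [this]
      · simp [huu]
  refine ⟨wf8, ?_, ?_, ?_, ?_, ?_⟩
  · intro a ha b hb'
    have : s8.arr 4 = s7.arr 4 := Cmd.det_arr rfl s7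
    rw [this, a7', hs.wt a ha b hb', setArc]
    refine if_congr ⟨fun h => row_inj hb' hv h, ?_⟩ rfl rfl
    rintro ⟨rfl, rfl⟩; rfl
  · intro a ha b hb'
    rw [setArc]
    split_ifs
    · exact hcW
    · exact hs.le a ha b hb'
  · intro a ha c' hc1 hc' y
    rw [key a ha c' hc', key6 a ha c' hc', hs.mem_class a ha c' hc1 hc', setArc]
    have : c' ≠ 0 := by omega
    by_cases huy : a = u ∧ y = v
    · obtain ⟨rfl, rfl⟩ := huy
      by_cases hc0 : c = 0
      · subst hc0; simp [this, this.symm]; omega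
      · simp [this, hv, hc0]; omega
    · rw [if_neg huy]
      have h3 : ∀ p, ¬ (a = u ∧ p ∧ y = v) := fun p hp => huy ⟨hp.1, hp.2.2⟩
      simp [h3]
  · intro a ha y
    have := key a ha 0 (by omega) y
    rw [add_zero] at this
    rw [this, memNbr a ha]
  · intro a
    have h6' : Mem n s6 (n * (W + 1)) a ↔ Mem n s (n * (W + 1)) a := by
      have h1 := hbu.ne'
      have h2 := hbc.ne'
      have h3 := (hb u hu 0 (by omega)).ne'
      rw [add_zero] at h3
      rw [m6 _ (by omega), m5, m4 _ (by omega), m3, m2 _ (by omega), m1]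
      simp [h1, h2, h3]
    have h9 : (∃ z, Mem n s6 (u * (W + 1)) z) ↔ ∃ z < n, setArc H u v c u z ≠ 0 :=
      exists_congr fun z => memNbr u hu z
    rw [m8 _ (by omega), h6', hs.mem_nis]
    by_cases hau : a = u
    · subst hau
      by_cases hz : ∃ z, Mem n s6 (a * (W + 1)) z
      · rw [if_pos hz]
        simpa [hu] using h9.1 hz
      · rw [if_neg hz]
        rw [h9] at hz
        simp only [not_true_eq_false, and_false, and_self, false_iff, not_and]
        exact fun _ => hz
    · have : ∀ y, setArc H u v c a y = H a y := fun y => by simp [setArc, hau]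
      simp [this, hau]

end RAM

/-! ### Registers and arrays that a program leaves untouched -/

namespace RAM

/-- Every step replaces the remaining commands by parts of themselves, so a location that none of
them can modify remains protected. -/
theorem run_frame {w : ℕ} (T : ℕ) {x y : Config} (hy : y ∈ (run w T x).support) :
    (∀ r, (∀ c ∈ x.1, c.modReg r = false) → y.2.reg r = x.2.reg r) ∧
    (∀ a, (∀ c ∈ x.1, c.modArr a = false) → y.2.arr a = x.2.arr a) := by
  induction T generalizing x with
  | zero =>
    obtain rfl : y = x := by simpa [run] using hy
    exact ⟨fun _ _ => rfl, fun _ _ => rfl⟩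
  | succ T ih =>
    rw [run, PMF.support_bind] at hy
    obtain ⟨z, hz, hyz⟩ := Set.mem_iUnion₂.1 hy
    have h1 := ih hyz
    suffices h2 : (∀ r, (∀ c ∈ x.1, c.modReg r = false) →
        (∀ c ∈ z.1, c.modReg r = false) ∧ z.2.reg r = x.2.reg r) ∧
        (∀ a, (∀ c ∈ x.1, c.modArr a = false) →
        (∀ c ∈ z.1, c.modArr a = false) ∧ z.2.arr a = x.2.arr a) from
      ⟨fun r hr => (h1.1 r (h2.1 r hr).1).trans (h2.1 r hr).2,
        fun a ha => (h1.2 a (h2.2 a ha).1).trans (h2.2 a ha).2⟩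
    obtain ⟨k, s⟩ := x
    cases k with
    | nil =>
      obtain rfl : z = ([], s) := by simpa [step] using hz
      simp
    | cons c k =>
      cases c with
      | assign x e =>
        obtain rfl : z = (k, s.setReg x (e.eval w s)) := by simpa [step] using hz
        refine ⟨fun r hr => ?_, fun a ha => ?_⟩
        · simp only [List.forall_mem_cons, Cmd.modReg, beq_eq_false_iff_ne] at hr
          exact ⟨hr.2, by simp [Ne.symm hr.1]⟩
        · simp only [List.forall_mem_cons] at ha
          exact ⟨ha.2, rfl⟩
      | write a' i e =>
        obtain rfl : z = (k, s.setArr a' (i.eval w s) (e.eval w s)) := by simpa [step] using hz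
        refine ⟨fun r hr => ?_, fun a ha => ?_⟩
        · simp only [List.forall_mem_cons] at hr
          exact ⟨hr.2, rfl⟩
        · simp only [List.forall_mem_cons, Cmd.modArr, beq_eq_false_iff_ne] at ha
          refine ⟨ha.2, ?_⟩
          funext j
          simp [Ne.symm ha.1]
      | rand x e =>
        rw [step, PMF.support_map] at hz
        obtain ⟨v, _, rfl⟩ := hz
        refine ⟨fun r hr => ?_, fun a ha => ?_⟩
        · simp only [List.forall_mem_cons, Cmd.modReg, beq_eq_false_iff_ne] at hr
          exact ⟨hr.2, by simp [Ne.symm hr.1]⟩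
        · simp only [List.forall_mem_cons] at ha
          exact ⟨ha.2, rfl⟩
      | seq c d =>
        obtain rfl : z = (c :: d :: k, s) := by simpa [step] using hz
        simp only [List.forall_mem_cons, Cmd.modReg, Cmd.modArr, Bool.or_eq_false_iff]
        tauto
      | ite e c d =>
        obtain rfl : z = ((if e.eval w s ≠ 0 then c else d) :: k, s) := by
          simpa [step] using hz
        simp only [List.forall_mem_cons, Cmd.modReg, Cmd.modArr, Bool.or_eq_false_iff]
        split_ifs <;> tauto
      | loop e c =>
        obtain rfl : z = (if e.eval w s ≠ 0 then c :: .loop e c :: k else k, s) := by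
          simpa [step] using hz
        simp only [List.forall_mem_cons, Cmd.modReg, Cmd.modArr]
        split_ifs
        · simp only [List.forall_mem_cons, Cmd.modReg, Cmd.modArr]
          tauto
        · tauto

theorem Tr.frame {w : ℕ} {c : Cmd} {s : Store} {T : ℕ} {P : Store → Prop} {f : Store → ℝ≥0∞}
    {v : ℝ≥0∞} (h : Tr w c s T P f v) :
    Tr w c s T (fun s' => P s' ∧ (∀ r, c.modReg r = false → s'.reg r = s.reg r) ∧
      (∀ a, c.modArr a = false → s'.arr a = s.arr a)) f v := by
  obtain ⟨μ, h1, h2, h3⟩ := h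
  refine ⟨μ, h1, fun s' hs' => ⟨h2 s' hs', ?_⟩, h3⟩
  have h4 : run w T ([c], s) = μ.map fun s => ([], s) := by
    have := h1 [] 0 PMF.pure fun s' _ => settles_nil s' 0
    rwa [PMF.bind_pure] at this
  have h5 : (([], s') : Config) ∈ (run w T ([c], s)).support := by
    rw [h4, PMF.support_map]
    exact ⟨s', hs', rfl⟩
  simpa using run_frame T h5

end RAM

/-! ## The estimator: mathematical description -/

namespace WGraph

variable {n : ℕ}

/-- The weight of the edge between two numbers. -/
def arc (G : WGraph n) (a b : ℕ) : ℕ := if h : a < n ∧ b < n then G s(⟨a, h.1⟩, ⟨b, h.2⟩) else 0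

theorem arc_val (G : WGraph n) (a b : Fin n) : G.arc a b = G s(a, b) := by
  simp [arc]

theorem lt_of_arc {G : WGraph n} {a b : ℕ} (h : G.arc a b ≠ 0) : a < n ∧ b < n := by
  by_contra hc
  exact h (by simp [arc, hc])

/-- `b` is in the component of `a` in the graph of the edges of weight at most `i`. -/
def ReachN (G : WGraph n) (i a b : ℕ) : Prop :=
  ∃ (ha : a < n) (hb : b < n), (G.level i).Reachable ⟨a, ha⟩ ⟨b, hb⟩

theorem ReachN.step {G : WGraph n} (hG : ∀ v, G s(v, v) = 0) {i a b c : ℕ} (h : G.ReachN i a b)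
    (h0 : 1 ≤ G.arc b c) (hi : G.arc b c ≤ i) : G.ReachN i a c := by
  obtain ⟨ha, hb, h⟩ := h
  obtain ⟨_, hc⟩ := lt_of_arc (G := G) (a := b) (b := c) (by omega)
  refine ⟨ha, hc, h.trans (SimpleGraph.Adj.reachable ?_)⟩
  simp only [arc, hb, hc, and_self, dite_true] at h0 hi
  refine ⟨?_, h0, hi⟩
  intro he
  rw [he, hG] at h0
  omega

/-- The size of the component of `v` in the graph of the edges of weight at most `i`. -/
noncomputable def compN (G : WGraph n) (i v : ℕ) : ℕ :=
  if h : v < n then (G.level i).compCard ⟨v, h⟩ else 0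

open Classical in
theorem exists_finset_compN (G : WGraph n) (i v : ℕ) (hv : v < n) :
    ∃ A : Finset ℕ, A.card = G.compN i v ∧ ∀ y, y ∈ A ↔ G.ReachN i v y := by
  refine ⟨(Finset.univ.filter fun y => (G.level i).Reachable ⟨v, hv⟩ y).image Fin.val, ?_, ?_⟩
  · rw [Finset.card_image_of_injective _ Fin.val_injective, compN, dif_pos hv,
      SimpleGraph.compCard, ← Set.ncard_coe_finset]
    simp
  · intro y
    simp only [Finset.mem_image, Finset.mem_filter, Finset.mem_univ, true_and, ReachN]
    constructor
    · rintro ⟨z, hz, rfl⟩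
      exact ⟨hv, z.2, hz⟩
    · rintro ⟨_, hy, h⟩
      exact ⟨⟨y, hy⟩, h, rfl⟩

open Classical in
/-- The contribution of a sample: the component of `v` has more than `X` vertices, but does not if
the edges of weight more than `i` are removed (unless `i = W`). -/
noncomputable def hit (G : WGraph n) (W X i v : ℕ) : ℕ :=
  if (i = W ∨ G.compN i v ≤ X) ∧ X < G.compN W v then 1 else 0

theorem hit_le_one (G : WGraph n) (W X i v : ℕ) : G.hit W X i v ≤ 1 := by
  rw [hit]; split_ifs <;> omega

/-- The expectation of `f` at the number of hits, if `c` hits have been found and `q` samples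
remain. -/
noncomputable def estVal (G : WGraph n) (W Γ : ℕ) (f : ℕ → ℝ≥0∞) : ℕ → ℕ → ℝ≥0∞
  | 0, c => f c
  | q + 1, c => (∑ v ∈ G.nonIsolated, (∑ i ∈ Finset.range W,
      estVal G W Γ f q (c + G.hit W (Γ / (q % Γ + 1)) i v)) / W) / G.nonIsolated.card

end WGraph

namespace RAM

/-! ## The estimator: program -/

/-- Start a new sample: choose a random vertex (register `38`) and a random level (register `22`),
determine the size threshold (register `23`), and start a search with this vertex. -/
def sampleInit : Cmd :=
  .seq (.seq (.assign 38 (.read 2 (.reg 12 * .reg 4 + .reg 38)))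
  (.seq (.assign 20 (.reg 20 - .const 1))
  (.seq (.assign 23 (.reg 8 / (.reg 20 % .reg 8 + .const 1)))
  (.seq (.assign 21 (.const 1))
  (.seq (.assign 24 (.const 0))
  (.seq (.assign 25 (.const 1))
  (.seq (.assign 26 (.const 0))
  (.seq (.write 1 (.reg 13) (.const 0))
  (.seq (.assign 30 (.reg 13))
  (.assign 31 (.reg 38))))))))))) addCmd

def sampleCmd : Cmd :=
  .ite (.reg 20)
    (.seq (.rand 38 (.read 1 (.reg 12))) (.seq (.rand 22 (.reg 5)) sampleInit))
    skip

/-- Scan the next edge at the current vertex, go to the next class of edges, or go to the next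
vertex. -/
def scanCmd : Cmd :=
  .ite (.op .lt (.reg 22) (.reg 25))
    (.seq (.assign 24 (.reg 24 + .const 1)) (.seq (.assign 25 (.const 1)) (.assign 26 (.const 0))))
    (.seq (.assign 40 (.read 2 (.reg 13 * .reg 4 + .reg 24) * (.reg 5 + .const 1) + .reg 25))
    (.ite (.op .lt (.reg 26) (.read 1 (.reg 40)))
      (.seq (.seq (.assign 31 (.read 2 (.reg 40 * .reg 4 + .reg 26)))
        (.seq (.assign 26 (.reg 26 + .const 1)) (.assign 30 (.reg 13)))) addCmd)
      (.seq (.assign 25 (.reg 25 + .const 1)) (.assign 26 (.const 0)))))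

/-- One step of a search. -/
def searchCmd : Cmd :=
  .ite (.op .lt (.reg 23) (.read 1 (.reg 13)))
    (.seq (.assign 21 (.const 0)) (.assign 27 (.reg 27 + .op .eq (.reg 22) (.reg 5))))
  (.ite (.op .lt (.reg 24) (.read 1 (.reg 13)))
    scanCmd
  (.ite (.op .lt (.reg 22) (.reg 5))
    (.seq (.assign 22 (.reg 5)) (.seq (.assign 24 (.const 0))
      (.seq (.assign 25 (.const 1)) (.assign 26 (.const 0)))))
    (.assign 21 (.const 0))))

/-- One step of the estimator. -/
def tick : Cmd := .ite (.reg 21) searchCmd sampleCmd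

/-- A bound for the number of steps in one stage of a search with threshold `X`. -/
def stageCost (W X : ℕ) : ℕ := (X + 1) * (X + W + 4)

/-- A bound for the number of steps of a sample with threshold `X`. -/
def sampleCost (W X : ℕ) : ℕ := 2 * stageCost W X + 3

/-- A bound for the number of steps of the last `q` samples. -/
def totalCost (W Γ q : ℕ) : ℕ := ∑ i ∈ Finset.range q, sampleCost W (Γ / (i % Γ + 1))

/-- All quantities fit into a word. -/
structure Fits (w n W Γ S : ℕ) : Prop where
  row : (n * (W + 1) + 2) * n < 2 ^ w
  bucket : n * (W + 1) + 2 < 2 ^ w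
  W_pos : 1 ≤ W
  W_lt : W + 2 < 2 ^ w
  Γ_pos : 1 ≤ Γ
  Γ_lt : Γ + 1 < 2 ^ w
  S_lt : S + 1 < 2 ^ w

/-- The invariant of a search from `root` in the graph of the edges of weight at most `lev`; at most
`fuel` steps remain. -/
structure SearchInv {n : ℕ} (W : ℕ) (G : WGraph n) (s : Store) (root lev X h c k fuel : ℕ) :
    Prop where
  root_lt : root < n
  mem_root : Mem n s (n * (W + 1) + 1) root
  reach : ∀ y, Mem n s (n * (W + 1) + 1) y → G.ReachN lev root y
  closed : ∀ h' < h, ∀ y, 1 ≤ G.arc (item n s (n * (W + 1) + 1) h') y →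
    G.arc (item n s (n * (W + 1) + 1) h') y ≤ lev → Mem n s (n * (W + 1) + 1) y
  h_le : h ≤ s.arr 1 (n * (W + 1) + 1)
  len_le : s.arr 1 (n * (W + 1) + 1) ≤ X + 1
  lev_le : lev ≤ W
  one_le : 1 ≤ c
  c_le : c ≤ lev + 1
  k_zero : c = lev + 1 → k = 0
  k_le : h < s.arr 1 (n * (W + 1) + 1) → c ≤ lev →
    k ≤ s.arr 1 (item n s (n * (W + 1) + 1) h * (W + 1) + c)
  -- `E` is the set of neighbors already scanned at the current vertex. All of them are visited, so
  -- there are at most X + 1, and `c + E.card` measures the steps spent at this vertex. The fuel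
  -- covers X + W + 4 steps for each of the X + 1 − h possible vertices and, below level W, also a
  -- whole second stage.
  scan : ∃ E : Finset ℕ, (∀ y ∈ E, Mem n s (n * (W + 1) + 1) y) ∧
    (h < s.arr 1 (n * (W + 1) + 1) → ∀ y, y ∈ E ↔
      (1 ≤ G.arc (item n s (n * (W + 1) + 1) h) y ∧ G.arc (item n s (n * (W + 1) + 1) h) y < c) ∨
      ∃ k' < k, item n s (item n s (n * (W + 1) + 1) h * (W + 1) + c) k' = y) ∧
    (h = s.arr 1 (n * (W + 1) + 1) → c = 1 ∧ E = ∅) ∧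
    (if lev < W then stageCost W X + 1 else 0) + (X + 1 - h) * (X + W + 4) + 2
      ≤ fuel + c + E.card

/-- The invariant of the estimator; at most `fuel` steps remain. -/
structure EstInv {n : ℕ} (W Γ S : ℕ) (G : WGraph n) (fuel : ℕ) (s : Store) : Prop where
  cfg : IsCfg n W s
  ds : IsDS n W s G.arc
  reg_Γ : s.reg 8 = Γ
  nis : s.reg 20 = 0 ∨ 0 < G.nonIsolated.card
  -- Each remaining or unfinished sample adds at most one hit, so the counter never exceeds `S`.
  count : s.reg 27 + s.reg 20 + s.reg 21 ≤ S
  phase : (s.reg 21 = 0 ∧ totalCost W Γ (s.reg 20) ≤ fuel) ∨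
    (s.reg 21 = 1 ∧ s.reg 23 ≤ Γ ∧ ∃ f, f + totalCost W Γ (s.reg 20) = fuel ∧
      SearchInv W G s (s.reg 38) (s.reg 22) (s.reg 23) (s.reg 24) (s.reg 25) (s.reg 26) f)

/-- The expected final value of `f`. -/
noncomputable def curVal {n : ℕ} (W Γ : ℕ) (G : WGraph n) (f : ℕ → ℝ≥0∞) (s : Store) : ℝ≥0∞ :=
  G.estVal W Γ f (s.reg 20) (s.reg 27 +
    if s.reg 21 = 0 then 0 else G.hit W (s.reg 23) (s.reg 22) (s.reg 38))

/-! ### Random non-isolated vertices, and visited sets versus components -/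

section

variable {n W Γ S : ℕ} {G : WGraph n} {s : Store}

theorem IsDS.card_nis (h : IsDS n W s G.arc) (hG : ∀ v, G s(v, v) = 0) :
    s.arr 1 (n * (W + 1)) = G.nonIsolated.card := by
  rw [card_mem h.wf (by omega) (G.nonIsolated.image Fin.val),
    Finset.card_image_of_injective _ Fin.val_injective]
  intro x
  rw [h.mem_nis]
  simp only [Finset.mem_image, WGraph.mem_nonIsolated]
  constructor
  · rintro ⟨hx, y, hy, hne⟩
    refine ⟨⟨x, hx⟩, ⟨⟨y, hy⟩, ?_, ?_⟩, rfl⟩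
    · intro he
      simp only [WGraph.arc, hx, hy, and_self, dite_true] at hne
      exact hne (by rw [← he]; exact hG _)
    · simp only [WGraph.arc, hx, hy, and_self, dite_true] at hne
      omega
  · rintro ⟨v, ⟨u, hu⟩, rfl⟩
    refine ⟨v.2, u, u.2, ?_⟩
    rw [G.arc_val]
    exact hu.2.ne'

/-- A uniform index into the list of bucket `n * (W + 1)` is thus a uniform non-isolated vertex. -/
theorem IsDS.sum_nis (h : IsDS n W s G.arc) (hG : ∀ v, G s(v, v) = 0) (f : ℕ → ℝ≥0∞) :
    ∑ i ∈ Finset.range (s.arr 1 (n * (W + 1))), f (item n s (n * (W + 1)) i)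
      = ∑ v ∈ G.nonIsolated, f v := by
  have hcard := h.card_nis hG
  rw [← Finset.sum_image (f := f) (g := item n s (n * (W + 1)))
    (s := Finset.range (s.arr 1 (n * (W + 1)))) (fun k hk k' hk' he =>
      h.wf.item_inj (by omega) (by simpa using hk) (by simpa using hk') he),
    ← Finset.sum_image (f := f) (g := Fin.val) (s := G.nonIsolated)
      (fun _ _ _ _ he => Fin.val_injective he)]
  congr 1
  ext x
  have := h.mem_nis x
  simp only [Mem] at this
  simp only [Finset.mem_image, Finset.mem_range]
  rw [this]
  simp only [WGraph.mem_nonIsolated]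
  constructor
  · rintro ⟨hx, y, hy, hne⟩
    refine ⟨⟨x, hx⟩, ⟨⟨y, hy⟩, ?_, ?_⟩, rfl⟩
    · intro he
      simp only [WGraph.arc, hx, hy, and_self, dite_true] at hne
      exact hne (by rw [← he]; exact hG _)
    · simp only [WGraph.arc, hx, hy, and_self, dite_true] at hne
      omega
  · rintro ⟨v, ⟨u, hu⟩, rfl⟩
    refine ⟨v.2, u, u.2, ?_⟩
    rw [G.arc_val]
    exact hu.2.ne'

theorem SearchInv.len_le_compN {root lev X h c k fuel : ℕ} (hs : WF n (n * (W + 1) + 2) s)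
    (hi : SearchInv W G s root lev X h c k fuel) :
    s.arr 1 (n * (W + 1) + 1) ≤ G.compN lev root := by
  classical
  obtain ⟨A, hA, hA'⟩ := G.exists_finset_compN lev root hi.root_lt
  have h1 := card_mem hs (b := n * (W + 1) + 1) (by omega)
    (A.filter fun y => Mem n s (n * (W + 1) + 1) y) (fun x => by
      rw [Finset.mem_filter, hA']
      exact ⟨fun h => ⟨hi.reach x h, h⟩, fun h => h.2⟩)
  rw [h1, ← hA]
  exact Finset.card_le_card (Finset.filter_subset _ _)

/-- Once every visited vertex has been scanned, the visited set is closed under the edges of the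
level, and a walk cannot leave it. -/
theorem SearchInv.len_eq_compN {root lev X c k fuel : ℕ} (hs : WF n (n * (W + 1) + 2) s)
    (hi : SearchInv W G s root lev X (s.arr 1 (n * (W + 1) + 1)) c k fuel) :
    s.arr 1 (n * (W + 1) + 1) = G.compN lev root := by
  obtain ⟨A, hA, hA'⟩ := G.exists_finset_compN lev root hi.root_lt
  rw [card_mem hs (b := n * (W + 1) + 1) (by omega) A, hA]
  intro x
  rw [hA']
  refine ⟨hi.reach x, ?_⟩
  rintro ⟨ha, hb, hr⟩
  obtain ⟨p⟩ := hr.symm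
  have : ∀ (a b : Fin n) (p : (G.level lev).Walk a b),
      Mem n s (n * (W + 1) + 1) b → Mem n s (n * (W + 1) + 1) a := by
    intro a b p
    induction p with
    | nil => exact id
    | @cons u v z hadj _ ih =>
      intro hz
      obtain ⟨h', hh', he⟩ := ih hz
      have h1 := hi.closed h' hh' u
      rw [he, G.arc_val, Sym2.eq_swap] at h1
      exact h1 hadj.2.1 hadj.2.2
  exact this _ _ p hi.mem_root

end

end RAM

/-! ### Correctness and cost of one step of the estimator -/

namespace RAM

theorem det_ite_pos {w : ℕ} {e : Expr} {c d : Cmd} {s : Store} (h : e.eval w s ≠ 0) :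
    (Cmd.ite e c d).det w s = c.det w s := if_pos h

theorem det_ite_neg {w : ℕ} {e : Expr} {c d : Cmd} {s : Store} (h : e.eval w s = 0) :
    (Cmd.ite e c d).det w s = d.det w s := if_neg (by simpa using h)

theorem eval_lt_ne {w : ℕ} (hw : 1 < 2 ^ w) {s : Store} {e f : Expr} :
    (Expr.op .lt e f).eval w s ≠ 0 ↔ e.eval w s < f.eval w s := by
  rw [eval_lt]
  split_ifs with h <;> simp [h, Nat.mod_eq_of_lt hw]

theorem eval_lt_eq {w : ℕ} (hw : 1 < 2 ^ w) {s : Store} {e f : Expr} :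
    (Expr.op .lt e f).eval w s = 0 ↔ f.eval w s ≤ e.eval w s := by
  rw [← not_lt, ← eval_lt_ne hw, not_not]

section

variable {w n W Γ S : ℕ} {G : WGraph n} {s s' : Store}

theorem Fits.one_lt (hf : Fits w n W Γ S) : 1 < 2 ^ w := by have := hf.Γ_lt; have := hf.Γ_pos; omega

theorem card_le_len (hs : WF n (n * (W + 1) + 2) s) {E : Finset ℕ}
    (hE : ∀ y ∈ E, Mem n s (n * (W + 1) + 1) y) : E.card ≤ s.arr 1 (n * (W + 1) + 1) := by
  classical
  rw [card_mem hs (b := n * (W + 1) + 1) (by omega)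
    ((Finset.range n).filter fun y => Mem n s (n * (W + 1) + 1) y) (fun x => by
      rw [Finset.mem_filter, Finset.mem_range]
      exact ⟨fun h => ⟨h.lt hs (by omega), h⟩, fun h => h.2⟩)]
  refine Finset.card_le_card fun y hy => ?_
  rw [Finset.mem_filter, Finset.mem_range]
  exact ⟨(hE y hy).lt hs (by omega), hE y hy⟩

/-- At an unfinished vertex, |E| ≤ X + 1 and c ≤ W + 1 cannot use up the allowance X + W + 4; after
the last vertex, c = 1 and E = ∅, and the summand 2 in the budget remains. -/
theorem SearchInv.fuel_pos {root lev X h c k f : ℕ} (hs : WF n (n * (W + 1) + 2) s)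
    (hi : SearchInv W G s root lev X h c k f) : 1 ≤ f := by
  obtain ⟨E, h1, _, h3, h4⟩ := hi.scan
  have h5 := card_le_len hs h1
  have := hi.len_le
  have := hi.c_le
  have := hi.lev_le
  rcases hi.h_le.lt_or_eq with hl | hl
  · have h6 : 1 * (X + W + 4) ≤ (X + 1 - h) * (X + W + 4) :=
      Nat.mul_le_mul_right (X + W + 4) (show 1 ≤ X + 1 - h by omega)
    omega
  · obtain ⟨rfl, rfl⟩ := h3 hl
    simp at h4
    omega

/-- A search modifies only the scratch bucket `n * (W + 1) + 1` of visited vertices. -/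
theorem IsDS.of_search (h : IsDS n W s G.arc) (hwf : WF n (n * (W + 1) + 2) s')
    (hm : ∀ b < n * (W + 1) + 1, ∀ y, Mem n s' b y ↔ Mem n s b y) (h4 : s'.arr 4 = s.arr 4) :
    IsDS n W s' G.arc := by
  have hb : ∀ u' < n, ∀ c' ≤ W, u' * (W + 1) + c' < n * (W + 1) := fun u' hu' c' hc' =>
    row_lt hu' (by omega)
  refine ⟨hwf, by simpa [h4] using h.wt, h.le, ?_, ?_, ?_⟩
  · intro u hu c h1 hc v
    rw [hm _ (by have := hb u hu c hc; omega), h.mem_class u hu c h1 hc]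
  · intro u hu v
    rw [hm _ (by have := hb u hu 0 (by omega); omega), h.mem_nbr u hu]
  · intro u
    rw [hm _ (by omega), h.mem_nis]

/-- Two stores with the same arrays and the same configuration registers. -/
theorem EstInv.of_arr {fuel fuel' : ℕ} (hi : EstInv W Γ S G fuel s) (ha : s'.arr = s.arr)
    (hr : ∀ r, r < 20 → s'.reg r = s.reg r) (h20 : s'.reg 20 = s.reg 20)
    (hc : s'.reg 27 + s'.reg 20 + s'.reg 21 ≤ S)
    (hp : (s'.reg 21 = 0 ∧ totalCost W Γ (s'.reg 20) ≤ fuel') ∨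
      (s'.reg 21 = 1 ∧ s'.reg 23 ≤ Γ ∧ ∃ f, f + totalCost W Γ (s'.reg 20) = fuel' ∧
      SearchInv W G s' (s'.reg 38) (s'.reg 22) (s'.reg 23) (s'.reg 24) (s'.reg 25) (s'.reg 26) f)) :
    EstInv W Γ S G fuel' s' := by
  refine ⟨?_, hi.ds.congr (by rw [ha]) (by rw [ha]) (by rw [ha]) (by rw [ha]), ?_, ?_, hc, hp⟩
  · simpa [IsCfg, hr] using hi.cfg
  · rw [hr 8 (by omega), hi.reg_Γ]
  · rw [h20]; exact hi.nis

/-- More than X visited vertices show that the component at the current level exceeds X. At level W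
this is a hit; at a lower level it rules a hit out. -/
theorem search_exceed {fuel : ℕ} {f : ℕ → ℝ≥0∞} (hf : Fits w n W Γ S)
    (hi : EstInv W Γ S G (fuel + 1) s) (h21 : s.reg 21 = 1)
    (hX : s.reg 23 < s.arr 1 (n * (W + 1) + 1))
    (hs' : s' = Cmd.det w
      (.seq (.assign 21 (.const 0)) (.assign 27 (.reg 27 + .op .eq (.reg 22) (.reg 5)))) s) :
    EstInv W Γ S G fuel s' ∧ curVal W Γ G f s' = curVal W Γ G f s := by
  obtain ⟨h4, h5, h12, h13⟩ := hi.cfg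
  obtain ⟨-, hXΓ, g, hg, hsi⟩ := hi.phase.resolve_left (by omega)
  have hcnt := hi.count
  have hS := hf.S_lt
  have hg1 := hsi.fuel_pos hi.ds.wf
  have r21 : s'.reg 21 = 0 := by simp [hs', Cmd.det]
  have r27 : s'.reg 27 = s.reg 27 + if s.reg 22 = W then 1 else 0 := by
    simp [hs', Cmd.det, h5]
    apply Nat.mod_eq_of_lt
    split_ifs <;> omega
  have r : ∀ r, r ≠ 21 → r ≠ 27 → s'.reg r = s.reg r := by
    intro r h h'; simp [hs', Cmd.det, h, h']
  have r20 := r 20 (by decide) (by decide)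
  refine ⟨hi.of_arr (by rw [hs']; rfl) (fun i hi => r i (by omega) (by omega)) r20 ?_ ?_, ?_⟩
  · rw [r21, r20, r27]; split_ifs <;> omega
  · left
    rw [r21, r20]; omega
  · have hlen := hsi.len_le_compN hi.ds.wf
    rw [curVal, curVal, r20, r21, r27, if_pos rfl, if_neg (by omega : s.reg 21 ≠ 0), add_zero]
    congr 2
    rw [WGraph.hit]
    by_cases hl : s.reg 22 = W
    · rw [hl] at hlen
      rw [if_pos hl, if_pos ⟨Or.inl hl, by omega⟩]
    · rw [if_neg hl, if_neg]
      rintro ⟨h | h, _⟩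
      · exact hl h
      · omega

theorem search_next {fuel : ℕ} {f : ℕ → ℝ≥0∞} (hf : Fits w n W Γ S)
    (hi : EstInv W Γ S G (fuel + 1) s) (h21 : s.reg 21 = 1)
    (hX : s.arr 1 (n * (W + 1) + 1) ≤ s.reg 23)
    (hh : s.reg 24 < s.arr 1 (n * (W + 1) + 1)) (hc : s.reg 22 < s.reg 25)
    (hs' : s' = Cmd.det w (.seq (.assign 24 (.reg 24 + .const 1))
      (.seq (.assign 25 (.const 1)) (.assign 26 (.const 0)))) s) :
    EstInv W Γ S G fuel s' ∧ curVal W Γ G f s' = curVal W Γ G f s := by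
  obtain ⟨h4, h5, h12, h13⟩ := hi.cfg
  obtain ⟨-, hXΓ, g, hg, hsi⟩ := hi.phase.resolve_left (by omega)
  have hcnt := hi.count
  have hg1 := hsi.fuel_pos hi.ds.wf
  have ha : s'.arr = s.arr := by rw [hs']; rfl
  have r24 : s'.reg 24 = s.reg 24 + 1 := by
    simp [hs', Cmd.det]
    exact Nat.mod_eq_of_lt (by have := hf.Γ_lt; omega)
  have r25 : s'.reg 25 = 1 := by simp [hs', Cmd.det, Nat.mod_eq_of_lt hf.one_lt]
  have r26 : s'.reg 26 = 0 := by simp [hs', Cmd.det]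
  have r : ∀ r, r ≠ 24 → r ≠ 25 → r ≠ 26 → s'.reg r = s.reg r := by
    intro r h h' h''; simp [hs', Cmd.det, h, h', h'']
  have r20 := r 20 (by decide) (by decide) (by decide)
  have r21 := r 21 (by decide) (by decide) (by decide)
  have r22 := r 22 (by decide) (by decide) (by decide)
  have r23 := r 23 (by decide) (by decide) (by decide)
  have r27 := r 27 (by decide) (by decide) (by decide)
  have r38 := r 38 (by decide) (by decide) (by decide)
  refine ⟨hi.of_arr ha (fun i hi => r i (by omega) (by omega) (by omega)) r20 ?_ ?_, ?_⟩
  · rw [r21, r20, r27]; omega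
  · right
    rw [r21, r22, r23, r24, r25, r26, r20, r38]
    refine ⟨h21, hXΓ, g - 1, by omega, ?_⟩
    obtain ⟨E, e1, e2, e3, e4⟩ := hsi.scan
    have hcl : s.reg 25 = s.reg 22 + 1 := by have := hsi.c_le; omega
    have hk := hsi.k_zero hcl
    have hit : item n s' = item n s := by funext b k; simp [item, ha]
    have hm : ∀ b y, Mem n s' b y ↔ Mem n s b y := by simp [Mem, item, ha]
    have hlX : s.arr 1 (n * (W + 1) + 1) ≤ s.reg 23 + 1 := by omega
    refine ⟨hsi.root_lt, (hm _ _).2 hsi.mem_root, by simpa [hm] using hsi.reach, ?_, ?_, ?_,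
      hsi.lev_le, le_rfl, by omega, fun _ => rfl, fun _ _ => Nat.zero_le _, ?_⟩
    · intro h' hh' y h1 h2
      rw [hit] at h1 h2
      rw [hm]
      rcases Nat.lt_succ_iff_lt_or_eq.1 hh' with hh' | rfl
      · exact hsi.closed h' hh' y h1 h2
      · exact e1 y ((e2 hh y).2 (Or.inl ⟨h1, by omega⟩))
    · rw [ha]; omega
    · rw [ha]; omega
    · refine ⟨∅, by simp, ?_, by simp, ?_⟩
      · intro _ y
        simp
        omega
      · have h5 := card_le_len hi.ds.wf e1
        have h6 := hsi.lev_le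
        -- The allowance X + W + 4 of the finished vertex pays for resetting `c` to 1 and `E` to the
        -- empty set.
        have h7 : s.reg 23 + 1 - s.reg 24 = (s.reg 23 + 1 - (s.reg 24 + 1)) + 1 := by omega
        rw [h7, Nat.succ_mul] at e4
        simp only [Finset.card_empty]
        omega
  · rw [curVal, curVal, r20, r21, r22, r23, r27, r38]

theorem search_class {fuel : ℕ} {f : ℕ → ℝ≥0∞} (hf : Fits w n W Γ S)
    (hi : EstInv W Γ S G (fuel + 1) s) (h21 : s.reg 21 = 1)
    (hh : s.reg 24 < s.arr 1 (n * (W + 1) + 1)) (hc : s.reg 25 ≤ s.reg 22)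
    (hk : s.arr 1 (item n s (n * (W + 1) + 1) (s.reg 24) * (W + 1) + s.reg 25) ≤ s.reg 26)
    (hs' : s' = Cmd.det w (.seq (.assign 25 (.reg 25 + .const 1)) (.assign 26 (.const 0)))
      (s.setReg 40 (item n s (n * (W + 1) + 1) (s.reg 24) * (W + 1) + s.reg 25))) :
    EstInv W Γ S G fuel s' ∧ curVal W Γ G f s' = curVal W Γ G f s := by
  obtain ⟨h4, h5, h12, h13⟩ := hi.cfg
  obtain ⟨-, hXΓ, g, hg, hsi⟩ := hi.phase.resolve_left (by omega)
  have hcnt := hi.count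
  have hg1 := hsi.fuel_pos hi.ds.wf
  have ha : s'.arr = s.arr := by rw [hs']; rfl
  have r25 : s'.reg 25 = s.reg 25 + 1 := by
    simp [hs', Cmd.det]
    exact Nat.mod_eq_of_lt (by have := hf.W_lt; have := hsi.lev_le; omega)
  have r26 : s'.reg 26 = 0 := by simp [hs', Cmd.det]
  have r : ∀ r, r ≠ 25 → r ≠ 26 → r ≠ 40 → s'.reg r = s.reg r := by
    intro r h h' h''; simp [hs', Cmd.det, h, h', h'']
  have r20 := r 20 (by decide) (by decide) (by decide)
  have r21 := r 21 (by decide) (by decide) (by decide)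
  have r22 := r 22 (by decide) (by decide) (by decide)
  have r23 := r 23 (by decide) (by decide) (by decide)
  have r24 := r 24 (by decide) (by decide) (by decide)
  have r27 := r 27 (by decide) (by decide) (by decide)
  have r38 := r 38 (by decide) (by decide) (by decide)
  refine ⟨hi.of_arr ha (fun i hi => r i (by omega) (by omega) (by omega)) r20 ?_ ?_, ?_⟩
  · rw [r21, r20, r27]; omega
  · right
    rw [r21, r22, r23, r24, r25, r26, r20, r38]
    refine ⟨h21, hXΓ, g - 1, by omega, ?_⟩
    obtain ⟨E, e1, e2, e3, e4⟩ := hsi.scan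
    have hit : item n s' = item n s := by funext b k; simp [item, ha]
    have hm : ∀ b y, Mem n s' b y ↔ Mem n s b y := by simp [Mem, item, ha]
    have hu : item n s (n * (W + 1) + 1) (s.reg 24) < n :=
      ((hi.ds.wf _ (by omega)).2 _ hh).1
    have hk' := hsi.k_le hh hc
    refine ⟨hsi.root_lt, (hm _ _).2 hsi.mem_root, by simpa [hm] using hsi.reach,
      by simpa [hm, hit] using hsi.closed, by rw [ha]; exact hsi.h_le, by rw [ha]; exact hsi.len_le,
      hsi.lev_le, by omega, by omega, fun _ => rfl, fun _ _ => Nat.zero_le _, ?_⟩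
    refine ⟨E, by simpa [hm] using e1, ?_, ?_, by omega⟩
    · intro _ y
      have hmc := hi.ds.mem_class _ hu (s.reg 25) hsi.one_le (hc.trans hsi.lev_le) y
      rw [e2 hh y, hit]
      have hex : (∃ k' < s.reg 26, item n s (item n s (n * (W + 1) + 1) (s.reg 24) * (W + 1)
          + s.reg 25) k' = y) ↔ Mem n s (item n s (n * (W + 1) + 1) (s.reg 24) * (W + 1)
          + s.reg 25) y := by
        rw [Mem, show s.reg 26 = _ from le_antisymm hk' hk]
      rw [hex, hmc]
      have := hsi.one_le
      constructor
      · rintro (h | h)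
        · exact Or.inl (by omega)
        · exact Or.inl (by omega)
      · rintro (h | ⟨k', hk', _⟩)
        · by_cases hlt : G.arc (item n s (n * (W + 1) + 1) (s.reg 24)) y < s.reg 25
          · exact Or.inl ⟨h.1, hlt⟩
          · exact Or.inr ⟨(WGraph.lt_of_arc (Nat.one_le_iff_ne_zero.1 h.1)).2, by omega⟩
        · omega
    · rw [ha]
      intro h
      omega
  · rw [curVal, curVal, r20, r21, r22, r23, r27, r38]

/-- The step is paid for by the growth of `E`, not of the visited set: the scanned neighbor is new
to `E` even if it was visited before. -/
theorem search_edge {fuel : ℕ} {f : ℕ → ℝ≥0∞} (hf : Fits w n W Γ S) (hG : ∀ v, G s(v, v) = 0)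
    (hi : EstInv W Γ S G (fuel + 1) s) (h21 : s.reg 21 = 1)
    (hX : s.arr 1 (n * (W + 1) + 1) ≤ s.reg 23)
    (hh : s.reg 24 < s.arr 1 (n * (W + 1) + 1)) (hc : s.reg 25 ≤ s.reg 22)
    (hk : s.reg 26 < s.arr 1 (item n s (n * (W + 1) + 1) (s.reg 24) * (W + 1) + s.reg 25))
    (hs' : s' = Cmd.det w (.seq (.seq (.assign 31 (.read 2 (.reg 40 * .reg 4 + .reg 26)))
        (.seq (.assign 26 (.reg 26 + .const 1)) (.assign 30 (.reg 13)))) addCmd)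
      (s.setReg 40 (item n s (n * (W + 1) + 1) (s.reg 24) * (W + 1) + s.reg 25))) :
    EstInv W Γ S G fuel s' ∧ curVal W Γ G f s' = curVal W Γ G f s := by
  obtain ⟨h4, h5, h12, h13⟩ := hi.cfg
  obtain ⟨-, hXΓ, g, hg, hsi⟩ := hi.phase.resolve_left (by omega)
  have hcnt := hi.count
  have hg1 := hsi.fuel_pos hi.ds.wf
  have hu : item n s (n * (W + 1) + 1) (s.reg 24) < n := ((hi.ds.wf _ (by omega)).2 _ hh).1
  set u := item n s (n * (W + 1) + 1) (s.reg 24) with hudef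
  have hbb : u * (W + 1) + s.reg 25 < n * (W + 1) :=
    row_lt hu (by have := hsi.lev_le; omega)
  set b := u * (W + 1) + s.reg 25 with hbdef
  have hwfb := hi.ds.wf b (by omega)
  have hx := (hwfb.2 _ hk).1
  set x := item n s b (s.reg 26) with hxdef
  have hmemx : Mem n s b x := ⟨_, hk, rfl⟩
  have hux : G.arc u x = s.reg 25 :=
    ((hi.ds.mem_class u hu _ hsi.one_le (hc.trans hsi.lev_le) x).1 hmemx).2
  have hrow := row_lt (show b < n * (W + 1) + 2 by omega) (show s.reg 26 < n by omega)
  have hfr := hf.row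
  have hfb := hf.bucket
  set s1 := Cmd.det w (.seq (.assign 31 (.read 2 (.reg 40 * .reg 4 + .reg 26)))
        (.seq (.assign 26 (.reg 26 + .const 1)) (.assign 30 (.reg 13)))) (s.setReg 40 b) with hs1
  have ha1 : s1.arr = s.arr := rfl
  have q31 : s1.reg 31 = x := by
    simp [hs1, Cmd.det, h4]
    rw [Nat.mod_eq_of_lt (by omega), hxdef, item]
  have q26 : s1.reg 26 = s.reg 26 + 1 := by
    simp [hs1, Cmd.det]
    have : n * 1 ≤ n * (W + 1) := Nat.mul_le_mul_left n (by omega)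
    exact Nat.mod_eq_of_lt (by omega)
  have q30 : s1.reg 30 = n * (W + 1) + 1 := by simp [hs1, Cmd.det, h13]
  have q : ∀ r, r ≠ 26 → r ≠ 30 → r ≠ 31 → r ≠ 40 → s1.reg r = s.reg r := by
    intro r h h' h'' h'''; simp [hs1, Cmd.det, h, h', h'', h''']
  have wf1 : WF n (n * (W + 1) + 2) s1 := hi.ds.wf
  have m1 : ∀ b y, Mem n s1 b y ↔ Mem n s b y := by simp [Mem, item, ha1]
  have i1 : item n s1 = item n s := rfl
  rw [Cmd.det_seq, ← hs1] at hs'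
  obtain ⟨wf', m', i', l1, l2⟩ := add_spec hfr wf1
    (by rw [q 4 (by decide) (by decide) (by decide) (by decide), h4]) q30 q31 (by omega) hx hs'
  have r' : ∀ r, addCmd.modReg r = false → s'.reg r = s1.reg r := fun r hr => by
    rw [hs']; exact Cmd.det_reg hr s1
  have r20 : s'.reg 20 = s.reg 20 := by rw [r' 20 rfl, q 20] <;> decide
  have r21 : s'.reg 21 = s.reg 21 := by rw [r' 21 rfl, q 21] <;> decide
  have r22 : s'.reg 22 = s.reg 22 := by rw [r' 22 rfl, q 22] <;> decide
  have r23 : s'.reg 23 = s.reg 23 := by rw [r' 23 rfl, q 23] <;> decide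
  have r24 : s'.reg 24 = s.reg 24 := by rw [r' 24 rfl, q 24] <;> decide
  have r25 : s'.reg 25 = s.reg 25 := by rw [r' 25 rfl, q 25] <;> decide
  have r26 : s'.reg 26 = s.reg 26 + 1 := by rw [r' 26 rfl, q26]
  have r27 : s'.reg 27 = s.reg 27 := by rw [r' 27 rfl, q 27] <;> decide
  have r38 : s'.reg 38 = s.reg 38 := by rw [r' 38 rfl, q 38] <;> decide
  have r4 : s'.reg 4 = s.reg 4 := by rw [r' 4 rfl, q 4] <;> decide
  have r5 : s'.reg 5 = s.reg 5 := by rw [r' 5 rfl, q 5] <;> decide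
  have r8 : s'.reg 8 = s.reg 8 := by rw [r' 8 rfl, q 8] <;> decide
  have r12 : s'.reg 12 = s.reg 12 := by rw [r' 12 rfl, q 12] <;> decide
  have r13 : s'.reg 13 = s.reg 13 := by rw [r' 13 rfl, q 13] <;> decide
  have lother : ∀ b', b' ≠ n * (W + 1) + 1 → s'.arr 1 b' = s.arr 1 b' := by
    intro b' hb'
    by_cases hm : Mem n s1 (n * (W + 1) + 1) x
    · rw [l1 hm, ha1]
    · rw [l2 hm, if_neg hb', ha1]
  have lvis : s.arr 1 (n * (W + 1) + 1) ≤ s'.arr 1 (n * (W + 1) + 1) ∧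
      s'.arr 1 (n * (W + 1) + 1) ≤ s.arr 1 (n * (W + 1) + 1) + 1 := by
    by_cases hm : Mem n s1 (n * (W + 1) + 1) x
    · rw [l1 hm, ha1]; omega
    · rw [l2 hm, if_pos rfl, ha1]; omega
  have hm' : ∀ b' < n * (W + 1) + 1, ∀ y, Mem n s' b' y ↔ Mem n s b' y := by
    intro b' hb' y
    rw [m' b' (by omega), m1]
    simp [show b' ≠ n * (W + 1) + 1 by omega]
  have hmv : ∀ y, Mem n s' (n * (W + 1) + 1) y ↔ Mem n s (n * (W + 1) + 1) y ∨ y = x := by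
    intro y
    rw [m' _ (by omega), m1]
    simp
  have hitv : ∀ k < s.arr 1 (n * (W + 1) + 1), item n s' (n * (W + 1) + 1) k
      = item n s (n * (W + 1) + 1) k := fun k hk => i' _ (by omega) k hk
  have hitb : ∀ k < s.arr 1 b, item n s' b k = item n s b k := fun k hk => i' b (by omega) k hk
  refine ⟨⟨?_, ?_, by rw [r8, hi.reg_Γ], by rw [r20]; exact hi.nis, by rw [r21, r20, r27]; omega,
    Or.inr ?_⟩, ?_⟩
  · rw [IsCfg, r4, r5, r12, r13]; exact hi.cfg
  · refine hi.ds.of_search wf' hm' ?_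
    rw [hs']
    exact Cmd.det_arr rfl s1
  · rw [r21, r22, r23, r24, r25, r26, r20, r38]
    refine ⟨h21, hXΓ, g - 1, by omega, ?_⟩
    obtain ⟨E, e1, e2, e3, e4⟩ := hsi.scan
    have hu' : item n s' (n * (W + 1) + 1) (s.reg 24) = u := hitv _ hh
    refine ⟨hsi.root_lt, (hmv _).2 (Or.inl hsi.mem_root), ?_, ?_, by omega, by omega,
      hsi.lev_le, hsi.one_le, hsi.c_le, by omega, ?_, ?_⟩
    · intro y hy
      rcases (hmv y).1 hy with hy | rfl
      · exact hsi.reach y hy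
      · exact (hsi.reach u ⟨_, hh, rfl⟩).step hG (by rw [hux]; exact hsi.one_le) (by rw [hux]; exact hc)
    · intro h' hh' y h1 h2
      rw [hitv h' (by omega)] at h1 h2
      exact (hmv y).2 (Or.inl (hsi.closed h' hh' y h1 h2))
    · intro _ _
      rw [hu', lother _ (by omega)]
      exact hk
    -- `E` contains only neighbors of smaller weight and the first `k` entries of the present class,
    -- whose entries are distinct.
    · have hxE : x ∉ E := by
        intro hxE
        rcases (e2 hh x).1 hxE with h | ⟨k', hk', he⟩
        · exact h.2.ne hux
        · have := hi.ds.wf.item_inj (show b < n * (W + 1) + 2 by omega) (by omega) hk he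
          omega
      refine ⟨insert x E, ?_, ?_, by omega, ?_⟩
      · intro y hy
        rcases Finset.mem_insert.1 hy with rfl | hy
        · exact (hmv _).2 (Or.inr rfl)
        · exact (hmv _).2 (Or.inl (e1 y hy))
      · intro _ y
        rw [hu', Finset.mem_insert, e2 hh y]
        constructor
        · rintro (rfl | h | ⟨k', hk', rfl⟩)
          · exact Or.inr ⟨s.reg 26, by omega, hitb _ hk⟩
          · exact Or.inl h
          · exact Or.inr ⟨k', by omega, hitb _ (by omega)⟩
        · rintro (h | ⟨k', hk', rfl⟩)
          · exact Or.inr (Or.inl h)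
          · rw [hitb k' (by omega)]
            rcases Nat.lt_succ_iff_lt_or_eq.1 hk' with hk' | rfl
            · exact Or.inr (Or.inr ⟨k', hk', rfl⟩)
            · exact Or.inl rfl
      · rw [Finset.card_insert_of_notMem hxE]
        omega
  · rw [curVal, curVal, r20, r21, r22, r23, r27, r38]

theorem WGraph.ReachN.mono {G : WGraph n} {i j a b : ℕ} (hij : i ≤ j) (h : G.ReachN i a b) :
    G.ReachN j a b := by
  obtain ⟨ha, hb, h⟩ := h
  exact ⟨ha, hb, h.mono (G.level_mono hij)⟩

/-- The whole component at level i has been found and has at most X vertices, so the first half of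
the hit condition holds. The search goes on at level W with the same visited set, scanning it again
from the beginning. -/
theorem search_stage {fuel : ℕ} {f : ℕ → ℝ≥0∞}
    (hf : Fits w n W Γ S) (hi : EstInv W Γ S G (fuel + 1) s) (h21 : s.reg 21 = 1)
    (hX : s.arr 1 (n * (W + 1) + 1) ≤ s.reg 23)
    (hh : s.arr 1 (n * (W + 1) + 1) ≤ s.reg 24) (hl : s.reg 22 < W)
    (hs' : s' = Cmd.det w (.seq (.assign 22 (.reg 5)) (.seq (.assign 24 (.const 0))
      (.seq (.assign 25 (.const 1)) (.assign 26 (.const 0))))) s) :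
    EstInv W Γ S G fuel s' ∧ curVal W Γ G f s' = curVal W Γ G f s := by
  obtain ⟨h4, h5, h12, h13⟩ := hi.cfg
  obtain ⟨-, hXΓ, g, hg, hsi⟩ := hi.phase.resolve_left (by omega)
  have hcnt := hi.count
  have hhe : s.reg 24 = s.arr 1 (n * (W + 1) + 1) := le_antisymm hsi.h_le hh
  rw [hhe] at hsi
  have hcomp := hsi.len_eq_compN hi.ds.wf
  have ha : s'.arr = s.arr := by rw [hs']; rfl
  have r22 : s'.reg 22 = W := by simp [hs', Cmd.det, h5]
  have r24 : s'.reg 24 = 0 := by simp [hs', Cmd.det]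
  have r25 : s'.reg 25 = 1 := by simp [hs', Cmd.det, Nat.mod_eq_of_lt hf.one_lt]
  have r26 : s'.reg 26 = 0 := by simp [hs', Cmd.det]
  have r : ∀ r, r ≠ 22 → r ≠ 24 → r ≠ 25 → r ≠ 26 → s'.reg r = s.reg r := by
    intro r h h' h'' h'''; simp [hs', Cmd.det, h, h', h'', h''']
  have r20 : s'.reg 20 = s.reg 20 := by apply r <;> decide
  have r21 : s'.reg 21 = s.reg 21 := by apply r <;> decide
  have r23 : s'.reg 23 = s.reg 23 := by apply r <;> decide
  have r27 : s'.reg 27 = s.reg 27 := by apply r <;> decide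
  have r38 : s'.reg 38 = s.reg 38 := by apply r <;> decide
  refine ⟨hi.of_arr ha (fun i hi => r i (by omega) (by omega) (by omega) (by omega)) r20 ?_ ?_, ?_⟩
  · rw [r21, r20, r27]; omega
  · right
    rw [r21, r22, r23, r24, r25, r26, r20, r38]
    have hg1 := hsi.fuel_pos hi.ds.wf
    refine ⟨h21, hXΓ, g - 1, by omega, ?_⟩
    obtain ⟨E, e1, e2, e3, e4⟩ := hsi.scan
    have hm : ∀ b y, Mem n s' b y ↔ Mem n s b y := by simp [Mem, item, ha]
    refine ⟨hsi.root_lt, (hm _ _).2 hsi.mem_root, ?_, by simp, Nat.zero_le _,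
      by rw [ha]; exact hsi.len_le, le_rfl, le_rfl, by omega, fun _ => rfl,
      fun _ _ => Nat.zero_le _, ?_⟩
    · intro y hy
      exact WGraph.ReachN.mono hl.le (hsi.reach y ((hm _ _).1 hy))
    · refine ⟨∅, by simp, ?_, by simp, ?_⟩
      · intro _ y
        simp
        omega
      · obtain ⟨e5, e6⟩ := e3 rfl
        rw [if_pos hl, e5, e6] at e4
        rw [if_neg (lt_irrefl W)]
        simp only [stageCost, Finset.card_empty, Nat.sub_zero] at e4 ⊢
        omega
  · rw [curVal, curVal, r20, r21, r22, r23, r27, r38]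
    congr 3
    -- This is the purpose of the alternative `i = W` in `WGraph.hit`: after the change of level,
    -- the condition on the lower level has already been verified.
    rw [WGraph.hit, WGraph.hit]
    refine if_congr (and_congr_left fun _ => ?_) rfl rfl
    simp only [true_or, true_iff]
    right
    omega

/-- The component at level W was explored completely within the threshold, so the sample is not a
hit. -/
theorem search_finish {fuel : ℕ} {f : ℕ → ℝ≥0∞}
    (hi : EstInv W Γ S G (fuel + 1) s) (h21 : s.reg 21 = 1)
    (hX : s.arr 1 (n * (W + 1) + 1) ≤ s.reg 23)
    (hh : s.arr 1 (n * (W + 1) + 1) ≤ s.reg 24) (hl : W ≤ s.reg 22)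
    (hs' : s' = Cmd.det w (.assign 21 (.const 0)) s) :
    EstInv W Γ S G fuel s' ∧ curVal W Γ G f s' = curVal W Γ G f s := by
  obtain ⟨-, hXΓ, g, hg, hsi⟩ := hi.phase.resolve_left (by omega)
  have hcnt := hi.count
  have hhe : s.reg 24 = s.arr 1 (n * (W + 1) + 1) := le_antisymm hsi.h_le hh
  rw [hhe] at hsi
  have hcomp := hsi.len_eq_compN hi.ds.wf
  have hle : s.reg 22 = W := le_antisymm hsi.lev_le hl
  rw [hle] at hcomp
  have hg1 := hsi.fuel_pos hi.ds.wf
  have ha : s'.arr = s.arr := by rw [hs']; rfl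
  have r21 : s'.reg 21 = 0 := by simp [hs', Cmd.det]
  have r : ∀ r, r ≠ 21 → s'.reg r = s.reg r := by
    intro r h; simp [hs', Cmd.det, h]
  have r20 := r 20 (by decide)
  have r27 := r 27 (by decide)
  refine ⟨hi.of_arr ha (fun i hi => r i (by omega)) r20 ?_ ?_, ?_⟩
  · rw [r21, r20, r27]; omega
  · left
    rw [r21, r20]
    omega
  · rw [curVal, curVal, r20, r21, r27, if_pos rfl, if_neg (by omega : s.reg 21 ≠ 0)]
    congr 2
    rw [WGraph.hit, if_neg]
    rintro ⟨_, h⟩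
    omega

theorem search_spec {fuel : ℕ} {f : ℕ → ℝ≥0∞} (hf : Fits w n W Γ S) (hG : ∀ v, G s(v, v) = 0)
    (hi : EstInv W Γ S G (fuel + 1) s) (h21 : s.reg 21 = 1) :
    EstInv W Γ S G fuel (searchCmd.det w s) ∧
      curVal W Γ G f (searchCmd.det w s) = curVal W Γ G f s := by
  obtain ⟨h4, h5, h12, h13⟩ := hi.cfg
  have hw1 := hf.one_lt
  rw [searchCmd]
  by_cases c1 : s.reg 23 < s.arr 1 (n * (W + 1) + 1)
  · rw [det_ite_pos ((eval_lt_ne hw1).2 (by simpa [h13] using c1))]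
    exact search_exceed hf hi h21 c1 rfl
  rw [det_ite_neg ((eval_lt_eq hw1).2 (by simpa [h13] using c1))]
  rw [not_lt] at c1
  by_cases c2 : s.reg 24 < s.arr 1 (n * (W + 1) + 1)
  · rw [det_ite_pos ((eval_lt_ne hw1).2 (by simpa [h13] using c2)), scanCmd]
    by_cases c3 : s.reg 22 < s.reg 25
    · rw [det_ite_pos ((eval_lt_ne hw1).2 (by simpa using c3))]
      exact search_next hf hi h21 c1 c2 c3 rfl
    rw [det_ite_neg ((eval_lt_eq hw1).2 (by simpa using c3))]
    rw [not_lt] at c3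
    obtain ⟨-, hXΓ, g, hg, hsi⟩ := hi.phase.resolve_left (by omega)
    have hfr := hf.row
    have hfb := hf.bucket
    have hwf := hi.ds.wf (n * (W + 1) + 1) (by omega)
    have hrow := row_lt (show n * (W + 1) + 1 < n * (W + 1) + 2 by omega)
      (show s.reg 24 < n by omega)
    have hu := (hwf.2 _ c2).1
    have hb : item n s (n * (W + 1) + 1) (s.reg 24) * (W + 1) + s.reg 25 < n * (W + 1) :=
      row_lt hu (by have := hsi.lev_le; omega)
    have h40 : Cmd.det w (.assign 40 (.read 2 (.reg 13 * .reg 4 + .reg 24)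
        * (.reg 5 + .const 1) + .reg 25)) s
        = s.setReg 40 (item n s (n * (W + 1) + 1) (s.reg 24) * (W + 1) + s.reg 25) := by
      rw [item] at hb ⊢
      simp only [Cmd.det]
      congr 1
      simp [h13, h4, h5]
      rw [Nat.mod_eq_of_lt (a := _ * n + _) (by omega), Nat.mod_eq_of_lt (by omega)]
    rw [Cmd.det_seq, h40]
    by_cases c4 : s.reg 26 < s.arr 1
        (item n s (n * (W + 1) + 1) (s.reg 24) * (W + 1) + s.reg 25)
    · rw [det_ite_pos ((eval_lt_ne hw1).2 (by simpa using c4))]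
      exact search_edge hf hG hi h21 c1 c2 c3 c4 rfl
    · rw [det_ite_neg ((eval_lt_eq hw1).2 (by simpa using c4))]
      exact search_class hf hi h21 c2 c3 (not_lt.1 c4) rfl
  rw [det_ite_neg ((eval_lt_eq hw1).2 (by simpa [h13] using c2))]
  rw [not_lt] at c2
  by_cases c5 : s.reg 22 < W
  · rw [det_ite_pos ((eval_lt_ne hw1).2 (by simpa [h5] using c5))]
    exact search_stage hf hi h21 c1 c2 c5 rfl
  · rw [det_ite_neg ((eval_lt_eq hw1).2 (by simpa [h5] using c5))]
    exact search_finish hi h21 c1 c2 (not_lt.1 c5) rfl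

/-- Setting the size of the scratch bucket to 0 empties it in one step, since consistency constrains
only entries below the size. The cost of this sample is released from the cost reserved for the
remaining samples. -/
theorem sampleInit_spec {fuel q i j : ℕ} {f : ℕ → ℝ≥0∞} (hf : Fits w n W Γ S)
    (hi : EstInv W Γ S G (fuel + 1) s) (h21 : s.reg 21 = 0) (h20 : s.reg 20 = q + 1)
    (hii : i < s.arr 1 (n * (W + 1))) (hj : j < W)
    (hs' : s' = sampleInit.det w ((s.setReg 38 i).setReg 22 j)) :
    EstInv W Γ S G fuel s' ∧ curVal W Γ G f s' = G.estVal W Γ f q (s.reg 27 +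
      G.hit W (Γ / (q % Γ + 1)) j (item n s (n * (W + 1)) i)) := by
  obtain ⟨h4, h5, h12, h13⟩ := hi.cfg
  have h8 := hi.reg_Γ
  obtain ⟨-, hph⟩ := hi.phase.resolve_right (by omega)
  have hcnt := hi.count
  have hfr := hf.row
  have hfb := hf.bucket
  have hW1 := hf.W_pos
  have hΓ := hf.Γ_pos
  have hΓ' := hf.Γ_lt
  have hS := hf.S_lt
  have hmod : q % Γ < Γ := Nat.mod_lt _ hΓ
  have hdiv : Γ / (q % Γ + 1) ≤ Γ := Nat.div_le_self _ _
  have hwf := hi.ds.wf (n * (W + 1)) (by omega)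
  have hv := (hwf.2 i hii).1
  set v := item n s (n * (W + 1)) i with hvdef
  have hrow := row_lt (show n * (W + 1) < n * (W + 1) + 2 by omega) (show i < n by omega)
  set s2 := (s.setReg 38 i).setReg 22 j with hs2
  rw [sampleInit, Cmd.det_seq] at hs'
  set s3 := Cmd.det w (.seq (.assign 38 (.read 2 (.reg 12 * .reg 4 + .reg 38)))
    (.seq (.assign 20 (.reg 20 - .const 1))
    (.seq (.assign 23 (.reg 8 / (.reg 20 % .reg 8 + .const 1)))
    (.seq (.assign 21 (.const 1))
    (.seq (.assign 24 (.const 0))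
    (.seq (.assign 25 (.const 1))
    (.seq (.assign 26 (.const 0))
    (.seq (.write 1 (.reg 13) (.const 0))
    (.seq (.assign 30 (.reg 13))
    (.assign 31 (.reg 38))))))))))) s2 with hs3
  have e1 : 1 % 2 ^ w = 1 := Nat.mod_eq_of_lt (by omega)
  have eq : q % 2 ^ w = q := Nat.mod_eq_of_lt (by omega)
  have ev : s.arr 2 ((n * (W + 1) * n + i) % 2 ^ w) = v := by
    rw [Nat.mod_eq_of_lt (by omega), hvdef, item]
  have p38 : s3.reg 38 = v := by simp [hs3, hs2, Cmd.det, h12, h4, ev]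
  have p31 : s3.reg 31 = v := by simp [hs3, hs2, Cmd.det, h12, h4, ev]
  have p20 : s3.reg 20 = q := by simp [hs3, hs2, Cmd.det, h20, e1, eq]
  have p23 : s3.reg 23 = Γ / (q % Γ + 1) := by
    simp [hs3, hs2, Cmd.det, h20, e1, eq, h8]
    rw [Nat.mod_eq_of_lt (a := q % Γ + 1) (by omega), Nat.mod_eq_of_lt (by omega)]
  have p21 : s3.reg 21 = 1 := by simp [hs3, hs2, Cmd.det, e1]
  have p22 : s3.reg 22 = j := by simp [hs3, hs2, Cmd.det]
  have p24 : s3.reg 24 = 0 := by simp [hs3, hs2, Cmd.det]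
  have p25 : s3.reg 25 = 1 := by simp [hs3, hs2, Cmd.det, e1]
  have p26 : s3.reg 26 = 0 := by simp [hs3, hs2, Cmd.det]
  have p30 : s3.reg 30 = n * (W + 1) + 1 := by simp [hs3, hs2, Cmd.det, h13]
  have p27 : s3.reg 27 = s.reg 27 := by simp [hs3, hs2, Cmd.det]
  have plow : ∀ r, r < 20 → s3.reg r = s.reg r := by
    intro r hr
    simp [hs3, hs2, Cmd.det, show r ≠ 38 by omega, show r ≠ 31 by omega, show r ≠ 20 by omega,
      show r ≠ 23 by omega, show r ≠ 21 by omega, show r ≠ 22 by omega, show r ≠ 24 by omega,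
      show r ≠ 25 by omega, show r ≠ 26 by omega, show r ≠ 30 by omega]
  have a1 : ∀ b, s3.arr 1 b = if b = n * (W + 1) + 1 then 0 else s.arr 1 b := by
    intro b
    simp [hs3, hs2, Cmd.det, h13]
  have a2 : s3.arr 2 = s.arr 2 := by
    funext b; simp [hs3, hs2, Cmd.det]
  have a3 : s3.arr 3 = s.arr 3 := by
    funext b; simp [hs3, hs2, Cmd.det]
  have a4 : s3.arr 4 = s.arr 4 := by
    funext b; simp [hs3, hs2, Cmd.det]
  have i3 : item n s3 = item n s := by funext b k; simp [item, a2]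
  have wf3 : WF n (n * (W + 1) + 2) s3 := by
    intro b hb
    rw [a1, i3, a3]
    split_ifs with h
    · simp
    · exact hi.ds.wf b hb
  have m3 : ∀ b, b ≠ n * (W + 1) + 1 → ∀ y, Mem n s3 b y ↔ Mem n s b y := by
    intro b hb y
    rw [Mem, Mem, i3, a1, if_neg hb]
  have m3v : ∀ y, ¬ Mem n s3 (n * (W + 1) + 1) y := by
    rintro y ⟨k, hk, _⟩
    rw [a1, if_pos rfl] at hk
    omega
  obtain ⟨wf', m', i', -, l2⟩ := add_spec hfr wf3 (by rw [plow 4 (by omega), h4]) p30 p31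
    (by omega) hv hs'
  have r' : ∀ r, addCmd.modReg r = false → s'.reg r = s3.reg r := fun r hr => by
    rw [hs']; exact Cmd.det_reg hr s3
  have r20 : s'.reg 20 = q := by rw [r' 20 rfl, p20]
  have r21 : s'.reg 21 = 1 := by rw [r' 21 rfl, p21]
  have r22 : s'.reg 22 = j := by rw [r' 22 rfl, p22]
  have r23 : s'.reg 23 = Γ / (q % Γ + 1) := by rw [r' 23 rfl, p23]
  have r24 : s'.reg 24 = 0 := by rw [r' 24 rfl, p24]
  have r25 : s'.reg 25 = 1 := by rw [r' 25 rfl, p25]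
  have r26 : s'.reg 26 = 0 := by rw [r' 26 rfl, p26]
  have r27 : s'.reg 27 = s.reg 27 := by rw [r' 27 rfl, p27]
  have r38 : s'.reg 38 = v := by rw [r' 38 rfl, p38]
  have hm' : ∀ b' < n * (W + 1) + 1, ∀ y, Mem n s' b' y ↔ Mem n s b' y := by
    intro b' hb' y
    rw [m' b' (by omega), m3 b' (by omega)]
    simp [show b' ≠ n * (W + 1) + 1 by omega]
  have hmv : ∀ y, Mem n s' (n * (W + 1) + 1) y ↔ y = v := by
    intro y
    rw [m' _ (by omega)]
    simp [m3v]
  have hlen : s'.arr 1 (n * (W + 1) + 1) = 1 := by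
    rw [l2 (m3v v), if_pos rfl, a1, if_pos rfl]
  refine ⟨⟨?_, ?_, ?_, ?_, ?_, ?_⟩, ?_⟩
  · rw [IsCfg, r' 4 rfl, r' 5 rfl, r' 12 rfl, r' 13 rfl, plow 4 (by omega), plow 5 (by omega),
      plow 12 (by omega), plow 13 (by omega)]
    exact hi.cfg
  · refine hi.ds.of_search wf' hm' ?_
    rw [hs', Cmd.det_arr rfl, a4]
  · rw [r' 8 rfl, plow 8 (by omega), h8]
  · have := hi.nis
    omega
  · rw [r20, r21, r27]; omega
  · right
    rw [r21, r22, r23, r24, r25, r26, r20, r38]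
    have ht : totalCost W Γ (q + 1) = totalCost W Γ q + sampleCost W (Γ / (q % Γ + 1)) := by
      rw [totalCost, totalCost, Finset.sum_range_succ]
    rw [h20, ht] at hph
    have hsc : 3 ≤ sampleCost W (Γ / (q % Γ + 1)) := by rw [sampleCost]; omega
    refine ⟨rfl, hdiv, fuel - totalCost W Γ q, by omega, ?_⟩
    refine ⟨hv, (hmv v).2 rfl, ?_, by omega, by omega, by omega, by omega, by omega, by omega,
      fun _ => rfl, fun _ _ => Nat.zero_le _, ∅, by simp, ?_, by simp, ?_⟩
    · intro y hy
      rw [(hmv y).1 hy]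
      exact ⟨hv, hv, SimpleGraph.Reachable.refl _⟩
    · intro _ y
      simp
      omega
    · rw [if_pos hj]
      rw [sampleCost] at hph
      simp only [Nat.sub_zero, Finset.card_empty]
      rw [stageCost] at hph ⊢
      omega
  · rw [curVal, r20, r21, r22, r23, r27, r38, if_neg one_ne_zero]

/-- One step of the estimator preserves the invariant and the expected final value. -/
theorem tick_spec {fuel : ℕ} {f : ℕ → ℝ≥0∞} (hf : Fits w n W Γ S) (hG : ∀ v, G s(v, v) = 0)
    (hi : EstInv W Γ S G (fuel + 1) s) :
    Tr w tick s tick.cost (EstInv W Γ S G fuel) (curVal W Γ G f) (curVal W Γ G f s) := by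
  have hcost : tick.cost = max searchCmd.cost sampleCmd.cost + 1 := rfl
  rw [hcost]
  refine Tr.ite (fun h => ?_) (fun h => ?_)
  · rw [eval_reg] at h
    obtain ⟨x1, x2⟩ := search_spec (f := f) hf hG hi (by have := hi.phase; omega)
    exact (tr_det rfl x1 x2.ge).mono (le_max_left _ _) (fun _ h => h) (fun _ _ => le_rfl) le_rfl
  · rw [eval_reg] at h
    obtain ⟨h4, h5, h12, h13⟩ := hi.cfg
    refine Tr.mono (T := sampleCmd.cost) ?_ (le_max_right _ _) (fun _ h => h)
      (fun _ _ => le_rfl) le_rfl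
    refine Tr.ite (T := max (Cmd.seq (.rand 38 (.read 1 (.reg 12)))
      (.seq (.rand 22 (.reg 5)) sampleInit)).cost skip.cost) (fun hq => ?_) (fun hq => ?_)
    · rw [eval_reg] at hq
      obtain ⟨q, hq⟩ := Nat.exists_eq_succ_of_ne_zero hq
      refine Tr.mono (T := _) ?_ (le_max_left _ _) (fun _ h => h) (fun _ _ => le_rfl) le_rfl
      have hN := hi.ds.card_nis hG
      have hN0 : 0 < G.nonIsolated.card := hi.nis.resolve_left (by omega)
      have hsum := hi.ds.sum_nis hG fun v => (∑ i ∈ Finset.range W,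
        G.estVal W Γ f q (s.reg 27 + G.hit W (Γ / (q % Γ + 1)) i v)) / W
      have hev : (Expr.read 1 (.reg 12)).eval w s = s.arr 1 (n * (W + 1)) := by simp [h12]
      have hc1 : (Cmd.seq (.rand 38 (.read 1 (.reg 12)))
        (.seq (.rand 22 (.reg 5)) sampleInit)).cost = 1 + (1 + sampleInit.cost + 1) + 1 := rfl
      rw [hc1]
      -- The two random choices follow the two averages in `WGraph.estVal`: after the vertex is
      -- drawn, only the average over the levels is left.
      refine Tr.seq (P := fun s' => ∃ i < s.arr 1 (n * (W + 1)), s' = s.setReg 38 i)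
        (f := fun s' => (∑ i ∈ Finset.range W, G.estVal W Γ f q (s.reg 27 +
          G.hit W (Γ / (q % Γ + 1)) i (item n s (n * (W + 1)) (s'.reg 38)))) / W)
        (tr_rand (by rw [hev]; omega) ?_ ?_) ?_
      · rw [hev]
        exact fun i hi => ⟨i, hi, rfl⟩
      · rw [hev, curVal, if_pos h, add_zero, hq, WGraph.estVal]
        simp only [Store.setReg_reg, if_true]
        rw [hsum, hN]
      · rintro s1 ⟨i, hilt, rfl⟩
        have hev2 : (Expr.reg 5).eval w (s.setReg 38 i) = W := by simp [h5]
        refine Tr.seq (P := fun s' => ∃ j < W, s' = (s.setReg 38 i).setReg 22 j)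
          (f := fun s' => G.estVal W Γ f q (s.reg 27 +
            G.hit W (Γ / (q % Γ + 1)) (s'.reg 22) (item n s (n * (W + 1)) i)))
          (tr_rand (by rw [hev2]; exact hf.W_pos) ?_ ?_) ?_
        · rw [hev2]
          exact fun j hj => ⟨j, hj, rfl⟩
        · rw [hev2]
          simp
        · rintro s2 ⟨j, hj, rfl⟩
          obtain ⟨x1, x2⟩ := sampleInit_spec (f := f) hf hi h hq hilt hj rfl
          exact tr_det rfl x1 (by rw [x2]; simp)
    · rw [eval_reg] at hq
      refine Tr.mono (tr_det (c := skip) rfl (P := EstInv W Γ S G fuel)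
        (f := curVal W Γ G f) (v := curVal W Γ G f s) ?_ ?_) (le_max_right _ _) (fun _ h => h)
        (fun _ _ => le_rfl) le_rfl
      · refine hi.of_arr rfl (fun r hr => ?_) ?_ ?_ ?_
        · simp [skip, Cmd.det, show r ≠ 39 by omega]
        · simp [skip, Cmd.det]
        · simpa [skip, Cmd.det] using hi.count
        · left
          simp [skip, Cmd.det, h, hq, totalCost]
      · simp [curVal, skip, Cmd.det]

end

end RAM

/-! ## The accuracy of the estimator -/

namespace WGraph

variable {n : ℕ} {G : WGraph n} {W Γ : ℕ}

theorem estVal_mono {f g : ℕ → ℝ≥0∞} (h : ∀ c, f c ≤ g c) (q c : ℕ) :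
    G.estVal W Γ f q c ≤ G.estVal W Γ g q c := by
  induction q generalizing c with
  | zero => exact h c
  | succ q ih =>
    rw [estVal, estVal]
    refine ENNReal.div_le_div_right (Finset.sum_le_sum fun v _ => ?_) _
    exact ENNReal.div_le_div_right (Finset.sum_le_sum fun i _ => ih _) _

theorem estVal_add (f g : ℕ → ℝ≥0∞) (q c : ℕ) :
    G.estVal W Γ (fun c => f c + g c) q c = G.estVal W Γ f q c + G.estVal W Γ g q c := by
  induction q generalizing c with
  | zero => rfl
  | succ q ih =>
    simp only [estVal, ih, Finset.sum_add_distrib, ENNReal.add_div]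

theorem estVal_one (hW : 1 ≤ W) (hN : 0 < G.nonIsolated.card) (q c : ℕ) :
    G.estVal W Γ (fun _ => 1) q c = 1 := by
  induction q generalizing c with
  | zero => rfl
  | succ q ih =>
    have hW' : (W : ℝ≥0∞) ≠ 0 := by simp; omega
    have hN' : (G.nonIsolated.card : ℝ≥0∞) ≠ 0 := by
      rw [Nat.cast_ne_zero]; omega
    simp [estVal, ih, ENNReal.div_self hW' (by simp), ENNReal.div_self hN' (by simp)]

/-- The probability of a hit with threshold `X`. -/
noncomputable def hitProb (G : WGraph n) (W X : ℕ) : ℝ :=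
  (∑ v ∈ G.nonIsolated, (∑ i ∈ Finset.range W, (G.hit W X i v : ℝ)) / W) / G.nonIsolated.card

/-- Moment generating function: a sample with hit probability p multiplies the expectation of
exp(l·count) by 1 + (e^l − 1)p ≤ exp((e^l − 1)p), whatever happened before. The shift `k` centers
the exponential for the tail bounds. -/
theorem estVal_exp_le (hW : 1 ≤ W) (hN : 0 < G.nonIsolated.card) (l k : ℝ) (q c : ℕ) :
    G.estVal W Γ (fun c => ENNReal.ofReal (Real.exp (l * c + k))) q c ≤
      ENNReal.ofReal (Real.exp (l * c + k +
        (Real.exp l - 1) * ∑ j ∈ Finset.range q, G.hitProb W (Γ / (j % Γ + 1)))) := by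
  induction q generalizing c with
  | zero => simp [estVal]
  | succ q ih =>
    have hW' : (0 : ℝ) < W := by exact_mod_cast hW
    have hN' : (0 : ℝ) < G.nonIsolated.card := by exact_mod_cast hN
    set m := ∑ j ∈ Finset.range q, G.hitProb W (Γ / (j % Γ + 1)) with hm
    set X := Γ / (q % Γ + 1) with hX
    have h1 : G.estVal W Γ (fun c => ENNReal.ofReal (Real.exp (l * c + k))) (q + 1) c ≤
        ENNReal.ofReal ((∑ v ∈ G.nonIsolated, (∑ i ∈ Finset.range W,
          Real.exp (l * ((c + G.hit W X i v : ℕ) : ℝ) + k + (Real.exp l - 1) * m)) / W)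
            / G.nonIsolated.card) := by
      rw [estVal, ENNReal.ofReal_div_of_pos hN', ENNReal.ofReal_natCast,
        ENNReal.ofReal_sum_of_nonneg (fun v _ => by positivity)]
      refine ENNReal.div_le_div_right (Finset.sum_le_sum fun v _ => ?_) _
      rw [ENNReal.ofReal_div_of_pos hW', ENNReal.ofReal_natCast,
        ENNReal.ofReal_sum_of_nonneg (fun i _ => by positivity)]
      exact ENNReal.div_le_div_right (Finset.sum_le_sum fun i _ => ih _) _
    refine h1.trans (ENNReal.ofReal_le_ofReal ?_)
    have h2 : ∀ v i : ℕ, Real.exp (l * ((c + G.hit W X i v : ℕ) : ℝ) + k + (Real.exp l - 1) * m)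
        = Real.exp (l * c + k + (Real.exp l - 1) * m) * (1 + (Real.exp l - 1) * G.hit W X i v) := by
      intro v i
      have h3 : G.hit W X i v = 0 ∨ G.hit W X i v = 1 := by
        have := G.hit_le_one W X i v; omega
      rcases h3 with h3 | h3
      · simp [h3]
      · rw [h3, ← mul_comm (1 + _)]
        push_cast
        rw [show l * ((c : ℝ) + 1) + k + (Real.exp l - 1) * m
          = l + (l * c + k + (Real.exp l - 1) * m) by ring, Real.exp_add]
        ring
    simp only [h2, ← Finset.mul_sum, Finset.sum_add_distrib, mul_div_assoc]
    rw [Finset.sum_range_succ, mul_add, ← add_assoc, ← hm,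
      Real.exp_add _ ((Real.exp l - 1) * G.hitProb W X)]
    refine mul_le_mul_of_nonneg_left ?_ (Real.exp_pos _).le
    have h4 : (∑ v ∈ G.nonIsolated, (∑ i ∈ Finset.range W, (1 : ℝ) +
        (Real.exp l - 1) * ∑ i ∈ Finset.range W, (G.hit W X i v : ℝ)) / W) / G.nonIsolated.card
        = 1 + (Real.exp l - 1) * G.hitProb W X := by
      rw [hitProb]
      simp only [Finset.sum_const, Finset.card_range, nsmul_eq_mul, mul_one, add_div, mul_div_assoc,
        Finset.sum_add_distrib, ← Finset.mul_sum]
      rw [div_self hW'.ne', mul_one_div_cancel hN'.ne']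
    rw [h4, add_comm]
    exact Real.add_one_le_exp _

theorem sum_mod (f : ℕ → ℝ) (R : ℕ) :
    ∑ j ∈ Finset.range (R * Γ), f (j % Γ) = R * ∑ j ∈ Finset.range Γ, f j := by
  induction R with
  | zero => simp
  | succ R ih =>
    rw [Nat.succ_mul, Finset.sum_range_add, ih]
    push_cast
    rw [add_mul, one_mul]
    congr 1
    refine Finset.sum_congr rfl fun j hj => ?_
    rw [mul_comm R, Nat.mul_add_mod, Nat.mod_eq_of_lt (Finset.mem_range.1 hj)]

/-- C ≤ ⌊Γ/(j+1)⌋ is equivalent to j + 1 ≤ ⌊Γ/C⌋. This is why the thresholds Γ/(j+1) reproduce the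
reciprocal 1/C. -/
theorem card_div_le {C : ℕ} (hC : 1 ≤ C) :
    ((Finset.range Γ).filter fun j => C ≤ Γ / (j + 1)).card = Γ / C := by
  have : (Finset.range Γ).filter (fun j => C ≤ Γ / (j + 1)) = Finset.range (Γ / C) := by
    ext j
    simp only [Finset.mem_filter, Finset.mem_range]
    rw [Nat.le_div_iff_mul_le (Nat.succ_pos j), Nat.lt_iff_add_one_le (n := Γ / C),
      Nat.le_div_iff_mul_le (by omega), mul_comm]
    refine ⟨fun h => h.2, fun h => ⟨?_, h⟩⟩
    have := Nat.le_mul_of_pos_right (j + 1) (show 0 < C by omega)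
    omega
  rw [this, Finset.card_range]

/-- Components grow with the level, so the hit indicator is the difference of two indicators counted
by `card_div_le`. Each of the two floors errs by an amount in [0, 1], hence so does their difference
up to sign. -/
theorem sum_hit {i v : ℕ} (hi : i < W) (hv : v < n) :
    |∑ j ∈ Finset.range Γ, (G.hit W (Γ / (j + 1)) i v : ℝ) -
      Γ * (1 / (G.compN i v : ℝ) - 1 / (G.compN W v : ℝ))| ≤ 1 := by
  have h1 : 1 ≤ G.compN i v := by
    rw [compN, dif_pos hv]; exact SimpleGraph.compCard_pos _ _
  have h2 : G.compN i v ≤ G.compN W v := by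
    rw [compN, compN, dif_pos hv, dif_pos hv]
    exact SimpleGraph.compCard_mono (G.level_mono hi.le) _
  have h3 : ∑ j ∈ Finset.range Γ, (G.hit W (Γ / (j + 1)) i v : ℝ)
      = ((Γ / G.compN i v : ℕ) : ℝ) - ((Γ / G.compN W v : ℕ) : ℝ) := by
    rw [← card_div_le (Γ := Γ) h1, ← card_div_le (Γ := Γ) (h1.trans h2), Finset.card_filter,
      Finset.card_filter]
    push_cast
    rw [← Finset.sum_sub_distrib]
    refine Finset.sum_congr rfl fun j _ => ?_
    rw [hit]
    have : i ≠ W := hi.ne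
    by_cases c1 : G.compN W v ≤ Γ / (j + 1)
    · rw [if_neg (by omega), if_pos (by omega), if_pos c1]; simp
    · by_cases c2 : G.compN i v ≤ Γ / (j + 1)
      · rw [if_pos ⟨Or.inr c2, by omega⟩, if_pos c2, if_neg c1]; simp
      · rw [if_neg (by omega), if_neg c2, if_neg c1]; simp
  have hdiv : ∀ C : ℕ, 1 ≤ C → ((Γ / C : ℕ) : ℝ) ≤ Γ * (1 / (C : ℝ)) ∧
      Γ * (1 / (C : ℝ)) ≤ ((Γ / C : ℕ) : ℝ) + 1 := by
    intro C hC
    have hC' : (0 : ℝ) < C := by exact_mod_cast hC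
    rw [mul_one_div]
    refine ⟨Nat.cast_div_le, ?_⟩
    rw [div_le_iff₀ hC']
    have := Nat.div_add_mod Γ C
    have h5 := Nat.mod_lt Γ (show C > 0 by omega)
    have : Γ ≤ (Γ / C + 1) * C := by
      rw [add_mul, one_mul, mul_comm]; omega
    exact_mod_cast this
  have h5 := hdiv _ h1
  have h6 := hdiv _ (h1.trans h2)
  rw [h3, abs_le]
  constructor <;> linarith

theorem sum_hitProb (hW : 1 ≤ W) (hG : G.WeightsIn W) (hN : 0 < G.nonIsolated.card) (R : ℕ) :
    |∑ j ∈ Finset.range (R * Γ), G.hitProb W (Γ / (j % Γ + 1)) -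
      R * Γ * (G.msfWeight / (G.nonIsolated.card * W))| ≤ R := by
  have hW' : (0 : ℝ) < W := by exact_mod_cast hW
  have hN' : (0 : ℝ) < G.nonIsolated.card := by exact_mod_cast hN
  rw [sum_mod (fun j => G.hitProb W (Γ / (j + 1)))]
  have h1 : ∑ j ∈ Finset.range Γ, G.hitProb W (Γ / (j + 1)) =
      (∑ v ∈ G.nonIsolated, (∑ i ∈ Finset.range W, ∑ j ∈ Finset.range Γ,
        (G.hit W (Γ / (j + 1)) i v : ℝ)) / W) / G.nonIsolated.card := by
    simp only [hitProb]
    rw [← Finset.sum_div, Finset.sum_comm]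
    congr 1
    refine Finset.sum_congr rfl fun v _ => ?_
    rw [← Finset.sum_div, Finset.sum_comm]
  have h2 : (Γ : ℝ) * (G.msfWeight / (G.nonIsolated.card * W)) =
      (∑ v ∈ G.nonIsolated, (∑ i ∈ Finset.range W,
        Γ * (1 / (G.compN i v : ℝ) - 1 / (G.compN W v : ℝ))) / W) / G.nonIsolated.card := by
    rw [msfWeight_eq_sum_nonIsolated hG, ← Finset.sum_div, div_div, mul_comm (W : ℝ),
      ← mul_div_assoc, Finset.mul_sum]
    congr 1
    refine Finset.sum_congr rfl fun v _ => ?_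
    rw [contrib, Finset.mul_sum]
    simp [compN]
  have h3 : |∑ j ∈ Finset.range Γ, G.hitProb W (Γ / (j + 1)) -
      Γ * (G.msfWeight / (G.nonIsolated.card * W))| ≤ 1 := by
    rw [h1, h2, ← sub_div, ← Finset.sum_sub_distrib, abs_div, abs_of_pos hN', div_le_one hN']
    calc _ ≤ ∑ v ∈ G.nonIsolated, (1 : ℝ) := by
          refine (Finset.abs_sum_le_sum_abs _ _).trans (Finset.sum_le_sum fun v _ => ?_)
          rw [← sub_div, ← Finset.sum_sub_distrib, abs_div, abs_of_pos hW', div_le_one hW']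
          calc _ ≤ ∑ i ∈ Finset.range W, (1 : ℝ) :=
                (Finset.abs_sum_le_sum_abs _ _).trans (Finset.sum_le_sum fun i hi =>
                  sum_hit (Finset.mem_range.1 hi) v.2)
            _ = W := by simp
      _ = G.nonIsolated.card := by simp
  rw [mul_assoc, ← mul_sub, abs_mul, abs_of_nonneg (Nat.cast_nonneg R)]
  exact mul_le_of_le_one_right (Nat.cast_nonneg R) h3

/-- Chernoff exponents with parameter ±δ/4 for a deviation of δ/2 from the nominal mean m₀, where
the true mean m may differ from m₀ by the factor 1 ± δ/8. With |e^x − 1 − x| ≤ x² the coefficient of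
m₀δ² is −1/8 + 1/32 + 1/16 ± δ/128 ≤ −3/128. -/
theorem tail_exponents {δ m₀ m : ℝ} (hδ : 0 < δ) (hδ1 : δ ≤ 1) (hm₀ : 0 ≤ m₀)
    (hm : |m - m₀| ≤ δ / 8 * m₀) :
    -(δ / 4) * ((1 + δ / 2) * m₀) + (Real.exp (δ / 4) - 1) * m ≤ -(3 / 128) * δ ^ 2 * m₀ ∧
    δ / 4 * ((1 - δ / 2) * m₀) + (Real.exp (-(δ / 4)) - 1) * m ≤ -(3 / 128) * δ ^ 2 * m₀ := by
  obtain ⟨h1, h2⟩ := abs_le.1 hm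
  have e1 := (abs_le.1 (Real.abs_exp_sub_one_sub_id_le (x := δ / 4)
    (by rw [abs_of_pos (by positivity)]; linarith))).2
  have e2 := (abs_le.1 (Real.abs_exp_sub_one_sub_id_le (x := -(δ / 4))
    (by rw [abs_neg, abs_of_pos (by positivity)]; linarith))).2
  have hm0 : 0 ≤ m := by nlinarith
  constructor
  · calc _ ≤ -(δ / 4) * ((1 + δ / 2) * m₀) + (δ / 4 + (δ / 4) ^ 2) * ((1 + δ / 8) * m₀) := by
          gcongr
          · linarith
          · linarith
      _ = m₀ * δ ^ 2 * (-1 / 8 + 1 / 32 + 1 / 16 + δ / 128) := by ring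
      _ ≤ m₀ * δ ^ 2 * (-(3 / 128)) := by
          refine mul_le_mul_of_nonneg_left ?_ (by positivity)
          linarith
      _ = _ := by ring
  · have h3 : (Real.exp (-(δ / 4)) - 1) * m ≤ (-(δ / 4) + (δ / 4) ^ 2) * m := by
      refine mul_le_mul_of_nonneg_right ?_ hm0
      have : (-(δ / 4)) ^ 2 = (δ / 4) ^ 2 := by ring
      linarith
    have h4 : (-(δ / 4) + (δ / 4) ^ 2) * m ≤ (-(δ / 4) + (δ / 4) ^ 2) * ((1 - δ / 8) * m₀) := by
      refine mul_le_mul_of_nonpos_left (by linarith) ?_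
      nlinarith
    calc _ ≤ δ / 4 * ((1 - δ / 2) * m₀) + (-(δ / 4) + (δ / 4) ^ 2) * ((1 - δ / 8) * m₀) := by
          linarith
      _ = m₀ * δ ^ 2 * (-1 / 8 + 1 / 32 + 1 / 16 - δ / 128) := by ring
      _ ≤ m₀ * δ ^ 2 * (-(3 / 128)) := by
          refine mul_le_mul_of_nonneg_left ?_ (by positivity)
          linarith
      _ = _ := by ring

/-- A union bound by exponential Markov inequalities: pointwise 1 ≤ f + U + L, where the
exponentials `U` and `L` exceed 1 on the upper and the lower tail. With δ = 1/a, each has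
expectation at most e^{-3l}. -/
theorem le_estVal {a l : ℕ} (hW : 1 ≤ W) (hG : G.WeightsIn W) (hN : 0 < G.nonIsolated.card)
    (ha : 1 ≤ a) {f : ℕ → ℝ≥0∞} {m₀ : ℝ}
    (hm₀ : m₀ = (16 * a * l * (16 * W * a) : ℕ) * (G.msfWeight / (G.nonIsolated.card * W)))
    (hf : ∀ c : ℕ, |(c : ℝ) - m₀| ≤ 1 / (2 * a) * m₀ → 1 ≤ f c) :
    1 ≤ G.estVal W (16 * W * a) f (16 * a * l * (16 * W * a)) 0
      + 2 * ENNReal.ofReal (Real.exp (-3 * l)) := by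
  have hW' : (0 : ℝ) < W := by exact_mod_cast hW
  have hN' : (0 : ℝ) < G.nonIsolated.card := by exact_mod_cast hN
  have ha' : (1 : ℝ) ≤ a := by exact_mod_cast ha
  set δ : ℝ := 1 / a with hδ
  have hδ0 : 0 < δ := by positivity
  have hδ1 : δ ≤ 1 := by rw [hδ, div_le_one (by linarith)]; exact ha'
  set m := ∑ j ∈ Finset.range (16 * a * l * (16 * W * a)),
    G.hitProb W (16 * W * a / (j % (16 * W * a) + 1)) with hm
  have hM : (1 : ℝ) / 2 / W ≤ G.msfWeight / (G.nonIsolated.card * W) := by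
    have := nis_le_two_mul_msfWeight hW hG
    rw [nis_eq_card] at this
    rw [div_div, div_le_div_iff₀ (by positivity) (by positivity)]
    nlinarith
  -- This is where M ≥ N/2 enters. The constants match: the bias 16al of all cycles equals
  -- (δ/8)·128a²l, and (3/128)δ²·128a²l = 3l.
  have hm₀' : (128 : ℝ) * a ^ 2 * l ≤ m₀ := by
    rw [hm₀]
    calc (128 : ℝ) * a ^ 2 * l = (16 * a * l * (16 * W * a) : ℕ) * (1 / 2 / W) := by
          push_cast; field_simp; ring
      _ ≤ _ := by gcongr
  have hm₀0 : 0 ≤ m₀ := le_trans (by positivity) hm₀'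
  have hmm : |m - m₀| ≤ δ / 8 * m₀ := by
    have h1 := sum_hitProb (Γ := 16 * W * a) hW hG hN (16 * a * l)
    rw [← hm] at h1
    have h2 : ((16 * a * l : ℕ) : ℝ) * (16 * W * a : ℕ)
        * (G.msfWeight / (G.nonIsolated.card * W)) = m₀ := by
      rw [hm₀]; push_cast; ring
    rw [h2] at h1
    refine h1.trans ?_
    calc ((16 * a * l : ℕ) : ℝ) = δ / 8 * (128 * a ^ 2 * l) := by
          rw [hδ]; push_cast; field_simp; ring
      _ ≤ _ := by gcongr
  obtain ⟨t1, t2⟩ := tail_exponents hδ0 hδ1 hm₀0 hmm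
  have hexp : -(3 / 128) * δ ^ 2 * m₀ ≤ -3 * l := by
    have : (3 / 128) * δ ^ 2 * (128 * a ^ 2 * l) ≤ (3 / 128) * δ ^ 2 * m₀ := by gcongr
    have h5 : (3 / 128) * δ ^ 2 * (128 * a ^ 2 * l) = 3 * l := by
      rw [hδ]; field_simp
    linarith
  set U : ℕ → ℝ≥0∞ := fun c =>
    ENNReal.ofReal (Real.exp (δ / 4 * c + -(δ / 4) * ((1 + δ / 2) * m₀))) with hU
  set L : ℕ → ℝ≥0∞ := fun c =>
    ENNReal.ofReal (Real.exp (-(δ / 4) * c + δ / 4 * ((1 - δ / 2) * m₀))) with hL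
  have hone : ∀ c, (1 : ℝ≥0∞) ≤ f c + (U c + L c) := by
    intro c
    by_cases hc : |(c : ℝ) - m₀| ≤ 1 / (2 * a) * m₀
    · exact (hf c hc).trans le_self_add
    · have h2 : (1 : ℝ) / (2 * a) = δ / 2 := by rw [hδ]; field_simp
      rw [h2, not_le, lt_abs] at hc
      rcases hc with hc | hc
      · refine le_trans ?_ (le_add_left (le_self_add (a := U c)))
        rw [← ENNReal.ofReal_one]
        refine ENNReal.ofReal_le_ofReal (Real.one_le_exp ?_)
        have : 0 ≤ δ / 4 * (c - m₀ - δ / 2 * m₀) := mul_nonneg (by positivity) (by linarith)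
        linarith
      · refine le_trans ?_ (le_add_left (le_add_left (le_refl (L c))))
        rw [← ENNReal.ofReal_one]
        refine ENNReal.ofReal_le_ofReal (Real.one_le_exp ?_)
        have : 0 ≤ δ / 4 * (-(c - m₀) - δ / 2 * m₀) := mul_nonneg (by positivity) (by linarith)
        linarith
  have h1 := estVal_mono (G := G) (W := W) (Γ := 16 * W * a) hone (16 * a * l * (16 * W * a)) 0
  rw [estVal_one hW hN, estVal_add, estVal_add] at h1
  refine h1.trans (add_le_add_right ?_ _)
  rw [two_mul]
  refine add_le_add ?_ ?_
  · refine (estVal_exp_le hW hN _ _ _ _).trans (ENNReal.ofReal_le_ofReal ?_)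
    rw [← hm, Real.exp_le_exp]
    simp only [Nat.cast_zero, mul_zero, zero_add]
    linarith
  · refine (estVal_exp_le hW hN _ _ _ _).trans (ENNReal.ofReal_le_ofReal ?_)
    rw [← hm, Real.exp_le_exp]
    simp only [Nat.cast_zero, mul_zero, zero_add]
    linarith

end WGraph

/-! ## Updates as triples -/

namespace Update

variable {n : ℕ}

/-- The first endpoint of the edge that is updated. -/
def src : Update n → Fin n
  | insert u _ _ => u
  | delete u _ => u

/-- The second endpoint of the edge that is updated. -/
def dst : Update n → Fin n
  | insert _ v _ => v
  | delete _ v => v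

/-- The new weight of the edge. -/
def wt : Update n → ℕ
  | insert _ _ c => c
  | delete _ _ => 0

theorem apply_eq (G : WGraph n) (u : Update n) :
    u.apply G = Function.update G s(u.src, u.dst) u.wt := by
  cases u <;> rfl

/-- The update does not create loops or large weights. -/
def Ok (W : ℕ) (u : Update n) : Prop := u.src ≠ u.dst ∧ u.wt ≤ W

/-- `Ok` does not mention a graph, so it can be recorded with a log entry that is replayed later. -/
theorem Legal.ok {W : ℕ} {G : WGraph n} {u : Update n} (h : u.Legal W G) : u.Ok W := by
  cases u with
  | insert a b c => exact ⟨h.1, h.2.2.2⟩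
  | delete a b => exact ⟨h.1, Nat.zero_le _⟩

theorem Ok.weightsIn {W : ℕ} {G : WGraph n} {u : Update n} (h : u.Ok W) (hG : G.WeightsIn W) :
    (u.apply G).WeightsIn W := by
  rw [apply_eq]
  refine ⟨fun v => ?_, fun e => ?_⟩
  · rw [Function.update_of_ne, hG.1]
    intro he
    have := h.1
    rw [Sym2.eq_iff] at he
    rcases he with ⟨rfl, h'⟩ | ⟨rfl, h'⟩
    · exact this h'
    · exact this h'.symm
  · by_cases he : e = s(u.src, u.dst)
    · subst he
      simpa using h.2
    · rw [Function.update_of_ne he]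
      exact hG.2 e

theorem arc_apply (G : WGraph n) (u : Update n) :
    RAM.setArc (RAM.setArc G.arc u.src u.dst u.wt) u.dst u.src u.wt = (u.apply G).arc := by
  funext a b
  by_cases h : a < n ∧ b < n
  · have h1 : (u.apply G).arc a b = (u.apply G) s(⟨a, h.1⟩, ⟨b, h.2⟩) := by simp [WGraph.arc, h]
    have h2 : G.arc a b = G s(⟨a, h.1⟩, ⟨b, h.2⟩) := by simp [WGraph.arc, h]
    rw [h1, apply_eq, Function.update_apply, RAM.setArc, RAM.setArc, h2]
    simp only [Sym2.eq_iff, Fin.ext_iff]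
    split_ifs <;> first | rfl | (exfalso; tauto)
  · have h1 : (u.apply G).arc a b = 0 := by simp only [WGraph.arc, dif_neg h]
    have h2 : G.arc a b = 0 := by simp only [WGraph.arc, dif_neg h]
    have h3 := u.src.2
    have h4 := u.dst.2
    rw [h1, RAM.setArc, RAM.setArc, if_neg, if_neg, h2]
    · rintro ⟨rfl, rfl⟩; exact h ⟨h3, h4⟩
    · rintro ⟨rfl, rfl⟩; exact h ⟨h4, h3⟩

theorem abs_msfWeight_sub_le {W : ℕ} {G : WGraph n} {u : Update n} (h : u.Ok W)
    (hG : G.WeightsIn W) :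
    |((u.apply G).msfWeight : ℝ) - G.msfWeight| ≤ 2 * W := by
  obtain ⟨a, b, hd⟩ := diffAt_apply G u
  have h1 := hd.msfWeight_le hG (h.weightsIn hG)
  have h2 := hd.symm.msfWeight_le (h.weightsIn hG) hG
  have h3 : (G.msfWeight : ℝ) ≤ (u.apply G).msfWeight + 2 * W := by exact_mod_cast h1
  have h4 : ((u.apply G).msfWeight : ℝ) ≤ G.msfWeight + 2 * W := by exact_mod_cast h2
  rw [abs_le]
  constructor <;> linarith

theorem nis_le_apply (G : WGraph n) (u : Update n) : G.nis ≤ (u.apply G).nis + 2 := by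
  obtain ⟨a, b, hd⟩ := diffAt_apply G u
  exact hd.nis_le

/-- The updates in the positions `i, …, j - 1` of a log lead from one graph to the other. -/
inductive Pending (W : ℕ) (L : ℕ → ℕ × ℕ × ℕ) : ℕ → WGraph n → ℕ → WGraph n → Prop
  | refl (i : ℕ) (G : WGraph n) : Pending W L i G i G
  | step {i j : ℕ} {H G : WGraph n} (u : Update n) :
      L i = ((u.src : ℕ), (u.dst : ℕ), u.wt) → u.Ok W →
      Pending W L (i + 1) (u.apply H) j G → Pending W L i H j G

namespace Pending

variable {W i j : ℕ} {L L' : ℕ → ℕ × ℕ × ℕ} {H G : WGraph n}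

theorem le (h : Pending W L i H j G) : i ≤ j := by
  induction h with
  | refl => rfl
  | step _ _ _ _ ih => omega

theorem snoc (h : Pending W L i H j G) (u : Update n)
    (hu : L j = ((u.src : ℕ), (u.dst : ℕ), u.wt)) (ho : u.Ok W) :
    Pending W L i H (j + 1) (u.apply G) := by
  induction h with
  | refl i G => exact .step u hu ho (.refl _ _)
  | step u' h1 h2 _ ih => exact .step u' h1 h2 (ih hu)

theorem congr (h : Pending W L i H j G) (hL : ∀ k < j, L' k = L k) : Pending W L' i H j G := by
  induction h with
  | refl i G => exact .refl _ _
  | step u h1 h2 h3 ih => exact .step u (by rw [hL _ h3.le, h1]) h2 (ih hL)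

theorem eq_of_le (h : Pending W L i H j G) (hij : j ≤ i) : H = G := by
  cases h with
  | refl => rfl
  | step u h1 h2 h3 => have := h3.le; omega

theorem exists_of_lt (h : Pending W L i H j G) (hij : i < j) :
    ∃ u : Update n, L i = ((u.src : ℕ), (u.dst : ℕ), u.wt) ∧ u.Ok W ∧
      Pending W L (i + 1) (u.apply H) j G := by
  cases h with
  | refl => omega
  | step u h1 h2 h3 => exact ⟨u, h1, h2, h3⟩

theorem abs_msfWeight_sub_le (h : Pending W L i H j G) (hH : H.WeightsIn W) :
    |(G.msfWeight : ℝ) - H.msfWeight| ≤ 2 * W * (j - i : ℕ) := by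
  induction h with
  | refl => simp
  | @step i j H G u h1 h2 h3 ih =>
    have h4 := ih (h2.weightsIn hH)
    have h5 := Update.abs_msfWeight_sub_le h2 hH
    have h6 : ((j - i : ℕ) : ℝ) = (j - (i + 1) : ℕ) + 1 := by
      have := h3.le
      rw [← Nat.cast_succ]
      congr 1
      omega
    rw [h6]
    calc |(G.msfWeight : ℝ) - H.msfWeight|
        ≤ |(G.msfWeight : ℝ) - (u.apply H).msfWeight| + |((u.apply H).msfWeight : ℝ) - H.msfWeight| :=
          abs_sub_le _ _ _
      _ ≤ _ := by linarith

end Pending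

end Update

namespace RAM

/-! ## The update program -/

/-- Append the update in the registers `0`, `1`, `2` to the log. -/
def appendCmd : Cmd :=
  .seq (.write 5 (.reg 18) (.reg 0)) (.seq (.write 6 (.reg 18) (.reg 1))
    (.seq (.write 7 (.reg 18) (.reg 2)) (.assign 18 (.reg 18 + .const 1))))

/-- Apply the next update of the log (if there is one) to the stored graph. -/
def applyCmd : Cmd :=
  .ite (.op .lt (.reg 17) (.reg 18))
    (.seq (.seq (.assign 34 (.read 5 (.reg 17))) (.seq (.assign 35 (.read 6 (.reg 17)))
      (.seq (.assign 36 (.read 7 (.reg 17))) (.assign 17 (.reg 17 + .const 1)))))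
    (.seq halfSet (.seq (.seq (.assign 40 (.reg 34)) (.seq (.assign 34 (.reg 35))
      (.assign 35 (.reg 40)))) halfSet)))
    skip

/-- Start a new run of the estimator on the stored graph. -/
def startEpoch : Cmd :=
  .seq (.assign 17 (.const 0)) (.seq (.assign 18 (.const 0))
  (.seq (.assign 14 (.reg 16 + .const 1)) (.seq (.assign 19 (.reg 10 / .reg 14 + .const 1))
  (.seq (.assign 16 (.read 1 (.reg 12) / .reg 11))
  (.seq (.assign 20 (.reg 9 * .op .lt (.const 0) (.read 1 (.reg 12))))
  (.seq (.assign 21 (.const 0)) (.assign 27 (.const 0))))))))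

/-- The part of an update before the estimator is advanced. -/
def preCmd : Cmd :=
  .seq appendCmd (.ite (.reg 14) skip (.seq applyCmd (.seq applyCmd
    (.ite (.op .eq (.reg 17) (.reg 18)) startEpoch skip))))

/-- Advance the estimator. -/
def chunkCmd : Cmd := .seq (.assign 37 (.reg 19)) (tick.repeat 37)

/-- Publish the result if the run of the estimator is complete. -/
def postCmd : Cmd :=
  .seq (.assign 14 (.reg 14 - .const 1)) (.ite (.reg 14) skip
    (.seq (.assign 28 (.reg 27 * .read 1 (.reg 12) * .reg 5)) (.assign 29 (.reg 9))))

def outCmd : Cmd := .seq (.assign 0 (.reg 28)) (.assign 1 (.reg 29))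

def runCmd : Cmd := .seq chunkCmd postCmd

def updCmd : Cmd :=
  .ite (.op .lt (.reg 6) (.const 2)) (.assign 0 (.const 0))
    (.seq preCmd (.seq (.ite (.reg 14) runCmd skip) outCmd))

/-! ## The invariant -/

/-- The number of thresholds. -/
def gam (W a : ℕ) : ℕ := 16 * W * a

/-- The number of samples. -/
def smp (W a l : ℕ) : ℕ := 16 * a * l * (16 * W * a)

/-- The number of steps of the estimator. -/
def tot (W a l : ℕ) : ℕ := totalCost W (gam W a) (smp W a l)

/-- The number of non-isolated vertices per update of an epoch. -/
def quo (W a : ℕ) : ℕ := 160 * W * a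

/-- All quantities fit into a word. -/
structure Words (w n W a l : ℕ) : Prop where
  fits : Fits w n W (gam W a) (smp W a l)
  tot_lt : tot W a l + 2 < 2 ^ w
  num_lt : smp W a l * (n * W) < 2 ^ w
  quo_lt : quo W a < 2 ^ w
  n_lt : 2 * n + 4 < 2 ^ w
  two_le : 2 ≤ W
  one_le : 1 ≤ a
  one_le_l : 1 ≤ l

/-- The registers hold the parameters. -/
structure Params (n W a l : ℕ) (s : Store) : Prop where
  cfg : IsCfg n W s
  reg_a : s.reg 6 = a
  reg_Γ : s.reg 8 = gam W a
  reg_S : s.reg 9 = smp W a l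
  reg_T : s.reg 10 = tot W a l
  reg_Q : s.reg 11 = quo W a

/-- The log. -/
def logOf (s : Store) : ℕ → ℕ × ℕ × ℕ := fun i => (s.arr 5 i, s.arr 6 i, s.arr 7 i)

/-- The graph with the weight matrix in array `4`. -/
def stored (n : ℕ) (s : Store) : WGraph n := fun e => s.arr 4 (e.inf * n + e.sup)

/-- The frozen graph is a function of the store, so potentials can refer to it without a separate
argument. -/
theorem stored_eq {n W : ℕ} {s : Store} {H : WGraph n} (h : IsDS n W s H.arc) :
    stored n s = H := by
  funext e
  induction e with
  | _ a b =>
    rw [stored, h.wt _ (Fin.is_lt _) _ (Fin.is_lt _), WGraph.arc_val]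
    rcases le_total a b with h' | h'
    · simp [h']
    · simp [h', Sym2.eq_swap]

open Classical in
/-- Does the number of hits yield a good estimate? -/
noncomputable def cntInd {n : ℕ} (W a l : ℕ) (H : WGraph n) (c : ℕ) : ℝ≥0∞ :=
  if |(c : ℝ) - smp W a l * (H.msfWeight / (H.nonIsolated.card * W))|
    ≤ 1 / (2 * a) * (smp W a l * (H.msfWeight / (H.nonIsolated.card * W))) then 1 else 0

/-- The value `x` remains a good approximation during `r` further updates. -/
def GoodFor {n : ℕ} (W : ℕ) (ε x : ℝ) (G : WGraph n) (r : ℕ) : Prop :=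
  ∀ y : ℝ, 0 ≤ y → |y - G.msfWeight| ≤ 2 * W * r → IsApprox ε x y

/-- The published value. -/
noncomputable def pub (s : Store) : ℝ := (s.reg 28 : ℝ) / s.reg 29

open Classical in
noncomputable def goodInd {n : ℕ} (W : ℕ) (ε : ℝ) (G : WGraph n) (r : ℕ) (s : Store) : ℝ≥0∞ :=
  if GoodFor W ε (pub s) G r then 1 else 0

/-- The expected final indicator of a good estimate. -/
noncomputable def runVal (n W a l : ℕ) (s : Store) : ℝ≥0∞ :=
  curVal W (gam W a) (stored n s) (cntInd W a l (stored n s)) s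

/-- A lower bound for the probability that the maintained value is correct after `k` further
updates. -/
noncomputable def potential {n : ℕ} (W a l : ℕ) (ε : ℝ) (q : ℝ≥0∞) (k : ℕ) (G : WGraph n)
    (s : Store) : ℝ≥0∞ :=
  if s.reg 14 = 0 then
    -- Between runs: the replay shortens the backlog by one per update, and the next run starts in
    -- the last update of the replay, or in the next update if there is no backlog. It publishes
    -- `reg 16` updates after its start; until then the present value is in use.
    if k < max 1 (s.reg 18 - s.reg 17) + s.reg 16 then goodInd W ε G k s else q
  else if k < s.reg 14 then goodInd W ε G k s
  -- During a run: it publishes after `reg 14` more updates, when the log will have `reg 18 + reg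
  -- 14` entries, and its estimate is then in use until the next run ends. All these numbers are
  -- known when the run starts.
  else if k < s.reg 14 + max 1 (s.reg 18 + s.reg 14) + s.reg 16 then runVal n W a l s else q

/-- The same during an update, before the estimator is advanced. -/
noncomputable def midPotential {n : ℕ} (W a l : ℕ) (ε : ℝ) (q : ℝ≥0∞) (k : ℕ) (G : WGraph n)
    (s : Store) : ℝ≥0∞ :=
  if k + 1 < s.reg 14 then goodInd W ε G k s
  else if k + 1 < s.reg 14 + max 1 (s.reg 18 + s.reg 14 - 1) + s.reg 16 then runVal n W a l s else q

/-- The invariant during an update, before the estimator is advanced. The number `m` is the minimum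
number of non-isolated vertices so far. -/
structure Mid {n : ℕ} (W a l m : ℕ) (G : WGraph n) (s : Store) : Prop where
  par : Params n W a l s
  wt : (stored n s).WeightsIn W
  est : EstInv W (gam W a) (smp W a l) (stored n s) (s.reg 14 * s.reg 19) s
  pend : Update.Pending W (logOf s) 0 (stored n s) (s.reg 18) G
  pos : 1 ≤ s.reg 14
  la : s.reg 17 = 0
  -- The sum of the updates logged and the chunks left is the length of the epoch and stays constant
  -- during it.
  tk : s.reg 19 = tot W a l / (s.reg 18 + s.reg 14) + 1
  len : quo W a * (s.reg 18 + s.reg 14) ≤ 2 * (stored n s).nis + quo W a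
  next : quo W a * s.reg 16 ≤ (stored n s).nis
  -- An update lowers the number of non-isolated vertices by at most two, hence the right side by at
  -- most four, and it brings the next start one update closer. So at that start the planned length
  -- is still justified by the graph of that moment.
  rest : s.reg 16 = 0 ∨ quo W a * s.reg 16 + 4 * (s.reg 14 - 1 + max 1 (s.reg 18 + s.reg 14 - 1))
    ≤ 2 * G.nis
  nis : 1 < s.reg 14 → m ≤ quo W a * (s.reg 18 + s.reg 14)
  -- Makes the next epoch, of length `reg 16 + 1`, long enough for the time bound.
  nis' : m ≤ quo W a * (s.reg 16 + 1)

/-- The invariant between two updates. -/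
structure Inv {n : ℕ} (W a l m : ℕ) (G : WGraph n) (s : Store) : Prop where
  par : Params n W a l s
  wt : (stored n s).WeightsIn W
  ds : IsDS n W s (stored n s).arc
  pend : Update.Pending W (logOf s) (s.reg 17) (stored n s) (s.reg 18) G
  rest : s.reg 16 = 0 ∨ quo W a * s.reg 16 + 4 * (s.reg 14 + max 1 (s.reg 18 + s.reg 14 - s.reg 17))
    ≤ 2 * G.nis
  nis' : m ≤ quo W a * (s.reg 16 + 1)
  -- While the replay goes on, the log grows by one and the backlog shrinks by one, so the sum is
  -- constant and bounds the length of the log.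
  idle : s.reg 14 = 0 → s.reg 18 + (s.reg 18 - s.reg 17) ≤ n
  run : s.reg 14 ≠ 0 → s.reg 17 = 0 ∧
    EstInv W (gam W a) (smp W a l) (stored n s) (s.reg 14 * s.reg 19) s ∧
    s.reg 19 = tot W a l / (s.reg 18 + s.reg 14 + 1) + 1 ∧
    quo W a * (s.reg 18 + s.reg 14) ≤ 2 * (stored n s).nis ∧
    quo W a * s.reg 16 ≤ (stored n s).nis ∧ m ≤ quo W a * (s.reg 18 + s.reg 14 + 1)

section

variable {w n W a l m k : ℕ} {ε : ℝ} {q : ℝ≥0∞} {G : WGraph n} {s s' : Store}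

theorem Params.congr (h : Params n W a l s) (hr : ∀ r, r < 14 → s'.reg r = s.reg r ∨ r < 4) :
    Params n W a l s' := by
  have h' : ∀ r, 4 ≤ r → r < 14 → s'.reg r = s.reg r := fun r h1 h2 => (hr r h2).resolve_right (by omega)
  obtain ⟨⟨h1, h2, h3, h4⟩, h5, h6, h7, h8, h9⟩ := h
  refine ⟨⟨?_, ?_, ?_, ?_⟩, ?_, ?_, ?_, ?_, ?_⟩ <;> rw [h' _ (by omega) (by omega)] <;> assumption

theorem applyCmd_spec {H : WGraph n} (hw : Words w n W a l) (hp : Params n W a l s)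
    (hH : H.WeightsIn W) (hd : IsDS n W s H.arc)
    (hpend : Update.Pending W (logOf s) (s.reg 17) H (s.reg 18) G)
    (hln : s.reg 18 < 2 ^ w) (hs : s' = applyCmd.det w s) :
    ∃ H' : WGraph n, H'.WeightsIn W ∧ IsDS n W s' H'.arc ∧
      s'.reg 17 = min (s.reg 17 + 1) (s.reg 18) ∧
      Update.Pending W (logOf s') (s'.reg 17) H' (s'.reg 18) G := by
  have hlog : logOf s' = logOf s := by
    funext i
    rw [hs, logOf, logOf, Cmd.det_arr rfl, Cmd.det_arr rfl, Cmd.det_arr rfl]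
  have h18 : s'.reg 18 = s.reg 18 := by rw [hs, Cmd.det_reg rfl]
  rw [hlog, h18]
  by_cases hlt : s.reg 17 < s.reg 18
  · obtain ⟨u, h1, h2, h3⟩ := hpend.exists_of_lt hlt
    simp only [logOf, Prod.mk.injEq] at h1
    obtain ⟨hu, hv, hc⟩ := h1
    rw [hs, applyCmd, det_ite_pos ((eval_lt_ne hw.fits.one_lt).2 (by simpa using hlt)), Cmd.det_seq, Cmd.det_seq,
      Cmd.det_seq]
    set s1 := Cmd.det w (.seq (.assign 34 (.read 5 (.reg 17))) (.seq (.assign 35 (.read 6 (.reg 17)))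
      (.seq (.assign 36 (.read 7 (.reg 17))) (.assign 17 (.reg 17 + .const 1))))) s with hs1
    have r34 : s1.reg 34 = u.src := by simp [hs1, Cmd.det, hu]
    have r35 : s1.reg 35 = u.dst := by simp [hs1, Cmd.det, hv]
    have r36 : s1.reg 36 = u.wt := by simp [hs1, Cmd.det, hc]
    have r17 : s1.reg 17 = s.reg 17 + 1 := by
      simp only [hs1, Cmd.det, Store.setReg_reg, eval_add, eval_reg, eval_const, if_true]
      simp only [show (17 : ℕ) ≠ 36 by decide, show (17 : ℕ) ≠ 35 by decide,
        show (17 : ℕ) ≠ 34 by decide, if_false]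
      rw [Nat.mod_eq_of_lt hw.fits.one_lt, Nat.mod_eq_of_lt (by omega)]
    have hd1 : IsDS n W s1 H.arc := hd.congr rfl rfl rfl rfl
    have hp1 : Params n W a l s1 := hp.congr fun r hr => by
      left
      simp [hs1, Cmd.det]
      repeat rw [if_neg (by omega)]
    have hd2 := halfSet_spec hw.fits.row hw.fits.bucket hd1 hp1.cfg r34 r35 r36 u.src.2 u.dst.2 h2.2
    set s2 := halfSet.det w s1 with hs2
    have hr2 : ∀ r, halfSet.modReg r = false → s2.reg r = s1.reg r := fun r hr => Cmd.det_reg hr s1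
    clear_value s2
    set s3 := Cmd.det w (.seq (.assign 40 (.reg 34)) (.seq (.assign 34 (.reg 35))
      (.assign 35 (.reg 40)))) s2 with hs3
    have r3 : ∀ r, r ≠ 34 → r ≠ 35 → r ≠ 40 → s3.reg r = s2.reg r := by
      intro r x1 x2 x3
      simp only [hs3, Cmd.det, Store.setReg_reg, x1, x2, x3, if_false]
    have t34 : s3.reg 34 = u.dst := by
      have : s3.reg 34 = s2.reg 35 := rfl
      rw [this, hr2 35 rfl, r35]
    have t35 : s3.reg 35 = u.src := by
      have : s3.reg 35 = s2.reg 34 := rfl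
      rw [this, hr2 34 rfl, r34]
    have t36 : s3.reg 36 = u.wt := by
      rw [r3 36 (by decide) (by decide) (by decide), hr2 36 rfl, r36]
    have hd3 : IsDS n W s3 (setArc H.arc u.src u.dst u.wt) := hd2.congr rfl rfl rfl rfl
    have hc3 : IsCfg n W s3 := by
      obtain ⟨c1, c2, c3, c4⟩ := hp1.cfg
      refine ⟨?_, ?_, ?_, ?_⟩
      · rw [r3 4 (by decide) (by decide) (by decide), hr2 4 rfl, c1]
      · rw [r3 5 (by decide) (by decide) (by decide), hr2 5 rfl, c2]
      · rw [r3 12 (by decide) (by decide) (by decide), hr2 12 rfl, c3]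
      · rw [r3 13 (by decide) (by decide) (by decide), hr2 13 rfl, c4]
    have hd4 := halfSet_spec hw.fits.row hw.fits.bucket hd3 hc3 t34 t35 t36 u.dst.2 u.src.2 h2.2
    rw [Update.arc_apply] at hd4
    have h17 : (halfSet.det w s3).reg 17 = s.reg 17 + 1 := by
      rw [Cmd.det_reg rfl, r3 17 (by decide) (by decide) (by decide), hr2 17 rfl, r17]
    exact ⟨u.apply H, h2.weightsIn hH, hd4, by omega, by rwa [h17]⟩
  · have hs0 : s' = skip.det w s := by
      rw [hs, applyCmd, det_ite_neg ((eval_lt_eq hw.fits.one_lt).2 (by simpa using hlt))]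
    have h17 : s'.reg 17 = s.reg 17 := by rw [hs0, Cmd.det_reg rfl]
    have := hpend.le
    refine ⟨H, hH, ?_, by omega, by rwa [h17]⟩
    rw [hs0]
    exact hd.congr rfl rfl rfl rfl

theorem appendCmd_spec (hw : Words w n W a l) {u : Update n} (hu : u.Ok W)
    (h0 : s.reg 0 = u.src) (h1 : s.reg 1 = u.dst) (h2 : s.reg 2 = u.wt) {H : WGraph n} {i : ℕ}
    (hpend : Update.Pending W (logOf s) i H (s.reg 18) G)
    (hln : s.reg 18 + 1 < 2 ^ w) (hs : s' = appendCmd.det w s) :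
    (∀ r, r ≠ 18 → s'.reg r = s.reg r) ∧ s'.reg 18 = s.reg 18 + 1 ∧
      (∀ b, b < 5 → s'.arr b = s.arr b) ∧
      Update.Pending W (logOf s') i H (s.reg 18 + 1) (u.apply G) := by
  have h1w := hw.fits.one_lt
  refine ⟨fun r hr => ?_, ?_, fun b hb => ?_, ?_⟩
  · rw [hs]
    simp [appendCmd, Cmd.det, hr]
  · rw [hs]
    simp [appendCmd, Cmd.det]
    exact Nat.mod_eq_of_lt hln
  · funext j
    rw [hs]
    simp [appendCmd, Cmd.det]
    repeat rw [if_neg (by omega)]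
  · have hlog : ∀ j, logOf s' j = if j = s.reg 18 then (s.reg 0, s.reg 1, s.reg 2) else logOf s j := by
      intro j
      rw [hs]
      by_cases hj : j = s.reg 18 <;> simp [appendCmd, Cmd.det, logOf, hj]
    refine (hpend.congr fun j hj => ?_).snoc u ?_ hu
    · rw [hlog, if_neg hj.ne]
    · rw [hlog, if_pos rfl, h0, h1, h2]

end

end RAM

/-! ### Start of an epoch, robustness of an estimate, and chunks of a run -/

namespace RAM

section

variable {w n W a l m k : ℕ} {ε : ℝ} {q : ℝ≥0∞} {G : WGraph n} {s s' : Store}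

/-- For a fresh run this is the Chernoff bound. Without non-isolated vertices no samples are drawn,
and the estimate 0 is exact. -/
theorem le_runVal (hw : Words w n W a l) (hq : q + 2 * ENNReal.ofReal (Real.exp (-3 * l)) ≤ 1)
    (hG : (stored n s).WeightsIn W) (h21 : s.reg 21 = 0) (h27 : s.reg 27 = 0)
    (h20 : s.reg 20 = if 0 < (stored n s).nonIsolated.card then smp W a l else 0) :
    q ≤ runVal n W a l s := by
  rw [runVal, curVal, h20, h21, h27, if_pos rfl, add_zero]
  by_cases hN : 0 < (stored n s).nonIsolated.card
  · rw [if_pos hN]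
    have h1 := WGraph.le_estVal (l := l) (le_trans one_le_two hw.two_le) hG hN hw.one_le
      (f := cntInd W a l (stored n s)) rfl (fun c hc =>
        (if_pos hc : cntInd W a l (stored n s) c = 1).ge)
    exact (ENNReal.add_le_add_iff_right (by finiteness)).1 (hq.trans h1)
  · rw [if_neg hN, WGraph.estVal, cntInd, if_pos]
    · exact le_self_add.trans hq
    · have h1 : (stored n s).nis = 0 := by rw [WGraph.nis_eq_card]; omega
      simp [WGraph.msfWeight_eq_zero hG h1]

theorem le_quo (hw : Words w n W a l) : 320 ≤ quo W a := by
  have := Nat.mul_le_mul hw.two_le hw.one_le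
  rw [quo, mul_assoc]
  omega

/-- The epoch gets the length that was fixed at the preceding start, and the length of the following
epoch is fixed now. Thus the period served by the new run is determined before any of its random
choices. -/
theorem startEpoch_spec (hw : Words w n W a l) (hp : Params n W a l s)
    (hG : G.WeightsIn W) (hd : IsDS n W s G.arc)
    (h16 : s.reg 16 = 0 ∨ quo W a * s.reg 16 ≤ 2 * G.nis) (hm : m ≤ G.nis)
    (hm' : s.reg 16 ≠ 0 → m ≤ quo W a * (s.reg 16 + 1))
    (hq : q + 2 * ENNReal.ofReal (Real.exp (-3 * l)) ≤ 1) (hs : s' = startEpoch.det w s) :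
    Mid W a l m G s' ∧ s'.reg 14 = s.reg 16 + 1 ∧ s'.reg 18 = 0 ∧ s'.reg 28 = s.reg 28 ∧
      s'.reg 29 = s.reg 29 ∧ q ≤ runVal n W a l s' := by
  have hlen : s.arr 1 (n * (W + 1)) = G.nis := by rw [hd.card_nis hG.1, WGraph.nis_eq_card]
  have hNn : G.nis ≤ n := by
    rw [WGraph.nis_eq_card]
    simpa using Finset.card_le_univ G.nonIsolated
  have hn := hw.n_lt
  have h1w := hw.fits.one_lt
  have hQ := le_quo hw
  have hQ16 : 320 * s.reg 16 ≤ 2 * n := by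
    rcases h16 with h | h
    · omega
    · have := Nat.mul_le_mul_right (s.reg 16) hQ
      omega
  have h12 := hp.cfg.2.2.1
  have e1 : ∀ x, x < 2 ^ w → x % 2 ^ w = x := fun x hx => Nat.mod_eq_of_lt hx
  have hT := hw.tot_lt
  have hTd : tot W a l / (s.reg 16 + 1) ≤ tot W a l := Nat.div_le_self _ _
  have hNd : G.nis / quo W a ≤ G.nis := Nat.div_le_self _ _
  have r16 : s'.reg 16 = G.nis / quo W a := by
    rw [hs]
    simp [startEpoch, Cmd.det, h12, hlen, hp.reg_Q]
    exact e1 _ (by omega)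
  have r14 : s'.reg 14 = s.reg 16 + 1 := by
    rw [hs]
    simp [startEpoch, Cmd.det]
    exact e1 _ (by omega)
  have r19 : s'.reg 19 = tot W a l / (s.reg 16 + 1) + 1 := by
    rw [hs]
    simp [startEpoch, Cmd.det, hp.reg_T]
    rw [e1 (s.reg 16 + 1) (by omega), e1 _ (by omega)]
  have r17 : s'.reg 17 = 0 := by rw [hs]; simp [startEpoch, Cmd.det]
  have r18 : s'.reg 18 = 0 := by rw [hs]; simp [startEpoch, Cmd.det]
  have r21 : s'.reg 21 = 0 := by rw [hs]; simp [startEpoch, Cmd.det]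
  have r27 : s'.reg 27 = 0 := by rw [hs]; simp [startEpoch, Cmd.det]
  have r20 : s'.reg 20 = if 0 < G.nonIsolated.card then smp W a l else 0 := by
    have := hw.fits.S_lt
    rw [← WGraph.nis_eq_card, hs]
    simp [startEpoch, Cmd.det, h12, hlen, hp.reg_S]
    split_ifs
    · exact e1 _ (by omega)
    · simp
  have hds' : IsDS n W s' G.arc :=
    hd.congr (by rw [hs, Cmd.det_arr rfl]) (by rw [hs, Cmd.det_arr rfl])
      (by rw [hs, Cmd.det_arr rfl]) (by rw [hs, Cmd.det_arr rfl])
  have hst : stored n s' = G := stored_eq hds'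
  have hp' : Params n W a l s' := hp.congr fun r hr => by
    left
    rw [hs, Cmd.det_reg]
    interval_cases r <;> rfl
  have hmod : quo W a * (G.nis / quo W a) ≤ G.nis := Nat.mul_div_le _ _
  have hmod' : G.nis < quo W a * (G.nis / quo W a + 1) := Nat.lt_mul_div_succ _ (by omega)
  refine ⟨⟨hp', by rwa [hst], ?_, ?_, by omega, r17, ?_, ?_, ?_, ?_, ?_, ?_⟩, r14, r18,
    by rw [hs, Cmd.det_reg rfl], by rw [hs, Cmd.det_reg rfl],
    le_runVal hw hq (by rwa [hst]) r21 r27 (by rw [hst, r20])⟩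
  · rw [hst]
    refine ⟨hp'.cfg, hds', hp'.reg_Γ, ?_, ?_, Or.inl ⟨r21, ?_⟩⟩
    · rw [r20]
      split_ifs with h
      · exact Or.inr h
      · exact Or.inl rfl
    · rw [r20, r21, r27]
      split_ifs <;> omega
    · have h1 : totalCost W (gam W a) (s'.reg 20) ≤ tot W a l := by
        rw [r20]
        split_ifs
        · exact le_rfl
        · simp [totalCost]
      refine h1.trans ?_
      rw [r14, r19]
      exact (Nat.lt_mul_div_succ _ (by omega)).le
  · rw [hst, r18]
    exact .refl _ _
  · rw [r19, r18, r14, zero_add]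
  · rw [hst, r18, r14, zero_add, mul_add, mul_one]
    rcases h16 with h | h
    · rw [h]; omega
    · omega
  · rw [hst, r16]
    exact hmod
  · rw [r16, r14, r18]
    by_cases h0 : G.nis / quo W a = 0
    · exact Or.inl h0
    · right
      -- If the next planned length is positive, then N ≥ quo ≥ 320. The old one is at most N/160,
      -- so four units for each update before the next start fit into the spare N.
      have h1 : quo W a ≤ quo W a * (G.nis / quo W a) := Nat.le_mul_of_pos_right _ (by omega)
      have h2 : 320 * s.reg 16 ≤ 2 * G.nis := by
        rcases h16 with h | h
        · omega
        · exact (Nat.mul_le_mul_right (s.reg 16) hQ).trans h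
      omega
  · intro h
    rw [r18, r14, zero_add]
    rw [r14] at h
    exact hm' (by omega)
  · rw [r16]
    omega

/-- Here `p` updates happen during the run and up to `p + r` while its result is in use. The total
drift is at most 2W(2p + r), which by the factor 160 in `quo` and N ≤ 2M is at most M/(8a). The
sampling error is at most M/(2a), and both together are at most (1/a)·(7/8)M ≤ εy, because y ≥
(7/8)M. -/
theorem goodFor_of_count {H : WGraph n} {c p r : ℕ} (hw : Words w n W a l) (hε : 1 ≤ ε * a)
    (hH : H.WeightsIn W) (hp : quo W a * p ≤ 2 * H.nis) (hr : quo W a * r ≤ H.nis)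
    (hd : |(G.msfWeight : ℝ) - H.msfWeight| ≤ 2 * W * p) (hk : k ≤ p + r)
    (hc : |(c : ℝ) - smp W a l * (H.msfWeight / (H.nonIsolated.card * W))|
      ≤ 1 / (2 * a) * (smp W a l * (H.msfWeight / (H.nonIsolated.card * W)))) :
    GoodFor W ε (((c * H.nis * W : ℕ) : ℝ) / smp W a l) G k := by
  intro y hy hyG
  have ha : (1 : ℝ) ≤ a := by exact_mod_cast hw.one_le
  have hW : (2 : ℝ) ≤ W := by exact_mod_cast hw.two_le
  have hS : (0 : ℝ) < smp W a l := by
    have h1 := hw.one_le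
    have h2 := hw.two_le
    have h3 := hw.one_le_l
    have : 0 < smp W a l := by unfold smp; positivity
    exact_mod_cast this
  rw [← WGraph.nis_eq_card] at hc
  set M : ℝ := (H.msfWeight : ℝ) with hM
  set N : ℝ := (H.nis : ℝ) with hN
  have hM0 : 0 ≤ M := Nat.cast_nonneg _
  have hNM : N ≤ 2 * M := WGraph.nis_le_two_mul_msfWeight (by have := hw.two_le; omega) hH
  have h1 : |y - M| ≤ M / (8 * a) := by
    have h2 : |y - M| ≤ 2 * W * k + 2 * W * p := (abs_sub_le _ _ _).trans (add_le_add hyG hd)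
    have h3 : (160 * W * a : ℝ) * p ≤ 2 * N := by
      rw [quo] at hp; rw [hN]; exact_mod_cast hp
    have h4 : (160 * W * a : ℝ) * r ≤ N := by
      rw [quo] at hr; rw [hN]; exact_mod_cast hr
    have h5 : (k : ℝ) ≤ p + r := by exact_mod_cast hk
    rw [le_div_iff₀ (by positivity)]
    have h6 : (2 * W * k + 2 * W * p : ℝ) ≤ 2 * W * (2 * p + r) := by nlinarith
    calc |y - M| * (8 * a) ≤ (2 * W * (2 * p + r)) * (8 * a) :=
          mul_le_mul_of_nonneg_right (h2.trans h6) (by positivity)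
      _ = ((160 * W * a) * p * 2 + (160 * W * a) * r) / 10 := by ring
      _ ≤ M := by linarith
  have h2 : |((c * H.nis * W : ℕ) : ℝ) / smp W a l - M| ≤ M / (2 * a) := by
    have hN0 : 0 ≤ N := Nat.cast_nonneg _
    rcases hN0.eq_or_lt with h0 | h0
    · have h3 : H.nis = 0 := by
        have : (H.nis : ℝ) = 0 := h0.symm
        exact_mod_cast this
      have h4 : M = 0 := by rw [hM, WGraph.msfWeight_eq_zero hH h3]; simp
      simp [h3, h4]
    · have h3 : ((c * H.nis * W : ℕ) : ℝ) / smp W a l - M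
          = N * W / smp W a l * ((c : ℝ) - smp W a l * (M / (N * W))) := by
        push_cast
        rw [← hN]
        field_simp
      rw [h3, abs_mul, abs_of_pos (by positivity)]
      refine (mul_le_mul_of_nonneg_left hc (by positivity)).trans_eq ?_
      field_simp
  have hε' : 1 / (a : ℝ) ≤ ε := by rwa [div_le_iff₀ (by positivity)]
  have h3 : 7 / 8 * M ≤ y := by
    have h4 := (abs_le.1 h1).1
    have h5 : M / (8 * a) ≤ M / 8 := div_le_div_of_nonneg_left hM0 (by norm_num) (by linarith)
    linarith
  have h4 : 1 / (a : ℝ) * (7 / 8 * M) ≤ ε * y :=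
    mul_le_mul hε' h3 (by positivity) (le_trans (by positivity) hε')
  have h5 : M / (2 * a) + M / (8 * a) ≤ 1 / (a : ℝ) * (7 / 8 * M) := by
    have : 1 / (a : ℝ) * (7 / 8 * M) - (M / (2 * a) + M / (8 * a)) = M / (4 * a) := by
      field_simp; ring
    have : 0 ≤ M / (4 * a) := by positivity
    linarith
  have h6 := abs_le.1 h1
  have h7 := abs_le.1 h2
  constructor <;> linarith

theorem Tr.const {c : Cmd} {T : ℕ} {P : Store → Prop} {f : Store → ℝ≥0∞}
    {v : ℝ≥0∞} (h : Tr w c s T P f v) (x : ℝ≥0∞) : Tr w c s T P (fun _ => x) x := by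
  obtain ⟨μ, h1, h2, -⟩ := h
  exact ⟨μ, h1, h2, (PMF.expect_const μ x).ge⟩

theorem SearchInv.congr {root lev X h c j f : ℕ} (hi : SearchInv W G s root lev X h c j f)
    (h1 : s'.arr 1 = s.arr 1) (h2 : s'.arr 2 = s.arr 2) :
    SearchInv W G s' root lev X h c j f := by
  have hitem : item n s' = item n s := by
    funext b x
    rw [item, item, h2]
  have hmem : Mem n s' = Mem n s := by
    funext b x
    rw [Mem, Mem, h1, hitem]
  obtain ⟨x1, x2, x3, x4, x5, x6, x7, x8, x9, x10, x11, x12⟩ := hi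
  rw [← hmem, ← hitem, ← h1] at *
  exact ⟨x1, x2, x3, x4, x5, x6, x7, x8, x9, x10, x11, x12⟩

theorem EstInv.congr {Γ S fuel : ℕ} (hi : EstInv W Γ S G fuel s)
    (ha : ∀ b, b < 5 → s'.arr b = s.arr b)
    (hr : ∀ r, 3 < r → r < 28 → r ≠ 14 → r ≠ 18 → s'.reg r = s.reg r)
    (h38 : s'.reg 38 = s.reg 38) : EstInv W Γ S G fuel s' := by
  obtain ⟨⟨c1, c2, c3, c4⟩, hd, hΓ, hn, hc, hp⟩ := hi
  refine ⟨⟨?_, ?_, ?_, ?_⟩, hd.congr (ha 1 (by decide)) (ha 2 (by decide))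
    (ha 3 (by decide)) (ha 4 (by decide)), ?_, ?_, ?_, ?_⟩
  · rw [hr 4 (by decide) (by decide) (by decide) (by decide), c1]
  · rw [hr 5 (by decide) (by decide) (by decide) (by decide), c2]
  · rw [hr 12 (by decide) (by decide) (by decide) (by decide), c3]
  · rw [hr 13 (by decide) (by decide) (by decide) (by decide), c4]
  · rw [hr 8 (by decide) (by decide) (by decide) (by decide), hΓ]
  · rwa [hr 20 (by decide) (by decide) (by decide) (by decide)]
  · rwa [hr 20 (by decide) (by decide) (by decide) (by decide),
      hr 21 (by decide) (by decide) (by decide) (by decide),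
      hr 27 (by decide) (by decide) (by decide) (by decide)]
  · rw [hr 20 (by decide) (by decide) (by decide) (by decide),
      hr 21 (by decide) (by decide) (by decide) (by decide),
      hr 22 (by decide) (by decide) (by decide) (by decide),
      hr 23 (by decide) (by decide) (by decide) (by decide),
      hr 24 (by decide) (by decide) (by decide) (by decide),
      hr 25 (by decide) (by decide) (by decide) (by decide),
      hr 26 (by decide) (by decide) (by decide) (by decide), h38]
    refine hp.imp id ?_
    rintro ⟨x1, x2, f, x3, x4⟩
    exact ⟨x1, x2, f, x3, x4.congr (ha 1 (by decide)) (ha 2 (by decide))⟩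

theorem curVal_congr {Γ : ℕ} {f : ℕ → ℝ≥0∞} (hr : ∀ r, 3 < r → r < 28 → r ≠ 14 → r ≠ 18 →
    s'.reg r = s.reg r) (h38 : s'.reg 38 = s.reg 38) :
    curVal W Γ G f s' = curVal W Γ G f s := by
  rw [curVal, curVal, hr 20 (by decide) (by decide) (by decide) (by decide),
    hr 21 (by decide) (by decide) (by decide) (by decide),
    hr 22 (by decide) (by decide) (by decide) (by decide),
    hr 23 (by decide) (by decide) (by decide) (by decide),
    hr 27 (by decide) (by decide) (by decide) (by decide), h38]

theorem chunkCmd_spec {H : WGraph n} {f : ℕ → ℝ≥0∞} {fuel : ℕ} (hw : Words w n W a l)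
    (hH : H.WeightsIn W)
    (hi : EstInv W (gam W a) (smp W a l) H (fuel + s.reg 19) s) (h19 : s.reg 19 < 2 ^ w) :
    Tr w chunkCmd s (s.reg 19 * (tick.cost + 3) + 3)
      (EstInv W (gam W a) (smp W a l) H fuel) (curVal W (gam W a) H f)
      (curVal W (gam W a) H f s) := by
  refine (Tr.seq (P := fun s' => s' = s.setReg 37 (s.reg 19)) (f := fun _ => curVal W (gam W a) H f s)
    (T₁ := 1) (T₂ := s.reg 19 * (tick.cost + 3) + 1)
    ((big_assign 37 _ s).tr rfl le_rfl) ?_).mono (by omega) (fun _ h => h) (fun _ _ => le_rfl) le_rfl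
  rintro s' rfl
  have h1 := tr_repeat (w := w) (x := 37) (c := tick) (T := tick.cost) (f := curVal W (gam W a) H f)
    (I := fun j s' => EstInv W (gam W a) (smp W a l) H (fuel + j) s') ?_ (s.reg 19) h19
    (s.setReg 37 (s.reg 19)) rfl ?_
  · exact h1.mono le_rfl (fun _ h => h.1) (fun _ _ => le_rfl) le_rfl
  · intro j t hj ht hI
    have h2 : EstInv W (gam W a) (smp W a l) H (fuel + j + 1) (t.setReg 37 j) :=
      EstInv.congr hI (fun _ _ => rfl) (fun r _ hr _ _ => by simp; omega) rfl
    refine (tick_spec (f := f) hw.fits hH.1 h2).frame.mono le_rfl (fun t' h => ⟨h.1, ?_⟩)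
      (fun _ _ => le_rfl) le_rfl
    rw [h.2.1 37 rfl]
    simp
  · exact EstInv.congr hi (fun _ _ => rfl) (fun r _ hr _ _ => by simp; omega) rfl

end

end RAM

namespace Update.Pending

theorem weightsIn {n W i j : ℕ} {L : ℕ → ℕ × ℕ × ℕ} {H G : WGraph n}
    (h : Pending W L i H j G) (hH : H.WeightsIn W) : G.WeightsIn W := by
  induction h with
  | refl => exact hH
  | step u _ h2 _ ih => exact ih (h2.weightsIn hH)

end Update.Pending

/-! ### Advancing a run and publishing its result -/

namespace RAM

section

variable {w n W a l m k : ℕ} {ε : ℝ} {q : ℝ≥0∞} {G : WGraph n} {s s' s₀ : Store}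

/-- The facts about a store after `chunkCmd` that are needed later. -/
structure Chunked (W a l : ℕ) (H : WGraph n) (s₀ s : Store) : Prop where
  est : EstInv W (gam W a) (smp W a l) H ((s₀.reg 14 - 1) * s₀.reg 19) s
  reg : ∀ r, chunkCmd.modReg r = false → s.reg r = s₀.reg r
  log : logOf s = logOf s₀

theorem Mid.chunk (hw : Words w n W a l) (hi : Mid W a l m G s) :
    Tr w chunkCmd s (s.reg 19 * (tick.cost + 3) + 3) (Chunked W a l (stored n s) s)
      (curVal W (gam W a) (stored n s) (cntInd W a l (stored n s))) (runVal n W a l s) := by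
  have h19 : s.reg 19 < 2 ^ w := by
    have h1 := hw.tot_lt
    have h2 : tot W a l / (s.reg 18 + s.reg 14) ≤ tot W a l := Nat.div_le_self _ _
    rw [hi.tk]
    omega
  have h1 : s.reg 14 * s.reg 19 = (s.reg 14 - 1) * s.reg 19 + s.reg 19 := by
    obtain ⟨r, hr⟩ : ∃ r, s.reg 14 = r + 1 := ⟨s.reg 14 - 1, by have := hi.pos; omega⟩
    rw [hr, Nat.add_sub_cancel, Nat.succ_mul]
  have h2 := hi.est
  rw [h1] at h2
  refine (chunkCmd_spec (f := cntInd W a l (stored n s)) hw hi.wt h2 h19).frame.mono le_rfl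
    (fun s' h => ⟨h.1, h.2.1, ?_⟩) (fun _ _ => le_rfl) le_rfl
  funext i
  rw [logOf, logOf, h.2.2 5 rfl, h.2.2 6 rfl, h.2.2 7 rfl]

/-- The published fraction count·N·W/S inverts the nominal mean S·M/(N·W) of the count. The
numerator fits into a word, as the count is at most S and N at most n. -/
theorem postCmd_spec (hw : Words w n W a l) (hi : Mid W a l m G s₀)
    (hc : Chunked W a l (stored n s₀) s₀ s) (hs : s' = postCmd.det w s) :
    (∀ r, r ≠ 14 → r ≠ 28 → r ≠ 29 → r ≠ 39 → s'.reg r = s.reg r) ∧ s'.arr = s.arr ∧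
      s'.reg 14 = s₀.reg 14 - 1 ∧
      (s'.reg 14 ≠ 0 → s'.reg 28 = s₀.reg 28 ∧ s'.reg 29 = s₀.reg 29) ∧
      (s'.reg 14 = 0 → s'.reg 28 = s.reg 27 * (stored n s₀).nis * W ∧ s'.reg 29 = smp W a l) := by
  have h1w := hw.fits.one_lt
  have hpos := hi.pos
  have h14 : s.reg 14 = s₀.reg 14 := hc.reg 14 rfl
  have hNn : (stored n s₀).nis ≤ n := by
    rw [WGraph.nis_eq_card]
    simpa using Finset.card_le_univ (stored n s₀).nonIsolated
  have hn := hw.n_lt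
  have hQ := le_quo hw
  have h14w : s₀.reg 14 < 2 ^ w := by
    have h1 := hi.len
    have h2 : quo W a * 1 ≤ quo W a * (s₀.reg 18 + s₀.reg 14) := Nat.mul_le_mul_left _ (by omega)
    have h3 : quo W a * (s₀.reg 18 + s₀.reg 14) - quo W a * 1
      = quo W a * (s₀.reg 18 + s₀.reg 14 - 1) := (Nat.mul_sub _ _ _).symm
    have h4 : 1 * (s₀.reg 18 + s₀.reg 14 - 1) ≤ quo W a * (s₀.reg 18 + s₀.reg 14 - 1) :=
      Nat.mul_le_mul_right _ (by omega)
    omega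
  have e14 : (s.reg 14 - 1) % 2 ^ w = s₀.reg 14 - 1 := by
    rw [h14]; exact Nat.mod_eq_of_lt (by omega)
  set s1 := s.setReg 14 (s₀.reg 14 - 1) with hs1
  have hdet : s' = (Cmd.ite (.reg 14) skip
    (.seq (.assign 28 (.reg 27 * .read 1 (.reg 12) * .reg 5)) (.assign 29 (.reg 9)))).det w s1 := by
    rw [hs, postCmd, Cmd.det_seq, hs1]
    congr 1
    simp [Cmd.det, Nat.mod_eq_of_lt h1w, e14]
  have r1 : s1.reg 14 = s₀.reg 14 - 1 := by simp [hs1]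
  by_cases h0 : s₀.reg 14 - 1 = 0
  · have h2 : s' = (s1.setReg 28 (s.reg 27 * (stored n s₀).nis * W)).setReg 29 (smp W a l) := by
      rw [hdet, det_ite_neg (by simpa [r1] using h0)]
      have h3 : s.reg 9 = smp W a l := by rw [hc.reg 9 rfl, hi.par.reg_S]
      have h4 : s.arr 1 (n * (W + 1)) = (stored n s₀).nis := by
        rw [hc.est.ds.card_nis hi.wt.1, WGraph.nis_eq_card]
      have h5 : s.reg 27 * (stored n s₀).nis * W < 2 ^ w := by
        refine lt_of_le_of_lt ?_ hw.num_lt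
        rw [mul_assoc]
        have := hc.est.count
        gcongr
        omega
      simp only [Cmd.det, hs1, eval_mul, eval_reg, eval_read, Store.setReg_arr, Store.setReg_reg,
        hc.est.cfg.2.2.1, hc.est.cfg.2.1, h3, h4,
        show (27 : ℕ) ≠ 14 by decide, show (12 : ℕ) ≠ 14 by decide,
        show (5 : ℕ) ≠ 14 by decide, show (9 : ℕ) ≠ 28 by decide, show (9 : ℕ) ≠ 14 by decide, if_false]
      rw [Nat.mod_mul_mod, Nat.mod_eq_of_lt h5]
    rw [h2]
    refine ⟨fun r h1 h2 h3 h4 => ?_, rfl, ?_, ?_, ?_⟩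
    · simp [hs1, h1, h2, h3]
    · simp [hs1]
    · simp [hs1, h0]
    · simp
  · have h2 : s' = skip.det w s1 := by
      rw [hdet, det_ite_pos (by simpa [r1] using h0)]
    rw [h2]
    refine ⟨fun r h1 h2 h3 h4 => ?_, rfl, ?_, fun _ => ⟨?_, ?_⟩, ?_⟩
    · simp [skip, Cmd.det, hs1, h1, h4]
    · simp [skip, Cmd.det, hs1]
    · simp [skip, Cmd.det, hs1, hc.reg 28 rfl]
    · simp [skip, Cmd.det, hs1, hc.reg 29 rfl]
    · simp [skip, Cmd.det, hs1, h0]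

/-- The three cases are a target served by the old value, by this run, or by a later run. In the
second case, when the last chunk is done, the expected indicator becomes the indicator for the
actual count, and `goodFor_of_count` turns a good count into a robust value. -/
theorem Mid.post (hw : Words w n W a l) (hε : 1 ≤ ε * a) (hi : Mid W a l m G s₀)
    (hc : Chunked W a l (stored n s₀) s₀ s) (hs : s' = postCmd.det w s) :
    Inv W a l m G s' ∧
    (k + 1 < s₀.reg 14 → potential W a l ε q k G s' = goodInd W ε G k s₀) ∧
    (¬ k + 1 < s₀.reg 14 → k + 1 < s₀.reg 14 + max 1 (s₀.reg 18 + s₀.reg 14 - 1) + s₀.reg 16 →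
      curVal W (gam W a) (stored n s₀) (cntInd W a l (stored n s₀)) s
        ≤ potential W a l ε q k G s') ∧
    (¬ k + 1 < s₀.reg 14 → ¬ k + 1 < s₀.reg 14 + max 1 (s₀.reg 18 + s₀.reg 14 - 1) + s₀.reg 16 →
      potential W a l ε q k G s' = q) := by
  classical
  obtain ⟨hr, harr, h14, hpub, hpub'⟩ := postCmd_spec hw hi hc hs
  have hr' : ∀ r, r ≠ 14 → r ≠ 28 → r ≠ 29 → r ≠ 39 → chunkCmd.modReg r = false →
      s'.reg r = s₀.reg r := fun r h1 h2 h3 h4 h5 => (hr r h1 h2 h3 h4).trans (hc.reg r h5)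
  have r16 : s'.reg 16 = s₀.reg 16 := hr' 16 (by decide) (by decide) (by decide) (by decide) rfl
  have r17 : s'.reg 17 = 0 :=
    (hr' 17 (by decide) (by decide) (by decide) (by decide) rfl).trans hi.la
  have r18 : s'.reg 18 = s₀.reg 18 := hr' 18 (by decide) (by decide) (by decide) (by decide) rfl
  have r19 : s'.reg 19 = s₀.reg 19 := hr' 19 (by decide) (by decide) (by decide) (by decide) rfl
  have hest : EstInv W (gam W a) (smp W a l) (stored n s₀) (s'.reg 14 * s'.reg 19) s' := by
    rw [h14, r19]
    exact hc.est.congr (fun b _ => by rw [harr]) (fun r _ h1 h2 _ => hr r h2 (by omega) (by omega) (by omega))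
      (hr 38 (by decide) (by decide) (by decide) (by decide))
  have hst : stored n s' = stored n s₀ := stored_eq hest.ds
  have hQ := le_quo hw
  have hlen : quo W a * (s₀.reg 18 + s₀.reg 14 - 1) ≤ 2 * (stored n s₀).nis := by
    have h1 := hi.len
    rw [Nat.mul_sub]
    omega
  have hNn : (stored n s₀).nis ≤ n := by
    rw [WGraph.nis_eq_card]
    simpa using Finset.card_le_univ (stored n s₀).nonIsolated
  have hlen' : 320 * (s₀.reg 18 + s₀.reg 14 - 1) ≤ 2 * n :=
    (Nat.mul_le_mul_right _ hQ).trans (hlen.trans (by omega))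
  have hpos := hi.pos
  have hadd : s₀.reg 18 + (s₀.reg 14 - 1) = s₀.reg 18 + s₀.reg 14 - 1 := by omega
  have hcur : ∀ f, curVal W (gam W a) (stored n s₀) f s' = curVal W (gam W a) (stored n s₀) f s :=
    fun f => curVal_congr (fun r _ h1 h2 _ => hr r h2 (by omega) (by omega) (by omega))
      (hr 38 (by decide) (by decide) (by decide) (by decide))
  have hlog : logOf s' = logOf s₀ := by
    rw [← hc.log]
    funext i
    rw [logOf, logOf, harr]
  refine ⟨⟨?_, ?_, ?_, ?_, ?_, ?_, ?_, ?_⟩, ?_, ?_, ?_⟩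
  · refine hi.par.congr fun r h => Or.inl (hr' r (by omega) (by omega) (by omega) (by omega) ?_)
    interval_cases r <;> rfl
  · rw [hst]; exact hi.wt
  · rw [hst]; exact hest.ds
  · rw [hst, r17, r18, hlog]; exact hi.pend
  · rw [r16, r17, r18, h14, Nat.sub_zero, hadd]
    exact hi.rest
  · rw [r16]; exact hi.nis'
  · intro h
    rw [r17, r18]
    omega
  · intro h
    rw [hst, r17, r18, r16]
    have hrem : s₀.reg 18 + s'.reg 14 + 1 = s₀.reg 18 + s₀.reg 14 := by omega
    refine ⟨rfl, hest, ?_, ?_, hi.next, ?_⟩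
    · rw [hrem, r19, hi.tk]
    · rw [h14, hadd]; exact hlen
    · rw [hrem]
      exact hi.nis (by omega)
  · intro h
    have h0 : s'.reg 14 ≠ 0 := by omega
    rw [potential, if_neg h0, if_pos (by omega), goodInd, goodInd, pub, pub, (hpub h0).1,
      (hpub h0).2]
  · intro h1 h2
    rw [potential, r16, r17, r18]
    by_cases h0 : s'.reg 14 = 0
    · rw [if_pos h0, if_pos (by omega)]
      have h3 : s₀.reg 14 = 1 := by omega
      have hph := hc.est.phase
      rw [h3, Nat.sub_self, zero_mul] at hph
      -- No fuel is left, while a pending search or a remaining sample would need some; so the run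
      -- is complete.
      have h4 : s.reg 21 = 0 ∧ s.reg 20 = 0 := by
        rcases hph with ⟨h5, h6⟩ | ⟨h5, h6, f, h7, h8⟩
        · refine ⟨h5, ?_⟩
          by_contra hne
          have : sampleCost W (gam W a / (0 % gam W a + 1)) ≤ totalCost W (gam W a) (s.reg 20) :=
            Finset.single_le_sum (f := fun i => sampleCost W (gam W a / (i % gam W a + 1)))
              (fun _ _ => Nat.zero_le _) (Finset.mem_range.2 (Nat.pos_of_ne_zero hne))
          rw [sampleCost] at this
          omega
        · have := h8.fuel_pos hc.est.ds.wf
          omega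
      rw [curVal, h4.1, h4.2, if_pos rfl, add_zero, WGraph.estVal, cntInd]
      split_ifs with h5
      · rw [goodInd, if_pos]
        rw [pub, (hpub' h0).1, (hpub' h0).2]
        have hd := hi.pend.abs_msfWeight_sub_le hi.wt
        refine goodFor_of_count hw hε hi.wt (p := s₀.reg 18) (r := s₀.reg 16) ?_ hi.next hd (by omega) h5
        rw [h3] at hlen
        exact hlen
      · exact bot_le
    · rw [if_neg h0, if_neg (by omega), if_pos (by omega), runVal, hst, hcur]
  · intro h1 h2
    rw [potential, r16, r17, r18]
    by_cases h0 : s'.reg 14 = 0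
    · rw [if_pos h0, if_neg (by omega)]
    · rw [if_neg h0, if_neg (by omega), if_neg (by omega)]

theorem runCmd_spec (hw : Words w n W a l) (hε : 1 ≤ ε * a) (hi : Mid W a l m G s) :
    Tr w runCmd s (s.reg 19 * (tick.cost + 3) + postCmd.cost + 4) (Inv W a l m G)
      (potential W a l ε q k G) (midPotential W a l ε q k G s) := by
  have hch := hi.chunk hw
  have hT : s.reg 19 * (tick.cost + 3) + postCmd.cost + 4
    = s.reg 19 * (tick.cost + 3) + 3 + postCmd.cost + 1 := by ring
  rw [hT]
  by_cases h1 : k + 1 < s.reg 14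
  · rw [midPotential, if_pos h1]
    refine Tr.seq (hch.const (goodInd W ε G k s)) fun s' hs' => ?_
    have := hi.post (k := k) (q := q) hw hε hs' rfl
    exact tr_det rfl this.1 (this.2.1 h1).ge
  by_cases h2 : k + 1 < s.reg 14 + max 1 (s.reg 18 + s.reg 14 - 1) + s.reg 16
  · rw [midPotential, if_neg h1, if_pos h2]
    refine Tr.seq hch fun s' hs' => ?_
    have := hi.post (k := k) (q := q) hw hε hs' rfl
    exact tr_det rfl this.1 (this.2.2.1 h1 h2)
  · rw [midPotential, if_neg h1, if_neg h2]
    refine Tr.seq (hch.const q) fun s' hs' => ?_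
    have := hi.post (k := k) (q := q) hw hε hs' rfl
    exact tr_det rfl this.1 (this.2.2.2 h1 h2).ge

end

end RAM

/-! ### Logging, replay and the change of epochs -/

namespace RAM

section

variable {w n W a l m m' k : ℕ} {ε : ℝ} {q : ℝ≥0∞} {G : WGraph n} {s s' : Store}

theorem stored_congr (ha : s'.arr = s.arr) : stored n s' = stored n s := by
  funext e
  rw [stored, stored, ha]

theorem Inv.congr (h : Inv W a l m G s) (hr : ∀ r, 3 ≤ r → r ≠ 39 → s'.reg r = s.reg r)
    (ha : s'.arr = s.arr) : Inv W a l m G s' := by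
  have hst : stored n s' = stored n s := stored_congr ha
  have hlog : logOf s' = logOf s := by
    funext i
    rw [logOf, logOf, ha]
  obtain ⟨h1, h2, h3, h4, h5, h6, h7, h8⟩ := h
  have r14 := hr 14 (by decide) (by decide)
  have r16 := hr 16 (by decide) (by decide)
  have r17 := hr 17 (by decide) (by decide)
  have r18 := hr 18 (by decide) (by decide)
  have r19 := hr 19 (by decide) (by decide)
  refine ⟨h1.congr fun r _ => ?_, by rwa [hst], ?_, by rwa [hst, hlog, r17, r18],
    by rwa [r14, r16, r17, r18], by rwa [r16], by rwa [r14, r17, r18], ?_⟩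
  · by_cases h : r < 4
    · exact Or.inr h
    · exact Or.inl (hr r (by omega) (by omega))
  · rw [hst]
    exact h3.congr (by rw [ha]) (by rw [ha]) (by rw [ha]) (by rw [ha])
  · rw [r14, r16, r17, r18, r19, hst]
    intro h
    obtain ⟨x1, x2, x3⟩ := h8 h
    exact ⟨x1, x2.congr (fun b _ => by rw [ha]) (fun r h1 h2 _ _ => hr r (by omega) (by omega)) (hr 38 (by decide) (by decide)), x3⟩

theorem potential_congr (hr : ∀ r, 3 ≤ r → r ≠ 39 → s'.reg r = s.reg r) (ha : s'.arr = s.arr) :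
    potential W a l ε q k G s' = potential W a l ε q k G s := by
  have hst : stored n s' = stored n s := stored_congr ha
  rw [potential, potential, goodInd, goodInd, pub, pub, runVal, runVal,
    hr 14 (by decide) (by decide), hr 16 (by decide) (by decide), hr 17 (by decide) (by decide),
    hr 18 (by decide) (by decide), hr 28 (by decide) (by decide), hr 29 (by decide) (by decide), hst,
    curVal_congr (s' := s') (s := s) (fun r h1 h2 _ _ => hr r (by omega) (by omega))
      (hr 38 (by decide) (by decide))]

/-- Triangle inequality: the update uses up one of the `k + 1` units of drift 2W for which the value
was robust. -/
theorem goodInd_le_apply {u : Update n} (hu : u.Ok W) (hG : G.WeightsIn W) (hp : pub s' = pub s) :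
    goodInd W ε G (k + 1) s ≤ goodInd W ε (u.apply G) k s' := by
  rw [goodInd, goodInd, hp]
  split_ifs with h1 h2
  · exact le_rfl
  · refine absurd (fun y hy hyG => h1 y hy ?_) h2
    have h3 := Update.abs_msfWeight_sub_le hu hG
    have h4 := abs_sub_le y ((u.apply G).msfWeight : ℝ) G.msfWeight
    push_cast
    linarith
  · exact bot_le
  · exact le_rfl

theorem Inv.lt (hw : Words w n W a l) (hi : Inv W a l m G s) : s.reg 18 + 1 < 2 ^ w := by
  have hn := hw.n_lt
  by_cases h : s.reg 14 = 0
  · have := hi.idle h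
    omega
  · obtain ⟨-, -, -, h1, -⟩ := hi.run h
    have hNn : (stored n s).nis ≤ n := by
      rw [WGraph.nis_eq_card]
      simpa using Finset.card_le_univ (stored n s).nonIsolated
    have h2 := Nat.mul_le_mul_right (s.reg 18 + s.reg 14) (le_quo hw)
    omega

/-- During a run the update is only logged, so the frozen graph and the expected outcome of the run
do not depend on it. Otherwise two log entries are replayed, and a new run starts when none is left.
-/
theorem preCmd_spec {u : Update n} (hw : Words w n W a l) (hi : Inv W a l m G s) (hu : u.Ok W)
    (h0 : s.reg 0 = u.src) (h1 : s.reg 1 = u.dst) (h2 : s.reg 2 = u.wt) (hm : m' ≤ m)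
    (hm' : m' ≤ (u.apply G).nis)
    (hq : q + 2 * ENNReal.ofReal (Real.exp (-3 * l)) ≤ 1) (hs : s' = preCmd.det w s) :
    (s'.reg 14 ≠ 0 → Mid W a l m' (u.apply G) s' ∧ m' ≤ quo W a * (s'.reg 18 + s'.reg 14) ∧
      potential W a l ε q (k + 1) G s ≤ midPotential W a l ε q k (u.apply G) s') ∧
    (s'.reg 14 = 0 → Inv W a l m' (u.apply G) s' ∧
      potential W a l ε q (k + 1) G s ≤ potential W a l ε q k (u.apply G) s') := by
  have hG := hi.pend.weightsIn hi.wt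
  have hnis := Update.nis_le_apply G u
  have hlt := hi.lt hw
  obtain ⟨rA, rA18, aA, pA⟩ := appendCmd_spec (s' := appendCmd.det w s) hw hu h0 h1 h2 hi.pend
    hlt rfl
  rw [preCmd, Cmd.det_seq] at hs
  set sA := appendCmd.det w s with hsA
  clear_value sA
  have hstA : stored n sA = stored n s := by
    funext e
    rw [stored, stored, aA 4 (by decide)]
  have rA14 := rA 14 (by decide)
  have rA16 := rA 16 (by decide)
  have rA17 := rA 17 (by decide)
  have hlen := hi.pend.le
  by_cases h14 : s.reg 14 = 0
  · have hparA : Params n W a l sA := hi.par.congr fun r hr => Or.inl (rA r (by omega))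
    have hdsA : IsDS n W sA (stored n s).arc := hi.ds.congr (aA 1 (by decide)) (aA 2 (by decide))
      (aA 3 (by decide)) (aA 4 (by decide))
    rw [det_ite_neg (by simpa [rA14] using h14), Cmd.det_seq, Cmd.det_seq] at hs
    rw [← rA18, ← rA17] at pA
    -- Two replays against one new entry: the backlog shrinks by one unless it is exhausted.
    obtain ⟨HB, wB, dB, B17, pB⟩ := applyCmd_spec (s' := applyCmd.det w sA) hw hparA hi.wt hdsA pA
      (by omega) rfl
    have rB : ∀ r, applyCmd.modReg r = false → (applyCmd.det w sA).reg r = sA.reg r :=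
      fun r hr => Cmd.det_reg hr sA
    set sB := applyCmd.det w sA with hsB
    clear_value sB
    have hparB : Params n W a l sB := hparA.congr fun r hr => Or.inl (rB r (by
      interval_cases r <;> rfl))
    obtain ⟨H, wC, dC, C17, pC⟩ := applyCmd_spec (s' := applyCmd.det w sB) hw hparB wB dB pB
      (by rw [rB 18 rfl]; omega) rfl
    have rC' : ∀ r, applyCmd.modReg r = false → (applyCmd.det w sB).reg r = sB.reg r :=
      fun r hr => Cmd.det_reg hr sB
    set sC := applyCmd.det w sB with hsC
    clear_value sC
    have hparC : Params n W a l sC := hparB.congr fun r hr => Or.inl (rC' r (by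
      interval_cases r <;> rfl))
    have rC : ∀ r, r ≠ 18 → applyCmd.modReg r = false → sC.reg r = s.reg r := fun r h hr =>
      (rC' r hr).trans ((rB r hr).trans (rA r h))
    have C14 := rC 14 (by decide) rfl
    have C16 := rC 16 (by decide) rfl
    have C28 := rC 28 (by decide) rfl
    have C29 := rC 29 (by decide) rfl
    have C18 : sC.reg 18 = s.reg 18 + 1 := by rw [rC' 18 rfl, rB 18 rfl, rA18]
    have B18 : sB.reg 18 = s.reg 18 + 1 := by rw [rB 18 rfl, rA18]
    rw [B17, B18, rA17, rA18] at C17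
    have h1w := hw.fits.one_lt
    have hidle := hi.idle h14
    have hrest := hi.rest
    rw [h14] at hrest
    by_cases heq : sC.reg 17 = sC.reg 18
    · have hGH : H = u.apply G := pC.eq_of_le (by omega)
      subst hGH
      rw [det_ite_pos (by simp [heq, Nat.mod_eq_of_lt h1w])] at hs
      have hmn := hi.nis'
      obtain ⟨x1, x2, x3, x4, x5, x6⟩ := startEpoch_spec (m := m') (q := q) hw hparC wC dC
        (by rw [C16]; omega) hm' (by rw [C16]; omega) hq hs
      refine ⟨fun _ => ⟨x1, ?_, ?_⟩, fun h => by omega⟩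
      · rw [x2, x3, C16, zero_add]
        omega
      -- The backlog was at most one, so the first window ends at `1 + reg 16` in both states. A
      -- target within it keeps the published value; a later one had the value `q`, which the fresh
      -- run dominates.
      · rw [potential, midPotential, if_pos h14, x2, x3, C16]
        by_cases hk : k < s.reg 16
        · rw [if_pos (by omega), if_pos (by omega)]
          exact goodInd_le_apply hu hG (by rw [pub, pub, x4, x5, C28, C29])
        · rw [if_neg (by omega), if_neg (by omega)]
          split_ifs
          · exact x6
          · exact le_rfl
    · rw [det_ite_neg (by simp [heq])] at hs
      have hs14 : s'.reg 14 = 0 := by rw [hs, Cmd.det_reg rfl, C14, h14]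
      refine ⟨fun h => absurd hs14 h, fun _ => ?_⟩
      have hstC : stored n sC = H := stored_eq dC
      have hr : ∀ r, 3 ≤ r → r ≠ 39 → s'.reg r = sC.reg r := by
        intro r _ h
        rw [hs]
        simp [skip, Cmd.det, h]
      have ha : s'.arr = sC.arr := by rw [hs]; rfl
      rw [potential_congr hr ha]
      refine ⟨Inv.congr (s := sC) ⟨hparC, by rwa [hstC], by rwa [hstC], by rwa [hstC], ?_, ?_, ?_,
        fun h => absurd (C14.trans h14) h⟩ hr ha, ?_⟩
      · rw [C14, C16, C18, h14]
        omega
      · rw [C16]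
        have := hi.nis'
        omega
      · intro _
        omega
      · rw [potential, potential, if_pos h14, if_pos (C14.trans h14), C16]
        by_cases hk : k < max 1 (sC.reg 18 - sC.reg 17) + s.reg 16
        · rw [if_pos (by omega), if_pos hk]
          exact goodInd_le_apply hu hG (by rw [pub, pub, C28, C29])
        · rw [if_neg (by omega), if_neg hk]
  · obtain ⟨i1, i2, i3, i4, i5, i6⟩ := hi.run h14
    rw [det_ite_pos (by simpa [rA14] using h14)] at hs
    have r18 : s'.reg 18 = s.reg 18 + 1 := by rw [hs, Cmd.det_reg rfl, rA18]
    have hr : ∀ r, r ≠ 18 → r ≠ 39 → s'.reg r = s.reg r := by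
      intro r h h'
      rw [hs, ← rA r h]
      simp [skip, Cmd.det, h']
    have ha : s'.arr = sA.arr := by rw [hs]; rfl
    have r14 := hr 14 (by decide) (by decide)
    have r16 := hr 16 (by decide) (by decide)
    have r17 := hr 17 (by decide) (by decide)
    have r19 := hr 19 (by decide) (by decide)
    have hst : stored n s' = stored n s := (stored_congr ha).trans hstA
    have hlog : logOf s' = logOf sA := by
      funext i
      rw [logOf, logOf, ha]
    refine ⟨fun _ => ?_, fun h => by omega⟩
    have hrem : s.reg 18 + 1 + s.reg 14 = s.reg 18 + s.reg 14 + 1 := by omega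
    refine ⟨⟨?_, by rw [hst]; exact hi.wt, ?_, ?_, by omega, by omega, ?_, ?_, ?_, ?_, ?_, ?_⟩, ?_, ?_⟩
    · exact hi.par.congr fun r h => Or.inl (hr r (by omega) (by omega))
    · rw [hst, r14, r19]
      exact i2.congr (fun b hb => by rw [ha, aA b hb]) (fun r _ h1 h2 h3 => hr r h3 (by omega))
        (hr 38 (by decide) (by decide))
    · rw [hst, r18, hlog, ← i1]
      exact pA
    · rw [r19, r18, r14, hrem, i3]
    · rw [hst, r18, r14, hrem, mul_add]
      omega
    · rw [hst, r16]
      exact i5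
    · have := hi.rest
      rw [r16, r18, r14, hrem]
      omega
    · intro _
      rw [r18, r14, hrem]
      omega
    · rw [r16]
      have := hi.nis'
      omega
    · rw [r18, r14, hrem]
      omega
    · rw [potential, midPotential, if_neg h14, r14, r16, r18, hrem]
      by_cases hk : k + 1 < s.reg 14
      · rw [if_pos hk, if_pos hk]
        exact goodInd_le_apply hu hG (by
          rw [pub, pub, hr 28 (by decide) (by decide), hr 29 (by decide) (by decide)])
      · rw [if_neg hk, if_neg hk, Nat.add_sub_cancel]
        refine le_of_eq (if_congr Iff.rfl ?_ rfl)
        rw [runVal, runVal, hst]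
        exact (curVal_congr (fun r _ _ _ h => hr r h (by omega)) (hr 38 (by decide) (by decide))).symm

end

end RAM

/-! ### A complete update, and the preprocessing -/

namespace RAM

section

variable {w n W a l m m' k : ℕ} {ε : ℝ} {q : ℝ≥0∞} {G : WGraph n} {s s' : Store}

theorem outCmd_spec (hi : Inv W a l m G s) (hs : s' = outCmd.det w s) :
    (Inv W a l m G s' ∧ s'.reg 0 = s'.reg 28 ∧ s'.reg 1 = s'.reg 29) ∧
      potential W a l ε q k G s' = potential W a l ε q k G s := by
  have hr : ∀ r, 3 ≤ r → r ≠ 39 → s'.reg r = s.reg r := by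
    intro r h _
    rw [hs]
    simp [outCmd, Cmd.det]
    repeat rw [if_neg (by omega)]
  have ha : s'.arr = s.arr := by rw [hs]; rfl
  refine ⟨⟨hi.congr hr ha, ?_, ?_⟩, potential_congr hr ha⟩ <;> rw [hs] <;> rfl

/-- The running time of an update. -/
def updTime (W a l m : ℕ) : ℕ :=
  (tot W a l * quo W a / max 1 m + 1) * (tick.cost + 3) +
    (preCmd.cost + postCmd.cost + outCmd.cost + 20)

theorem updCmd_spec {u : Update n} (hw : Words w n W a l) (ha : 2 ≤ a) (hε : 1 ≤ ε * a)
    (hi : Inv W a l m G s) (hu : u.Ok W)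
    (h0 : s.reg 0 = u.src) (h1 : s.reg 1 = u.dst) (h2 : s.reg 2 = u.wt) (hm : m' ≤ m)
    (hm' : m' ≤ (u.apply G).nis) (hq : q + 2 * ENNReal.ofReal (Real.exp (-3 * l)) ≤ 1) :
    Tr w updCmd s (updTime W a l m')
      (fun s' => Inv W a l m' (u.apply G) s' ∧ s'.reg 0 = s'.reg 28 ∧ s'.reg 1 = s'.reg 29)
      (potential W a l ε q k (u.apply G)) (potential W a l ε q (k + 1) G s) := by
  have h1w := hw.fits.one_lt
  have h2w : 2 < 2 ^ w := by have := hw.n_lt; omega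
  set B := (tot W a l * quo W a / max 1 m' + 1) * (tick.cost + 3) with hB
  obtain ⟨hp1, hp2⟩ := preCmd_spec (k := k) (ε := ε) (q := q) hw hi hu h0 h1 h2 hm hm' hq rfl
  have hT : preCmd.cost + ((B + postCmd.cost + 4 + 1) + outCmd.cost + 1) + 1 + 1 ≤ updTime W a l m' := by
    rw [updTime, ← hB]
    omega
  refine Tr.mono (Tr.ite (T := preCmd.cost + ((B + postCmd.cost + 4 + 1) + outCmd.cost + 1) + 1)
    (fun h => ?_) (fun _ => ?_)) hT (fun _ h => h) (fun _ _ => le_rfl) le_rfl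
  · rw [eval_lt_ne h1w, eval_reg, eval_const, hi.par.reg_a, Nat.mod_eq_of_lt h2w] at h
    omega
  · refine Tr.seq (P := fun s' => s' = preCmd.det w s)
      (f := fun _ => potential W a l ε q (k + 1) G s) (tr_det rfl rfl le_rfl) ?_
    rintro s' hs'
    rw [← hs'] at hp1 hp2
    refine Tr.seq (P := Inv W a l m' (u.apply G)) (f := potential W a l ε q k (u.apply G)) ?_
      (fun s'' hi'' => ?_)
    · refine Tr.ite (fun h => ?_) (fun h => ?_)
      · obtain ⟨x1, x2, x3⟩ := hp1 h
        refine (runCmd_spec hw hε x1).mono ?_ (fun _ h => h) (fun _ _ => le_rfl) x3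
        have h3 : s'.reg 19 ≤ tot W a l * quo W a / max 1 m' + 1 := by
          rw [x1.tk]
          have hQ := le_quo hw
          have hpos := x1.pos
          have h4 : max 1 m' ≤ (s'.reg 18 + s'.reg 14) * quo W a := by
            rw [mul_comm]
            refine max_le ?_ x2
            exact Nat.mul_pos (by omega) (by omega)
          -- The length of the epoch times `quo` is at least the minimum of the non-isolated counts,
          -- so dividing the work by the length costs at most a factor `quo` over dividing it by
          -- that minimum.
          have h5 : tot W a l / (s'.reg 18 + s'.reg 14)
              = tot W a l * quo W a / ((s'.reg 18 + s'.reg 14) * quo W a) :=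
            (Nat.mul_div_mul_right _ _ (by omega)).symm
          rw [h5]
          exact Nat.add_le_add_right (Nat.div_le_div_left h4 (by omega)) 1
        have h6 := Nat.mul_le_mul_right (tick.cost + 3) h3
        omega
      · obtain ⟨x1, x2⟩ := hp2 h
        have h3 : skip.cost ≤ B + postCmd.cost + 4 := by
          have : skip.cost = 1 := rfl
          omega
        have hr : ∀ r, 3 ≤ r → r ≠ 39 → (skip.det w s').reg r = s'.reg r := by
          intro r _ h
          simp [skip, Cmd.det, h]
        refine (tr_det (c := skip) rfl (x1.congr hr rfl) ?_).mono h3 (fun _ h => h)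
          (fun _ _ => le_rfl) le_rfl
        rwa [potential_congr hr rfl]
    · obtain ⟨y1, y2⟩ := outCmd_spec (w := w) (ε := ε) (q := q) (k := k) hi'' rfl
      exact tr_det rfl y1 y2.ge

/-! ## The preprocessing program -/

def copyCmd : Cmd :=
  .seq (.assign 4 (.reg 0)) (.seq (.assign 5 (.reg 1)) (.seq (.assign 6 (.reg 2))
  (.seq (.assign 12 (.reg 4 * (.reg 5 + .const 1))) (.seq (.assign 13 (.reg 12 + .const 1))
  (.seq (.assign 7 (.const 1)) (.seq (.assign 40 (.const 1)) (.assign 37 (.reg 4 * .reg 4))))))))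

def loadBody : Cmd :=
  .seq (.seq (.assign 34 (.reg 37 / .reg 4)) (.seq (.assign 35 (.reg 37 % .reg 4))
    (.assign 36 (.read 0 (.reg 37))))) halfSet

/-- Load the initial graph. -/
def loadCmd : Cmd := loadBody.repeat 37

def logBody : Cmd :=
  .ite (.op .lt (.reg 40) (.reg 3))
    (.seq (.assign 40 (.const 2 * .reg 40)) (.assign 7 (.reg 7 + .const 1))) skip

/-- Compute a logarithm of register `3`. -/
def logCmd : Cmd := .seq (.assign 37 (.reg 3)) (logBody.repeat 37)

def paramCmd : Cmd :=
  .seq (.assign 8 (.const 16 * .reg 5 * .reg 6))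
  (.seq (.assign 9 (.const 16 * .reg 6 * .reg 7 * (.const 16 * .reg 5 * .reg 6)))
  (.seq (.assign 11 (.const 160 * .reg 5 * .reg 6))
  (.seq (.assign 10 (.const 0)) (.assign 37 (.reg 9)))))

def costBody : Cmd :=
  .seq (.assign 23 (.reg 8 / (.reg 37 % .reg 8 + .const 1)))
    (.assign 10 (.reg 10 + (.const 2 * ((.reg 23 + .const 1) * (.reg 23 + .reg 5 + .const 4))
      + .const 3)))

/-- Compute the number of steps of the estimator. -/
def costCmd : Cmd := costBody.repeat 37

def prepCmd : Cmd :=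
  .seq copyCmd (.ite (.op .lt (.reg 6) (.const 2)) (.assign 0 (.const 0))
    (.seq loadCmd (.seq logCmd (.seq (.seq paramCmd costCmd)
      (.seq startEpoch (.seq runCmd outCmd))))))

/-- From the store `s`, the command `c` halts within `T` steps in stores that satisfy `P`. -/
def Ends (w : ℕ) (c : Cmd) (s : Store) (T : ℕ) (P : Store → Prop) : Prop :=
  Tr w c s T P (fun _ => 0) 0

theorem Ends.mono {c : Cmd} {T : ℕ} {P P' : Store → Prop} (h : Ends w c s T P)
    (hP : ∀ s', P s' → P' s') : Ends w c s T P' :=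
  Tr.mono h le_rfl hP (fun _ _ => le_rfl) le_rfl

theorem ends_repeat {x : ℕ} {c : Cmd} {T : ℕ} {I : ℕ → Store → Prop}
    (hc : ∀ m s, m + 1 < 2 ^ w → s.reg x = m + 1 → I (m + 1) s →
      Tr w c (s.setReg x m) T (I m) (fun _ => 0) 0) (hx : c.modReg x = false)
    (hm : s.reg x < 2 ^ w) (hI : I (s.reg x) s) :
    Ends w (c.repeat x) s (s.reg x * (T + 3) + 1) (fun s' => I 0 s' ∧
      (∀ r, (c.repeat x).modReg r = false → s'.reg r = s.reg r) ∧
      (∀ b, c.modArr b = false → s'.arr b = s.arr b)) := by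
  refine (tr_repeat (T := T) (f := fun _ => 0) (I := I) ?_ _ hm s rfl hI).frame.mono le_rfl ?_
    (fun _ _ => le_rfl) le_rfl
  · intro j t h1 h2 h3
    refine (hc j t h1 h2 h3).frame.mono le_rfl (fun t' h => ⟨h.1, ?_⟩) (fun _ _ => le_rfl) le_rfl
    rw [h.2.1 x hx]
    simp
  · rintro t ⟨h1, h2, h3⟩
    refine ⟨h1.1, h2, fun b hb => h3 b ?_⟩
    simp [Cmd.repeat, Cmd.modArr, hb]

theorem logCmd_spec (hb : 2 * s.reg 3 + 2 < 2 ^ w) (h7 : s.reg 7 = 1) (h40 : s.reg 40 = 1) :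
    Ends w logCmd s (s.reg 3 * (logBody.cost + 3) + 3) fun s' => s'.reg 7 = Nat.clog 2 (s.reg 3) + 1 ∧
      (∀ r, logCmd.modReg r = false → s'.reg r = s.reg r) ∧ s'.arr = s.arr := by
  have h1w : 1 < 2 ^ w := by omega
  have h2w : 2 < 2 ^ w := by omega
  -- The last clause says that the power has reached the bound or that enough rounds remain; `reg 3`
  -- rounds suffice because i < 2^i.
  let I : ℕ → Store → Prop := fun j t => t.reg 3 = s.reg 3 ∧ ∃ i, t.reg 7 = i + 1 ∧
    t.reg 40 = 2 ^ i ∧ i ≤ Nat.clog 2 (s.reg 3) ∧ (s.reg 3 ≤ 2 ^ i ∨ s.reg 3 ≤ i + j)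
  have hI : ∀ j t, j + 1 < 2 ^ w → t.reg 37 = j + 1 → I (j + 1) t →
      Tr w logBody (t.setReg 37 j) logBody.cost (I j) (fun _ => 0) 0 := by
    rintro j t hj ht ⟨h3, i, h1, h2, h4, h5⟩
    refine tr_det rfl ?_ le_rfl
    by_cases hlt : 2 ^ i < s.reg 3
    · have hi : i < 2 ^ i := Nat.lt_two_pow_self
      rw [logBody, det_ite_pos ((eval_lt_ne h1w).2 (by simpa [h2, h3] using hlt))]
      refine ⟨by simpa [Cmd.det] using h3, i + 1, ?_, ?_, ?_, ?_⟩
      · simp [Cmd.det, h1]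
        exact Nat.mod_eq_of_lt (by omega)
      · simp [Cmd.det, h2]
        rw [pow_succ, mul_comm]
        exact Nat.mod_eq_of_lt (by omega)
      · exact (Nat.lt_clog_iff_pow_lt (by norm_num)).2 hlt
      · right
        omega
    · rw [logBody, det_ite_neg ((eval_lt_eq h1w).2 (by simpa [h2, h3] using hlt))]
      exact ⟨by simpa [skip, Cmd.det] using h3, i, by simpa [skip, Cmd.det] using h1,
        by simpa [skip, Cmd.det] using h2, h4, Or.inl (not_lt.1 hlt)⟩
  have hT := ends_repeat hI rfl (s := s.setReg 37 (s.reg 3)) (by simp; omega)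
    ⟨by simp, 0, by simpa using h7, by simpa using h40, Nat.zero_le _, by simp⟩
  refine Tr.mono (Tr.seq (P := fun s' => s' = s.setReg 37 (s.reg 3)) (f := fun _ => 0) (T₁ := 1)
    (T₂ := s.reg 3 * (logBody.cost + 3) + 1) ((big_assign 37 _ s).tr rfl le_rfl) ?_) (by omega)
    (fun _ h => h) (fun _ _ => le_rfl) le_rfl
  rintro s' rfl
  have hs3 : (s.setReg 37 (s.reg 3)).reg 37 = s.reg 3 := by simp
  rw [hs3] at hT
  refine hT.mono ?_
  rintro t ⟨⟨-, i, h1, -, h3, h4⟩, h5, h6⟩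
  refine ⟨?_, fun r hr => ?_, ?_⟩
  · rw [h1, add_left_inj]
    refine le_antisymm h3 (Nat.clog_le_of_le_pow ?_)
    rcases h4 with h4 | h4
    · exact h4
    · exact h4.trans Nat.lt_two_pow_self.le
  · have h7 : (logBody.repeat 37).modReg r = false := by
      simp only [logCmd, Cmd.modReg, Bool.or_eq_false_iff] at hr
      exact hr.2
    have h8 : r ≠ 37 := by
      rintro rfl
      simp [logCmd, Cmd.modReg] at hr
    rw [h5 r h7]
    simp [h8]
  · funext b
    exact h6 b rfl

theorem costCmd_spec (hw : Words w n W a l) (h5 : s.reg 5 = W) (h8 : s.reg 8 = gam W a)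
    (h10 : s.reg 10 = 0) (h37 : s.reg 37 = smp W a l) :
    Ends w costCmd s (smp W a l * (costBody.cost + 3) + 1) fun s' => s'.reg 10 = tot W a l ∧
      (∀ r, costCmd.modReg r = false → s'.reg r = s.reg r) ∧ s'.arr = s.arr := by
  have hT := hw.tot_lt
  have hS := hw.fits.S_lt
  have hΓ := hw.fits.Γ_lt
  have hΓ0 := hw.fits.Γ_pos
  have h1w := hw.fits.one_lt
  rw [← h37]
  refine (ends_repeat (w := w) (x := 37) (c := costBody) (T := costBody.cost) (s := s)
    (I := fun j t => t.reg 5 = W ∧ t.reg 8 = gam W a ∧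
      t.reg 10 + totalCost W (gam W a) j = tot W a l) ?_ rfl (by omega)
    ⟨h5, h8, by rw [h10, h37, zero_add]; rfl⟩).mono ?_
  · rintro j t hj ht ⟨t5, t8, t10⟩
    refine tr_det rfl ?_ le_rfl
    rw [totalCost, Finset.sum_range_succ, ← totalCost, sampleCost, stageCost] at t10
    set X := gam W a / (j % gam W a + 1) with hX
    have h23 : (Expr.reg 8 / (.reg 37 % .reg 8 + .const 1)).eval w (t.setReg 37 j) = X := by
      have h1 : j % gam W a < gam W a := Nat.mod_lt _ (by omega)
      have h2 : X ≤ gam W a := Nat.div_le_self _ _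
      simp only [eval_div, eval_add, eval_mod, eval_reg, eval_const, Store.setReg_reg, if_true,
        show (8 : ℕ) ≠ 37 by decide, if_false, t8]
      rw [Nat.mod_eq_of_lt h1w, Nat.mod_eq_of_lt (show j % gam W a < 2 ^ w by omega),
        Nat.mod_eq_of_lt (show j % gam W a + 1 < 2 ^ w by omega)]
      exact Nat.mod_eq_of_lt (by omega)
    rw [costBody]
    simp only [Cmd.det, h23]
    refine ⟨by simpa using t5, by simpa using t8, ?_⟩
    simp [t5]
    rw [Nat.mod_eq_of_lt (by omega)]
    omega
  · rintro t ⟨⟨-, -, h1⟩, h2, h3⟩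
    refine ⟨by simpa [totalCost] using h1, h2, ?_⟩
    funext b
    exact h3 b rfl

/-- Zeroed memory represents the empty graph. The matrix is read from its last entry to its first,
so with `j` entries left exactly the arcs of index at least `j` are present. -/
theorem loadCmd_spec (hw : Words w n W a l) (hc : IsCfg n W s) (hG : G.WeightsIn W)
    (h0 : ∀ i < n * n, s.arr 0 i = G.arc (i / n) (i % n)) (h37 : s.reg 37 = n * n)
    (hz : ∀ b, b ≠ 0 → ∀ i, s.arr b i = 0) :
    Ends w loadCmd s (n * n * (loadBody.cost + 3) + 1) fun s' => IsDS n W s' G.arc ∧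
      (∀ r, loadCmd.modReg r = false → s'.reg r = s.reg r) := by
  have hnn : n * n < 2 ^ w := by
    refine lt_of_le_of_lt (Nat.mul_le_mul_right n ?_) hw.fits.row
    have : n * 1 ≤ n * (W + 1) := Nat.mul_le_mul_left _ (by omega)
    omega
  rw [← h37]
  refine (ends_repeat (w := w) (x := 37) (c := loadBody) (T := loadBody.cost) (s := s)
    (I := fun j t => j ≤ n * n ∧ IsCfg n W t ∧ t.arr 0 = s.arr 0 ∧
      IsDS n W t fun u v => if j ≤ u * n + v then G.arc u v else 0) ?_ rfl (by omega) ?_).mono ?_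
  · rintro j t hj ht ⟨hjn, hct, t0, htd⟩
    refine tr_det rfl ?_ le_rfl
    have hn : 0 < n := by
      rcases Nat.eq_zero_or_pos n with rfl | h
      · omega
      · exact h
    have hu : j / n < n := Nat.div_lt_of_lt_mul (by omega)
    have hv : j % n < n := Nat.mod_lt _ hn
    have hjuv : j / n * n + j % n = j := by rw [mul_comm]; exact Nat.div_add_mod j n
    rw [loadBody, Cmd.det_seq]
    set t1 := Cmd.det w (.seq (.assign 34 (.reg 37 / .reg 4)) (.seq (.assign 35 (.reg 37 % .reg 4))
      (.assign 36 (.read 0 (.reg 37))))) (t.setReg 37 j) with ht1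
    have e1 : ∀ x, x ≤ j → x % 2 ^ w = x := fun x hx => Nat.mod_eq_of_lt (by omega)
    have r34 : t1.reg 34 = j / n := by
      simp [ht1, Cmd.det, hct.1]
      exact e1 _ (Nat.div_le_self _ _)
    have r35 : t1.reg 35 = j % n := by
      simp [ht1, Cmd.det, hct.1]
      exact e1 _ (Nat.mod_le _ _)
    have r36 : t1.reg 36 = G.arc (j / n) (j % n) := by
      simp [ht1, Cmd.det, t0]
      exact h0 j (by omega)
    have hc1 : IsCfg n W t1 := by
      obtain ⟨c1, c2, c3, c4⟩ := hct
      refine ⟨?_, ?_, ?_, ?_⟩ <;> simp [Cmd.det, *]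
    have hd1 := htd.congr (s' := t1) rfl rfl rfl rfl
    have hle : G.arc (j / n) (j % n) ≤ W := by
      rw [WGraph.arc]
      split_ifs
      · exact hG.2 _
      · exact Nat.zero_le _
    have h2 := halfSet_spec hw.fits.row hw.fits.bucket hd1 hc1 r34 r35 r36 hu hv hle
    have a0 : (halfSet.det w t1).arr 0 = s.arr 0 := by rw [Cmd.det_arr rfl]; exact t0
    have hr : ∀ r, halfSet.modReg r = false → (halfSet.det w t1).reg r = t1.reg r :=
      fun r hr => Cmd.det_reg hr t1
    set t2 := halfSet.det w t1 with ht2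
    clear_value t2
    refine ⟨by omega, ?_, a0, ?_⟩
    · obtain ⟨c1, c2, c3, c4⟩ := hc1
      exact ⟨by rw [hr 4 rfl, c1], by rw [hr 5 rfl, c2], by rw [hr 12 rfl, c3],
        by rw [hr 13 rfl, c4]⟩
    · convert h2 using 1
      funext u v
      rw [setArc]
      by_cases huv : u = j / n ∧ v = j % n
      · rw [if_pos huv, huv.1, huv.2, hjuv, if_pos le_rfl]
      · rw [if_neg huv]
        by_cases hb : G.arc u v = 0
        · simp [hb]
        · have hlt := WGraph.lt_of_arc hb
          have : u * n + v ≠ j := by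
            intro he
            rw [← hjuv] at he
            exact huv (row_inj hlt.2 hv he)
          split_ifs <;> first | rfl | omega
  · rw [h37]
    refine ⟨le_rfl, hc, rfl, ?_⟩
    have h1 : ∀ u v, (if n * n ≤ u * n + v then G.arc u v else 0) = 0 := by
      intro u v
      split_ifs with h
      · by_contra hne
        have hlt := WGraph.lt_of_arc hne
        have := row_lt hlt.1 hlt.2
        omega
      · rfl
    simp only [h1]
    refine ⟨?_, ?_, ?_, ?_, ?_, ?_⟩
    · intro b _
      simp [hz]
    · simp [hz]
    · simp
    · intro u _ c hc _ v
      simp [Mem, hz]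
      omega
    · simp [Mem, hz]
    · simp [Mem, hz]
  · rintro t ⟨⟨-, -, -, h1⟩, h2, -⟩
    exact ⟨by simpa using h1, h2⟩

/-- Register `16` is initially 0, so the first epoch has length one: its only chunk is the complete
run, and a value is available before the first update. -/
theorem prepCmd_spec {b : ℕ} (hw : Words w n W a l) (ha : 2 ≤ a) (hb : 2 * b + 2 < 2 ^ w)
    (hl : l = Nat.clog 2 b + 1) (hε : 1 ≤ ε * a) (hG : G.WeightsIn W)
    (hq : q + 2 * ENNReal.ofReal (Real.exp (-3 * l)) ≤ 1) :
    ∃ T, Tr w prepCmd (inputStore W a b G) T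
      (fun s' => Inv W a l G.nis G s' ∧ s'.reg 0 = s'.reg 28 ∧ s'.reg 1 = s'.reg 29)
      (potential W a l ε q k G) q := by
  have h1w := hw.fits.one_lt
  have h2w : 2 < 2 ^ w := by have := hw.n_lt; omega
  have e1 : ∀ x, x < 2 ^ w → x % 2 ^ w = x := fun x hx => Nat.mod_eq_of_lt hx
  have hbk := hw.fits.bucket
  have hnn : n * n < 2 ^ w := by
    refine lt_of_le_of_lt (Nat.mul_le_mul_right n ?_) hw.fits.row
    have : n * 1 ≤ n * (W + 1) := Nat.mul_le_mul_left _ (by omega)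
    omega
  have hw0 : 0 < w := Nat.pos_of_ne_zero (by rintro rfl; simp at h1w)
  set s0 := inputStore W a b G with hs0
  obtain ⟨s1, hs1⟩ : ∃ s1, s1 = copyCmd.det w s0 := ⟨_, rfl⟩
  have a1 : s1.arr = s0.arr := by rw [hs1]; rfl
  have r1 : ∀ r, copyCmd.modReg r = false → s1.reg r = s0.reg r := fun r hr => by
    rw [hs1, Cmd.det_reg hr]
  have hW := hw.fits.W_lt
  have c1 : IsCfg n W s1 := by
    refine ⟨by simp [hs1, copyCmd, Cmd.det, hs0, inputStore],
      by simp [hs1, copyCmd, Cmd.det, hs0, inputStore], ?_, ?_⟩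
    · simp [hs1, copyCmd, Cmd.det, hs0, inputStore]
      exact e1 _ (by omega)
    · simp [hs1, copyCmd, Cmd.det, hs0, inputStore]
      exact e1 _ (by omega)
  have s1_6 : s1.reg 6 = a := by simp [hs1, copyCmd, Cmd.det, hs0, inputStore]
  have s1_7 : s1.reg 7 = 1 := by
    simp [hs1, copyCmd, Cmd.det]
    exact hw0
  have s1_40 : s1.reg 40 = 1 := by
    simp [hs1, copyCmd, Cmd.det]
    exact hw0
  have s1_37 : s1.reg 37 = n * n := by
    simp [hs1, copyCmd, Cmd.det, hs0, inputStore]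
    exact e1 _ hnn
  have s1_3 : s1.reg 3 = b := by rw [r1 3 rfl]; simp [hs0, inputStore]
  have s1_14 : s1.reg 14 = 0 := by rw [r1 14 rfl]; simp [hs0, inputStore]
  have s1_16 : s1.reg 16 = 0 := by rw [r1 16 rfl]; simp [hs0, inputStore]
  have h0 : ∀ i < n * n, s1.arr 0 i = G.arc (i / n) (i % n) := by
    intro i hi
    have hn : 0 < n := by
      rcases Nat.eq_zero_or_pos n with rfl | h
      · omega
      · exact h
    have hu : i / n < n := Nat.div_lt_of_lt_mul hi
    have hv : i % n < n := Nat.mod_lt _ hn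
    rw [a1, hs0]
    simp [inputStore, hi, WGraph.arc, hu, hv]
  have hz : ∀ c, c ≠ 0 → ∀ i, s1.arr c i = 0 := by
    intro c hc i
    rw [a1, hs0]
    simp [inputStore, hc]
  -- the stages of the main part
  let P2 : Store → Prop := fun s => IsDS n W s G.arc ∧ IsCfg n W s ∧ s.reg 6 = a ∧ s.reg 7 = 1 ∧
    s.reg 40 = 1 ∧ s.reg 3 = b ∧ s.reg 16 = 0
  let P3 : Store → Prop := fun s => IsDS n W s G.arc ∧ IsCfg n W s ∧ s.reg 6 = a ∧ s.reg 7 = l ∧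
    s.reg 16 = 0
  let P5 : Store → Prop := fun s => IsDS n W s G.arc ∧ Params n W a l s ∧ s.reg 16 = 0
  have st2 : Ends w loadCmd s1 (n * n * (loadBody.cost + 3) + 1) P2 := by
    refine (loadCmd_spec hw c1 hG h0 s1_37 hz).mono ?_
    rintro s ⟨x1, x2⟩
    obtain ⟨y1, y2, y3, y4⟩ := c1
    exact ⟨x1, ⟨by rw [x2 4 rfl, y1], by rw [x2 5 rfl, y2], by rw [x2 12 rfl, y3],
      by rw [x2 13 rfl, y4]⟩, by rw [x2 6 rfl, s1_6], by rw [x2 7 rfl, s1_7],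
      by rw [x2 40 rfl, s1_40], by rw [x2 3 rfl, s1_3], by rw [x2 16 rfl, s1_16]⟩
  have st3 : ∀ s, P2 s → Ends w logCmd s (b * (logBody.cost + 3) + 3) P3 := by
    rintro s ⟨x1, ⟨y1, y2, y3, y4⟩, x3, x4, x5, x6, x7⟩
    rw [← x6]
    refine (logCmd_spec (by rw [x6]; exact hb) x4 x5).mono ?_
    rintro t ⟨z1, z2, z3⟩
    exact ⟨x1.congr (by rw [z3]) (by rw [z3]) (by rw [z3]) (by rw [z3]),
      ⟨by rw [z2 4 rfl, y1], by rw [z2 5 rfl, y2], by rw [z2 12 rfl, y3], by rw [z2 13 rfl, y4]⟩,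
      by rw [z2 6 rfl, x3], by rw [z1, x6, hl], by rw [z2 16 rfl, x7]⟩
  have st4 : ∀ s, P3 s → Ends w (.seq paramCmd costCmd) s
      (paramCmd.cost + (smp W a l * (costBody.cost + 3) + 1) + 1) P5 := by
    rintro s ⟨x1, ⟨y1, y2, y3, y4⟩, x3, x4, x5⟩
    refine Tr.seq (P := fun s' => s' = paramCmd.det w s) (f := fun _ => 0) (tr_det rfl rfl le_rfl) ?_
    rintro s' hs'
    have hr : ∀ r, paramCmd.modReg r = false → s'.reg r = s.reg r := fun r hr => by
      rw [hs', Cmd.det_reg hr]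
    have h8 : s'.reg 8 = gam W a := by
      rw [hs']
      simp [paramCmd, Cmd.det, y2, x3]
      rw [gam]
      exact e1 _ (by have := hw.fits.Γ_lt; rw [gam] at this; omega)
    have h9 : smp W a l % 2 ^ w = smp W a l := e1 _ (by have := hw.fits.S_lt; omega)
    have h9' : s'.reg 9 = smp W a l := by
      rw [hs']
      simp [paramCmd, Cmd.det, y2, x3, x4]
      exact h9
    have h37 : s'.reg 37 = smp W a l := by
      rw [hs']
      simp [paramCmd, Cmd.det, y2, x3, x4]
      exact h9
    have h10 : s'.reg 10 = 0 := by rw [hs']; simp [paramCmd, Cmd.det]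
    have h11 : s'.reg 11 = quo W a := by
      rw [hs']
      simp [paramCmd, Cmd.det, y2, x3]
      exact e1 _ hw.quo_lt
    have ha' : s'.arr = s.arr := by rw [hs']; rfl
    have hd := x1.congr (s' := s') (by rw [ha']) (by rw [ha']) (by rw [ha']) (by rw [ha'])
    clear hs' hb hl hz
    refine (costCmd_spec hw (by rw [hr 5 rfl, y2]) h8 h10 h37).mono ?_
    rintro t ⟨z1, z2, z3⟩
    exact ⟨hd.congr (by rw [z3]) (by rw [z3]) (by rw [z3]) (by rw [z3]),
      ⟨⟨by rw [z2 4 rfl, hr 4 rfl, y1], by rw [z2 5 rfl, hr 5 rfl, y2],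
        by rw [z2 12 rfl, hr 12 rfl, y3], by rw [z2 13 rfl, hr 13 rfl, y4]⟩,
        by rw [z2 6 rfl, hr 6 rfl, x3], by rw [z2 8 rfl, h8], by rw [z2 9 rfl, h9'], z1,
        by rw [z2 11 rfl, h11]⟩, by rw [z2 16 rfl, hr 16 rfl, x5]⟩
  have st5 : ∀ s, P5 s → Tr w (.seq startEpoch (.seq runCmd outCmd)) s
      (startEpoch.cost + ((tot W a l + 1) * (tick.cost + 3) + postCmd.cost + 4 + outCmd.cost + 1) + 1)
      (fun s' => Inv W a l G.nis G s' ∧ s'.reg 0 = s'.reg 28 ∧ s'.reg 1 = s'.reg 29)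
      (potential W a l ε q k G) q := by
    rintro s ⟨x1, x2, x3⟩
    obtain ⟨y1, y2, y3, -, -, y6⟩ := startEpoch_spec (m := G.nis) (q := q) hw x2 hG x1 (Or.inl x3)
      le_rfl (fun h => absurd x3 h) hq rfl
    refine Tr.seq (P := fun s' => s' = startEpoch.det w s) (f := fun _ => q)
      (tr_det rfl rfl le_rfl) ?_
    rintro s' hs'
    rw [← hs'] at y1 y2 y3 y6
    rw [x3, zero_add] at y2
    have hmid : q ≤ midPotential W a l ε q k G s' := by
      rw [midPotential, y2, if_neg (by omega)]
      split_ifs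
      · exact y6
      · exact le_rfl
    have h19 : s'.reg 19 = tot W a l + 1 := by
      rw [y1.tk, y2, y3, zero_add, Nat.div_one]
    have hrun := runCmd_spec (k := k) (q := q) hw hε y1
    rw [h19] at hrun
    refine Tr.seq (hrun.mono le_rfl (fun _ h => h) (fun _ _ => le_rfl) hmid) fun s'' hi'' => ?_
    obtain ⟨z1, z2⟩ := outCmd_spec (w := w) (ε := ε) (q := q) (k := k) hi'' rfl
    exact tr_det rfl z1 z2.ge
  have hmain := Tr.seq (Tr.const st2 q) fun s h2 => Tr.seq (Tr.const (st3 s h2) q) fun s h3 =>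
    Tr.seq (Tr.const (st4 s h3) q) fun s h5 => st5 s h5
  have hite := Tr.ite (c := .assign 0 (.const 0)) (e := .op .lt (.reg 6) (.const 2)) (fun h => by
    rw [eval_lt_ne h1w, eval_reg, eval_const, s1_6, Nat.mod_eq_of_lt h2w] at h
    omega) (fun _ => hmain)
  exact ⟨_, Tr.seq (P := fun s' => s' = s1) (f := fun _ => q) (tr_det rfl hs1.symm le_rfl)
    fun s' h => (congrArg (fun t => Tr w _ t _ _ _ q) h).mpr hite⟩

end

end RAM

namespace RAM

section

variable {w n W a b l m : ℕ} {ε p : ℝ}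

/-! ## Size of the numbers -/

theorem totalCost_le (W Γ q : ℕ) :
    totalCost W Γ q ≤ q * (2 * ((Γ + 1) * (Γ + W + 4)) + 3) := by
  rw [totalCost]
  refine (Finset.sum_le_card_nsmul _ _ (2 * ((Γ + 1) * (Γ + W + 4)) + 3) fun i _ => ?_).trans_eq
    (by simp)
  have h : Γ / (i % Γ + 1) ≤ Γ := Nat.div_le_self _ _
  rw [sampleCost, stageCost]
  gcongr

/-- With Z = n + W + a + b ≥ 5, the constants 16 and 160 are below Z² and Z⁴. The crudest bound is
Z^20, for `tot`; the exponent 30 leaves room for the additive constants. -/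
theorem words_of_pow (hW : 2 ≤ W) (ha : 1 ≤ a) (hb : 2 ≤ b) (hl : l = Nat.clog 2 b + 1)
    (h : (n + W + a + b) ^ 30 ≤ 2 ^ w) : Words w n W a l ∧ 2 * b + 2 < 2 ^ w := by
  have hlb : l ≤ b + 1 := by
    rw [hl]
    exact Nat.succ_le_succ (Nat.clog_le_of_le_pow Nat.lt_two_pow_self.le)
  obtain ⟨Z, hZ⟩ : ∃ Z, Z = n + W + a + b := ⟨_, rfl⟩
  rw [← hZ] at h
  have hZ5 : 5 ≤ Z := by omega
  have key : ∀ x, x ≤ Z ^ 20 → x + 5 < 2 ^ w := by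
    intro x hx
    refine lt_of_lt_of_le ?_ h
    have h1 : Z ^ 30 = Z ^ 20 * Z ^ 10 := by ring
    have h2 : 5 ^ 10 ≤ Z ^ 10 := Nat.pow_le_pow_left hZ5 10
    have h3 : 1 ≤ Z ^ 20 := Nat.one_le_pow _ _ (by omega)
    nlinarith
  have mono : ∀ {x k}, x ≤ Z ^ k → k ≤ 20 → x ≤ Z ^ 20 := fun hx hk =>
    hx.trans (Nat.pow_le_pow_right (by omega) hk)
  have hn : n ≤ Z := by omega
  have hW' : W + 1 ≤ Z := by omega
  have haZ : a ≤ Z := by omega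
  have hlZ : l ≤ Z := by omega
  have h16 : 16 ≤ Z ^ 2 := le_trans (by norm_num) (Nat.pow_le_pow_left hZ5 2)
  have h160 : 160 ≤ Z ^ 4 := le_trans (by norm_num) (Nat.pow_le_pow_left hZ5 4)
  have hp4 : Z * 5 ^ 3 ≤ Z ^ 4 := by
    rw [show Z ^ 4 = Z * Z ^ 3 by ring]
    exact Nat.mul_le_mul_left _ (Nat.pow_le_pow_left hZ5 3)
  have hp5 : Z ^ 4 * 5 ≤ Z ^ 5 := by
    rw [show Z ^ 5 = Z ^ 4 * Z by ring]
    exact Nat.mul_le_mul_left _ hZ5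
  have hΓ : gam W a ≤ Z ^ 4 := by
    rw [gam, show Z ^ 4 = Z ^ 2 * Z * Z by ring]
    gcongr
    omega
  have hS : smp W a l ≤ Z ^ 8 := by
    rw [smp, show Z ^ 8 = Z ^ 2 * Z * Z * (Z ^ 2 * Z * Z) by ring]
    gcongr
    omega
  have hQ : quo W a ≤ Z ^ 6 := by
    rw [quo, show Z ^ 6 = Z ^ 4 * Z * Z by ring]
    gcongr
    omega
  have hT : tot W a l ≤ Z ^ 20 := by
    refine (totalCost_le _ _ _).trans ?_
    have h1 : (gam W a + 1) * (gam W a + W + 4) ≤ Z ^ 5 * Z ^ 5 := Nat.mul_le_mul (by omega) (by omega)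
    have h2 : 2 * ((gam W a + 1) * (gam W a + W + 4)) + 3 ≤ Z ^ 12 := by
      have h3 : Z ^ 10 * 25 ≤ Z ^ 12 := by
        rw [show Z ^ 12 = Z ^ 10 * Z ^ 2 by ring]
        exact Nat.mul_le_mul_left _ (le_trans (by norm_num) (Nat.pow_le_pow_left hZ5 2))
      have h4 : 1 ≤ Z ^ 10 := Nat.one_le_pow _ _ (by omega)
      rw [show Z ^ 5 * Z ^ 5 = Z ^ 10 by ring] at h1
      omega
    rw [show Z ^ 20 = Z ^ 8 * Z ^ 12 by ring]
    gcongr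
  have hbk : n * (W + 1) ≤ Z ^ 2 := by
    rw [sq]
    gcongr
  have hbk' : n * (W + 1) + 2 ≤ Z ^ 3 := by
    rw [show Z ^ 3 = Z ^ 2 * Z by ring]
    nlinarith
  have hrow : (n * (W + 1) + 2) * n ≤ Z ^ 4 := by
    rw [show Z ^ 4 = Z ^ 3 * Z by ring]
    gcongr
  have hnum : smp W a l * (n * W) ≤ Z ^ 10 := by
    rw [show Z ^ 10 = Z ^ 8 * (Z * Z) by ring]
    gcongr
    omega
  have k1 := key _ (mono hrow (by norm_num))
  have k2 := key _ (mono hbk' (by norm_num))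
  have k3 := key _ (mono hΓ (by norm_num))
  have k4 := key _ (mono hS (by norm_num))
  have k5 := key _ (mono hQ (by norm_num))
  have k6 := key _ hT
  have k7 := key _ (mono hnum (by norm_num))
  have k8 := key (4 * Z) (mono (by omega : 4 * Z ≤ Z ^ 4) (by norm_num))
  have hΓ0 : 1 ≤ gam W a := by
    have : 0 < gam W a := by unfold gam; positivity
    exact this
  exact ⟨⟨⟨by omega, by omega, by omega, by omega, hΓ0, by omega, by omega⟩, by omega, by omega,
    by omega, by omega, hW, ha, by omega⟩, by omega⟩

/-! ## The running time -/

/-- As 1 ≤ X ≤ Γ = 16Wa, the quadratic cost of a sample is at most 78Wa·X, and X ≤ Γ/(j+1) makes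
each cycle a harmonic sum. The constant is 16·78·16. -/
theorem tot_le (hW : 2 ≤ W) (ha : 1 ≤ a) :
    (tot W a l : ℝ) ≤ 19968 * W ^ 2 * a ^ 3 * l * (1 + Real.log (gam W a)) := by
  have hΓ0 : 0 < gam W a := by unfold gam; positivity
  have hW' : (2 : ℝ) ≤ W := by exact_mod_cast hW
  have ha' : (1 : ℝ) ≤ a := by exact_mod_cast ha
  have h1 : (tot W a l : ℝ) = ∑ j ∈ Finset.range (16 * a * l * gam W a),
      (fun j => (sampleCost W (gam W a / (j + 1)) : ℝ)) (j % gam W a) := by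
    rw [tot, totalCost]
    push_cast
    rfl
  rw [h1, WGraph.sum_mod (Γ := gam W a) (fun j => (sampleCost W (gam W a / (j + 1)) : ℝ))]
  have h2 : ∀ j ∈ Finset.range (gam W a), (sampleCost W (gam W a / (j + 1)) : ℝ)
      ≤ (78 * W * a * gam W a) * ((j : ℝ) + 1)⁻¹ := by
    intro j hj
    have hj' : j + 1 ≤ gam W a := Finset.mem_range.1 hj
    have h3 : 1 ≤ gam W a / (j + 1) := (Nat.one_le_div_iff (by omega)).2 hj'
    have h4 : gam W a / (j + 1) ≤ gam W a := Nat.div_le_self _ _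
    have h5 : ((gam W a / (j + 1) : ℕ) : ℝ) ≤ gam W a * ((j : ℝ) + 1)⁻¹ := by
      refine Nat.cast_div_le.trans_eq ?_
      push_cast
      rw [div_eq_mul_inv]
    set X := gam W a / (j + 1) with hX
    have h6 : sampleCost W X ≤ (4 * gam W a + 14 * W) * X := by
      rw [sampleCost, stageCost]
      nlinarith [Nat.mul_le_mul_right X h4, Nat.mul_le_mul_right X hW, Nat.mul_le_mul_right X h3,
        Nat.mul_le_mul_right W h3]
    have h7 : 4 * gam W a + 14 * W ≤ 78 * W * a := by
      rw [gam]
      nlinarith [Nat.mul_le_mul_left W ha]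
    have h8 : (sampleCost W X : ℝ) ≤ (78 * W * a) * X := by
      exact_mod_cast h6.trans (Nat.mul_le_mul_right X h7)
    refine h8.trans ?_
    rw [mul_assoc (78 * W * a : ℝ)]
    gcongr
  have h3 : ∑ j ∈ Finset.range (gam W a), ((j : ℝ) + 1)⁻¹ ≤ 1 + Real.log (gam W a) := by
    have := harmonic_le_one_add_log (gam W a)
    simpa [harmonic] using this
  have h4 := Finset.sum_le_sum h2
  rw [← Finset.mul_sum] at h4
  have h5 : (78 * W * a * gam W a : ℝ) * ∑ j ∈ Finset.range (gam W a), ((j : ℝ) + 1)⁻¹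
      ≤ (78 * W * a * gam W a) * (1 + Real.log (gam W a)) := by gcongr
  calc ((16 * a * l : ℕ) : ℝ) * ∑ j ∈ Finset.range (gam W a), (sampleCost W (gam W a / (j + 1)) : ℝ)
      ≤ ((16 * a * l : ℕ) : ℝ) * ((78 * W * a * gam W a) * (1 + Real.log (gam W a))) := by
        gcongr
        exact h4.trans h5
    _ = _ := by
        have : (gam W a : ℝ) = 16 * W * a := by rw [gam]; push_cast; rfl
        push_cast
        rw [this]
        ring

/-- Rounding costs constants only: a ≤ 2/ε, l ≤ 3 + 2 log(1/p), and Γ ≤ 32W/ε together with W/ε ≥ 2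
gives 1 + log Γ ≤ 9 log(W/ε). -/
theorem work_le (hW : 2 ≤ W) (hε : 0 < ε) (hε' : ε < 1) (hp : 0 < p) (hp' : p < 1)
    (ha : a = ⌈1 / ε⌉₊) (hb : b = ⌈1 / p⌉₊) (hl : l = Nat.clog 2 b + 1) :
    (tot W a l * quo W a : ℝ) ≤
      3194880 * 16 * (W ^ 3 / ε ^ 4) * (3 + 2 * Real.log (1 / p)) * (9 * Real.log (W / ε)) := by
  have hW' : (2 : ℝ) ≤ W := by exact_mod_cast hW
  have hlog2 := Real.log_two_gt_d9
  have h1ε : 1 < 1 / ε := by rw [lt_div_iff₀ hε]; linarith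
  have h1p : 1 < 1 / p := by rw [lt_div_iff₀ hp]; linarith
  have ha1 : 1 ≤ a := by rw [ha]; exact Nat.one_le_ceil_iff.2 (by linarith)
  have ha2 : (a : ℝ) ≤ 2 / ε := by
    have := Nat.ceil_lt_add_one (show 0 ≤ 1 / ε by linarith)
    rw [ha, show 2 / ε = 1 / ε + 1 / ε by ring]
    linarith
  have hb2 : (b : ℝ) ≤ 2 * (1 / p) := by
    have := Nat.ceil_lt_add_one (show 0 ≤ 1 / p by linarith)
    rw [hb]
    linarith
  have hb1 : 1 < b := by
    rw [hb, Nat.lt_ceil]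
    simpa using h1p
  have hl' : (l : ℝ) ≤ 3 + 2 * Real.log (1 / p) := by
    have h1 : (2 : ℝ) ^ (Nat.clog 2 b - 1) ≤ b := by
      exact_mod_cast (Nat.pow_pred_clog_lt_self (by norm_num) hb1).le
    have h2 : ((Nat.clog 2 b - 1 : ℕ) : ℝ) * Real.log 2 ≤ Real.log (2 * (1 / p)) := by
      rw [← Real.log_pow]
      exact Real.log_le_log (by positivity) (h1.trans hb2)
    rw [Real.log_mul (by norm_num) (by positivity)] at h2
    have h3 : (l : ℝ) = ((Nat.clog 2 b - 1 : ℕ) : ℝ) + 2 := by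
      have := Nat.clog_pos (b := 2) (by norm_num) hb1
      have h4 : Nat.clog 2 b + 1 = (Nat.clog 2 b - 1) + 2 := by omega
      rw [hl]
      exact_mod_cast h4
    have h4 : 0 ≤ Real.log (1 / p) := Real.log_nonneg h1p.le
    rw [h3]
    nlinarith
  have hWε : (2 : ℝ) ≤ W / ε := by
    rw [le_div_iff₀ hε]
    nlinarith
  have hL1 : Real.log 2 ≤ Real.log (W / ε) := Real.log_le_log (by norm_num) hWε
  have hΓ : 1 + Real.log (gam W a) ≤ 9 * Real.log (W / ε) := by
    have h1 : (gam W a : ℝ) ≤ 2 ^ 5 * (W / ε) := by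
      have : (gam W a : ℝ) = 16 * W * a := by rw [gam]; push_cast; rfl
      rw [this]
      calc (16 * W * a : ℝ) ≤ 16 * W * (2 / ε) := by gcongr
        _ = _ := by ring
    have h0 : (0 : ℝ) < gam W a := by
      have : 0 < gam W a := by unfold gam; positivity
      exact_mod_cast this
    have h2 := Real.log_le_log h0 h1
    rw [Real.log_mul (by norm_num) (by positivity), Real.log_pow] at h2
    push_cast at h2
    have hlt := Real.log_two_lt_d9
    linarith
  have hq : (quo W a : ℝ) = 160 * W * a := by rw [quo]; push_cast; rfl
  have hlogΓ : 0 ≤ 1 + Real.log (gam W a) := by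
    have := Real.log_natCast_nonneg (gam W a)
    linarith
  have h4 : 0 ≤ Real.log (1 / p) := Real.log_nonneg h1p.le
  calc (tot W a l * quo W a : ℝ)
      ≤ (19968 * W ^ 2 * a ^ 3 * l * (1 + Real.log (gam W a))) * quo W a := by
        gcongr
        exact tot_le hW ha1
    _ = 3194880 * (W ^ 3 * (a : ℝ) ^ 4) * l * (1 + Real.log (gam W a)) := by
        rw [hq]; ring
    _ ≤ 3194880 * (W ^ 3 * (2 / ε) ^ 4) * (3 + 2 * Real.log (1 / p)) * (9 * Real.log (W / ε)) := by
        gcongr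
    _ = _ := by
        field_simp
        ring

theorem work_le_timeBound {M : ℕ} (hM : 1 ≤ M) (hW : 2 ≤ W) (hε : 0 < ε) (hε' : ε < 1)
    (hp : 0 < p) (hp' : p < 1)
    (ha : a = ⌈1 / ε⌉₊) (hb : b = ⌈1 / p⌉₊) (hl : l = Nat.clog 2 b + 1) :
    (tot W a l * quo W a : ℝ) / M ≤ 10 ^ 16 * timeBound W ε p M := by
  have hw := work_le hW hε hε' hp hp' ha hb hl
  have hW' : (2 : ℝ) ≤ W := by exact_mod_cast hW
  have hM' : (1 : ℝ) ≤ M := by exact_mod_cast hM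
  have hlog2 := Real.log_two_gt_d9
  have h1ε : 1 < 1 / ε := by rw [lt_div_iff₀ hε]; linarith
  have h1p : 1 < 1 / p := by rw [lt_div_iff₀ hp]; linarith
  have hWε : (2 : ℝ) ≤ W / ε := by
    rw [le_div_iff₀ hε]
    nlinarith
  have hL1 : Real.log 2 ≤ Real.log (W / ε) := Real.log_le_log (by norm_num) hWε
  have hLW : Real.log 2 ≤ Real.log W := Real.log_le_log (by norm_num) hW'
  have hp0 : 0 ≤ Real.log (1 / p) := Real.log_nonneg h1p.le
  have hε4 : 0 < ε ^ 4 := by positivity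
  -- In the first case log(1/p) is at most the last logarithm of the bound plus one, and the factor
  -- log W is inserted using 2 log W ≥ 1. In the second case that logarithm may be small or
  -- negative, but then ε, p ≥ 1/3 and W ≤ 8, so all the work is bounded by a constant.
  rcases le_total 2 (Real.log W / (ε * p)) with h | h
  · have hL2 : Real.log 2 ≤ Real.log (Real.log W / (ε * p)) := Real.log_le_log (by norm_num) h
    have hlp : Real.log (1 / p) ≤ Real.log (Real.log W / (ε * p)) + 1 := by
      have h1 : 1 / p ≤ 2 * (Real.log W / (ε * p)) := by
        rw [show 2 * (Real.log W / (ε * p)) = (1 / p) * (2 * Real.log W * (1 / ε)) by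
          field_simp]
        refine le_mul_of_one_le_right (by positivity) ?_
        nlinarith
      have h2 := Real.log_le_log (by positivity) h1
      rw [Real.log_mul (by norm_num) (by linarith)] at h2
      have := Real.log_two_lt_d9
      linarith
    set L2 := Real.log (Real.log W / (ε * p)) with hL2'
    set L1 := Real.log (W / ε) with hL1'
    set LW := Real.log W with hLW'
    have h3 : 3 + 2 * Real.log (1 / p) ≤ 10 * L2 := by linarith
    have h4 : (tot W a l * quo W a : ℝ) ≤ 10 ^ 16 * (W ^ 3 * LW * L1 * L2 / ε ^ 4) := by
      refine hw.trans ?_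
      calc 3194880 * 16 * (W ^ 3 / ε ^ 4) * (3 + 2 * Real.log (1 / p)) * (9 * L1)
          ≤ 3194880 * 16 * (W ^ 3 / ε ^ 4) * (10 * L2) * (9 * L1) * (2 * LW) := by
            have h5 : 0 ≤ L1 := by linarith
            refine le_trans ?_ (le_mul_of_one_le_right ?_ (by linarith))
            · gcongr
            · have : 0 ≤ L2 := by linarith
              positivity
        _ = (3194880 * 16 * 10 * 9 * 2) * (W ^ 3 * LW * L1 * L2 / ε ^ 4) := by ring
        _ ≤ _ := by
            have : 0 ≤ L2 := by linarith
            have : 0 ≤ L1 := by linarith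
            have : 0 ≤ LW := by linarith
            gcongr
            norm_num
    calc (tot W a l * quo W a : ℝ) / M ≤ 10 ^ 16 * (W ^ 3 * LW * L1 * L2 / ε ^ 4) / M := by gcongr
      _ = 10 ^ 16 * (W ^ 3 * LW * L1 * L2 / (ε ^ 4 * M)) := by
        rw [mul_div_assoc, div_div]
      _ ≤ _ := by
        rw [timeBound]
        gcongr
        exact le_max_right _ _
  · rw [div_le_iff₀ (by positivity)] at h
    have hε2 : (1 : ℝ) / 3 ≤ ε := by nlinarith
    have hp2 : (1 : ℝ) / 3 ≤ p := by nlinarith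
    have hlW : Real.log W ≤ 2 := by nlinarith
    have hW8 : (W : ℝ) ≤ 8 := by
      have h1 : (W : ℝ) ≤ Real.exp 2 := (Real.log_le_iff_le_exp (by positivity)).1 hlW
      have h2 : Real.exp 2 = Real.exp 1 * Real.exp 1 := by rw [← Real.exp_add]; norm_num
      have h3 := Real.exp_one_lt_d9
      have h4 := Real.exp_pos 1
      nlinarith
    have h3 : 1 / p ≤ 3 := by
      rw [div_le_iff₀ hp]; linarith
    have h4 : Real.log (1 / p) ≤ 3 := (Real.log_le_self (by positivity)).trans h3
    have h5 : W / ε ≤ 24 := by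
      rw [div_le_iff₀ hε]; linarith
    have h6 : Real.log (W / ε) ≤ 24 := (Real.log_le_self (by positivity)).trans h5
    have h7 : (W : ℝ) ^ 3 / ε ^ 4 ≤ 8 ^ 3 / (1 / 3) ^ 4 := by gcongr
    have h8 : (tot W a l * quo W a : ℝ) ≤ 10 ^ 16 := by
      refine hw.trans ?_
      calc 3194880 * 16 * (W ^ 3 / ε ^ 4) * (3 + 2 * Real.log (1 / p)) * (9 * Real.log (W / ε))
          ≤ 3194880 * 16 * (8 ^ 3 / (1 / 3) ^ 4) * (3 + 2 * 3) * (9 * 24) := by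
            have : 0 ≤ Real.log (W / ε) := by linarith
            gcongr
        _ ≤ _ := by norm_num
    calc (tot W a l * quo W a : ℝ) / M ≤ 10 ^ 16 / 1 := by gcongr
      _ = 10 ^ 16 * 1 := by ring
      _ ≤ _ := by
        rw [timeBound]
        gcongr
        exact le_max_left _ _

theorem updTime_le (hW : 2 ≤ W) (hε : 0 < ε) (hε' : ε < 1)
    (hp : 0 < p) (hp' : p < 1)
    (ha : a = ⌈1 / ε⌉₊) (hb : b = ⌈1 / p⌉₊) (hl : l = Nat.clog 2 b + 1) :
    (updTime W a l m : ℝ) ≤ ((10 ^ 16 + 1) * (tick.cost + 3) +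
      (preCmd.cost + postCmd.cost + outCmd.cost + 20)) * timeBound W ε p (max 1 m) := by
  have h1 := work_le_timeBound (M := max 1 m) (le_max_left _ _) hW hε hε' hp hp' ha hb hl
  have h2 : ((tot W a l * quo W a / max 1 m : ℕ) : ℝ) ≤ 10 ^ 16 * timeBound W ε p (max 1 m) := by
    refine Nat.cast_div_le.trans ?_
    rw [Nat.cast_mul]
    exact h1
  have h3 : 1 ≤ timeBound W ε p (max 1 m) := le_max_left _ _
  rw [updTime, Nat.cast_add, Nat.cast_mul, Nat.cast_add, Nat.cast_add tick.cost]
  simp only [Nat.cast_one, Nat.cast_ofNat, Nat.cast_add]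
  have h4 : (0 : ℝ) ≤ tick.cost + 3 := by positivity
  have h5 : (0 : ℝ) ≤ preCmd.cost + postCmd.cost + outCmd.cost + 20 := by positivity
  have h6 := mul_le_mul_of_nonneg_right (show ((tot W a l * quo W a / max 1 m : ℕ) : ℝ) + 1
    ≤ (10 ^ 16 + 1) * timeBound W ε p (max 1 m) by linarith) h4
  exact (add_le_add h6 (le_mul_of_one_le_right h5 h3)).trans_eq (by ring)

end

end RAM

/-! ### The interaction with the adversary -/

namespace RAM

theorem Tr.haltsWithin {w T : ℕ} {c : Cmd} {s : Store} {P : Store → Prop} {f : Store → ℝ≥0∞}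
    {v : ℝ≥0∞} (h : Tr w c s T P f v) : HaltsWithin w c s T := by
  obtain ⟨μ, h1, -, -⟩ := h
  exact h1.halts_exec.1

theorem Tr.exec {w T : ℕ} {c : Cmd} {s : Store} {P : Store → Prop} {f : Store → ℝ≥0∞}
    {v : ℝ≥0∞} (h : Tr w c s T P f v) :
    (∀ s' ∈ (exec w c s).support, P s') ∧ v ≤ (exec w c s).expect f := by
  obtain ⟨μ, h1, h2, h3⟩ := h
  rw [h1.halts_exec.2]
  exact ⟨h2, h3⟩

/-- An invariant and a supermartingale for the interaction with an adversary. -/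
theorem play_invariant {n w W t : ℕ} {alg : DynAlg} {s₀ : Store} {G₀ : WGraph n}
    {A : Adversary n} (hA : A.LegalFor W G₀ t) {I : List (Update n) → Store → Prop}
    {V : ℕ → List (Update n) → Store → ℝ≥0∞} {v : ℝ≥0∞}
    (hprep : ∃ T, Tr w alg.prep s₀ T (I []) (V t []) v)
    (hupd : ∀ us s u k, I us s → u.Legal W (Update.applyAll G₀ us) →
      ∃ T, Tr w alg.upd (feed s u) T (I (u :: us)) (V k (u :: us)) (V (k + 1) us s)) :
    ∀ i ≤ t, (∀ π ∈ (play w alg s₀ A i).support, π.upds.length = i ∧ I π.upds π.store) ∧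
      v ≤ (play w alg s₀ A i).expect fun π => V (t - i) π.upds π.store := by
  intro i
  induction i with
  | zero =>
    intro _
    obtain ⟨T, hT⟩ := hprep
    rw [play]
    refine ⟨fun π hπ => ?_, ?_⟩
    · rw [PMF.support_map] at hπ
      obtain ⟨s, hs, rfl⟩ := hπ
      exact ⟨rfl, hT.exec.1 s hs⟩
    · rw [PMF.expect_map]
      exact hT.exec.2
  | succ i ih =>
    intro hi
    obtain ⟨h1, h2⟩ := ih (by omega)
    rw [play]
    refine ⟨fun π hπ => ?_, h2.trans ?_⟩
    · rw [PMF.support_bind] at hπ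
      obtain ⟨π', hπ', hπ⟩ := Set.mem_iUnion₂.1 hπ
      rw [PMF.support_bind] at hπ
      obtain ⟨u, hu, hπ⟩ := Set.mem_iUnion₂.1 hπ
      rw [PMF.support_map] at hπ
      obtain ⟨s, hs, rfl⟩ := hπ
      obtain ⟨h3, h4⟩ := h1 π' hπ'
      obtain ⟨T, hT⟩ := hupd π'.upds π'.store u 0 h4 (hA _ _ (by omega) u hu)
      exact ⟨by simp [h3], hT.exec.1 s hs⟩
    · rw [PMF.expect_bind]
      refine PMF.expect_mono fun π hπ => ?_
      rw [PMF.expect_bind]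
      -- The bound holds for every legal update separately, so the way the adversary chooses among
      -- them is irrelevant.
      refine PMF.le_expect fun u hu => ?_
      rw [PMF.expect_map]
      obtain ⟨h3, h4⟩ := h1 π hπ
      obtain ⟨T, hT⟩ := hupd π.upds π.store u (t - (i + 1)) h4 (hA _ _ (by omega) u hu)
      rw [show t - i = t - (i + 1) + 1 by omega]
      exact hT.exec.2

section

variable {n : ℕ}

theorem feed_eq (s : Store) (u : Update n) :
    feed s u = ((s.setReg 0 u.src).setReg 1 u.dst).setReg 2 u.wt := by
  cases u <;> rfl

theorem updCmd_feed {w W a l m m' k : ℕ} {ε : ℝ} {q : ℝ≥0∞} {G : WGraph n} {s : Store}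
    {u : Update n} (hw : Words w n W a l) (ha : 2 ≤ a) (hε : 1 ≤ ε * a)
    (hi : Inv W a l m G s) (hu : u.Ok W) (hm : m' ≤ m)
    (hm' : m' ≤ (u.apply G).nis) (hq : q + 2 * ENNReal.ofReal (Real.exp (-3 * l)) ≤ 1) :
    Tr w updCmd (feed s u) (updTime W a l m')
      (fun s' => Inv W a l m' (u.apply G) s' ∧ s'.reg 0 = s'.reg 28 ∧ s'.reg 1 = s'.reg 29)
      (potential W a l ε q k (u.apply G)) (potential W a l ε q (k + 1) G s) := by
  have hr : ∀ r, 3 ≤ r → r ≠ 39 → (feed s u).reg r = s.reg r := by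
    intro r h _
    rw [feed_eq]
    simp [show r ≠ 0 by omega, show r ≠ 1 by omega, show r ≠ 2 by omega]
  have ha' : (feed s u).arr = s.arr := by rw [feed_eq]; rfl
  rw [← potential_congr hr ha']
  exact updCmd_spec hw ha hε (hi.congr hr ha') hu (by simp [feed_eq]) (by simp [feed_eq])
    (by simp [feed_eq]) hm hm' hq

/-- At the target itself both windows contain k = 0, so the potential is the indicator of robustness
against no further drift. -/
theorem potential_zero_le {W a l : ℕ} {ε : ℝ} {q : ℝ≥0∞} {G : WGraph n} {s : Store}
    (h0 : s.reg 0 = s.reg 28) (h1 : s.reg 1 = s.reg 29)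
    [Decidable (IsApprox ε (output s) G.msfWeight)] :
    potential W a l ε q 0 G s ≤ if IsApprox ε (output s) G.msfWeight then 1 else 0 := by
  have h2 : potential W a l ε q 0 G s = goodInd W ε G 0 s := by
    rw [potential]
    split_ifs <;> first | rfl | omega
  rw [h2, goodInd]
  split_ifs with h3 h4
  · exact le_rfl
  · refine absurd ?_ h4
    have h5 := h3 G.msfWeight (Nat.cast_nonneg _) (by simp)
    rw [output, h0, h1]
    push_cast
    exact h5
  · exact bot_le
  · exact le_rfl

theorem minNis_le_nis (G₀ : WGraph n) (us : List (Update n)) :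
    Update.minNis G₀ us ≤ (Update.applyAll G₀ us).nis := by
  cases us with
  | nil => exact le_rfl
  | cons u us => exact min_le_left _ _

theorem minNis_cons_le (G₀ : WGraph n) (u : Update n) (us : List (Update n)) :
    Update.minNis G₀ (u :: us) ≤ Update.minNis G₀ us := min_le_right _ _

/-- If `a < 2`, then the program maintains the value `0`. -/
theorem prepCmd_trivial {w W b : ℕ} (h2w : 2 < 2 ^ w) (G : WGraph n) :
    ∃ T, Tr w prepCmd (inputStore W 1 b G) T (fun s => s.reg 0 = 0 ∧ s.reg 6 = 1)
      (fun _ => 1) 1 := by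
  have hw0 : 0 < w := Nat.pos_of_ne_zero (by rintro rfl; simp at h2w)
  obtain ⟨s1, hs1⟩ : ∃ s1, s1 = copyCmd.det w (inputStore W 1 b G) := ⟨_, rfl⟩
  have h6 : s1.reg 6 = 1 := by rw [hs1]; simp [copyCmd, Cmd.det, inputStore]
  have hite : ∀ d, Tr w (.ite (.op .lt (.reg 6) (.const 2)) (.assign 0 (.const 0)) d) s1 (1 + 1)
      (fun s => s.reg 0 = 0 ∧ s.reg 6 = 1) (fun _ => 1) 1 := fun d =>
    Tr.ite (fun _ => tr_det rfl (by simp [Cmd.det, h6]) le_rfl) (fun h => by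
      rw [eval_lt_eq (by omega), eval_reg, eval_const, h6, Nat.mod_eq_of_lt h2w] at h
      omega)
  exact ⟨_, Tr.seq (P := fun s' => s' = s1) (f := fun _ => 1) (tr_det rfl hs1.symm le_rfl)
    fun s' h => (congrArg (fun t => Tr w _ t _ _ _ 1) h).mpr (hite _)⟩

theorem updCmd_trivial {w : ℕ} (h2w : 2 < 2 ^ w) {s : Store} (h6 : s.reg 6 = 1) (u : Update n) :
    Tr w updCmd (feed s u) 2 (fun s => s.reg 0 = 0 ∧ s.reg 6 = 1) (fun _ => 1) 1 := by
  have h6' : (feed s u).reg 6 = 1 := by rw [feed_eq]; simp [h6]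
  refine Tr.ite (T := 1) (fun _ => ?_) (fun h => ?_)
  · exact tr_det rfl (by simp [Cmd.det, h6']) le_rfl
  · rw [eval_lt_eq (by omega), eval_reg, eval_const, h6', Nat.mod_eq_of_lt h2w] at h
    omega

end

/-- The algorithm. -/
def mstAlg : DynAlg := ⟨prepCmd, updCmd⟩

/-- The invariant of the interaction. -/
def PlayInv {n : ℕ} (W a l : ℕ) (G₀ : WGraph n) (us : List (Update n)) (s : Store) : Prop :=
  Inv W a l (Update.minNis G₀ us) (Update.applyAll G₀ us) s ∧
    s.reg 0 = s.reg 28 ∧ s.reg 1 = s.reg 29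

theorem mstAlg_prep {n w W a b l k : ℕ} {ε : ℝ} {q : ℝ≥0∞} {G : WGraph n}
    (hw : Words w n W a l) (ha : 2 ≤ a) (hb : 2 * b + 2 < 2 ^ w)
    (hl : l = Nat.clog 2 b + 1) (hε : 1 ≤ ε * a) (hG : G.WeightsIn W)
    (hq : q + 2 * ENNReal.ofReal (Real.exp (-3 * l)) ≤ 1) :
    ∃ T, Tr w mstAlg.prep (inputStore W a b G) T (PlayInv W a l G [])
      (potential W a l ε q k (Update.applyAll G [])) q := prepCmd_spec hw ha hb hl hε hG hq

theorem mstAlg_upd {n w W a l k : ℕ} {ε : ℝ} {q : ℝ≥0∞} {G₀ : WGraph n} {s : Store}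
    {u : Update n} {us : List (Update n)} (hw : Words w n W a l) (ha : 2 ≤ a) (hε : 1 ≤ ε * a)
    (hi : PlayInv W a l G₀ us s) (hu : u.Ok W)
    (hq : q + 2 * ENNReal.ofReal (Real.exp (-3 * l)) ≤ 1) :
    Tr w mstAlg.upd (feed s u) (updTime W a l (Update.minNis G₀ (u :: us)))
      (PlayInv W a l G₀ (u :: us)) (potential W a l ε q k (Update.applyAll G₀ (u :: us)))
      (potential W a l ε q (k + 1) (Update.applyAll G₀ us) s) :=
  updCmd_feed hw ha hε hi.1 hu (minNis_cons_le G₀ u us) (minNis_le_nis G₀ (u :: us)) hq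

/-- The summand 1 in `l` gives 2^l ≥ 2/p, hence e^{-3l} ≤ e^{-l} ≤ 2^{-l} ≤ p/2. -/
theorem exp_bound {b l : ℕ} {p : ℝ} (hp : 0 < p) (hp' : p < 1) (hb : b = ⌈1 / p⌉₊)
    (hl : l = Nat.clog 2 b + 1) :
    ENNReal.ofReal (1 - p) + 2 * ENNReal.ofReal (Real.exp (-3 * l)) ≤ 1 := by
  have h1 : 1 / p ≤ 2 ^ Nat.clog 2 b := by
    refine (Nat.le_ceil (1 / p)).trans ?_
    rw [← hb]
    exact_mod_cast Nat.le_pow_clog (by norm_num) b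
  have h2 : (2 : ℝ) ^ l ≤ Real.exp l := by
    have h3 : (2 : ℝ) ≤ Real.exp 1 := by have := Real.add_one_le_exp (1 : ℝ); linarith
    calc (2 : ℝ) ^ l ≤ Real.exp 1 ^ l := by gcongr
      _ = Real.exp l := by rw [← Real.exp_nat_mul, mul_one]
  have h3 : 2 * Real.exp (-3 * l) ≤ p := by
    have h4 : Real.exp (-3 * l) ≤ Real.exp (-l) := Real.exp_le_exp.2 (by
      have : (0 : ℝ) ≤ l := Nat.cast_nonneg l
      linarith)
    have h5 : Real.exp (-l) * Real.exp l = 1 := by rw [← Real.exp_add]; simp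
    have h6 : 2 * (1 / p) ≤ Real.exp l := by
      refine le_trans ?_ h2
      rw [hl, pow_succ]
      linarith
    have h7 := Real.exp_pos (-l : ℝ)
    have h8 : Real.exp (-l) * (2 * (1 / p)) ≤ 1 := 
      (mul_le_mul_of_nonneg_left h6 h7.le).trans_eq h5
    have h9 : Real.exp (-l) * (2 * (1 / p)) = 2 * Real.exp (-l) / p := by ring
    rw [h9, div_le_one hp] at h8
    linarith
  have h4 : (2 : ℝ≥0∞) = ENNReal.ofReal 2 := by simp
  rw [h4, ← ENNReal.ofReal_mul (by norm_num), ← ENNReal.ofReal_add (by linarith) (by positivity),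
    ← ENNReal.ofReal_one]
  exact ENNReal.ofReal_le_ofReal (by linarith)

end RAM

open RAM in
theorem mainTheorem6 :
    ∃ (alg : DynAlg) (K : ℕ) (C : ℝ), 0 < C ∧
      ∀ (n W w : ℕ) (ε p : ℝ), 2 ≤ W → 0 < ε → 0 < p → p < 1 →
        -- words have at least `K * log₂ (n + W + 1 / ε + 1 / p)` bits
        (n + W + ⌈1 / ε⌉₊ + ⌈1 / p⌉₊) ^ K ≤ 2 ^ w →
        ∀ G₀ : WGraph n, G₀.WeightsIn W →
          -- the preprocessing terminates
          (∃ T, RAM.HaltsWithin w alg.prep (inputStore W ⌈1 / ε⌉₊ ⌈1 / p⌉₊ G₀) T) ∧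
          ∀ (A : Adversary n) (t : ℕ), A.LegalFor W G₀ t →
            -- worst-case time of each of the `t` updates
            (∀ i < t, ∀ π ∈ (play w alg (inputStore W ⌈1 / ε⌉₊ ⌈1 / p⌉₊ G₀) A i).support,
              ∀ u ∈ (A π.upds π.outs).support,
                ∃ T : ℕ, RAM.HaltsWithin w alg.upd (feed π.store u) T ∧
                  (T : ℝ) ≤ C * timeBound W ε p (max 1 (Update.minNis G₀ (u :: π.upds)))) ∧
            -- correctness of the maintained value after `t` updates
            ENNReal.ofReal (1 - p) ≤
              (play w alg (inputStore W ⌈1 / ε⌉₊ ⌈1 / p⌉₊ G₀) A t).toOuterMeasure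
                {π | IsApprox ε (output π.store) (Update.applyAll G₀ π.upds).msfWeight} := by

  classical
  refine ⟨mstAlg, 30, (10 ^ 16 + 1) * (tick.cost + 3) +
    (preCmd.cost + postCmd.cost + outCmd.cost + 20), by positivity, ?_⟩
  intro n W w ε p hW hε hp hp' hK G₀ hG
  have htb : ∀ m, 1 ≤ timeBound W ε p m := fun m => le_max_left _ _
  have h1p : 1 < 1 / p := by rw [lt_div_iff₀ hp]; linarith
  obtain ⟨a, ha⟩ : ∃ a, a = ⌈1 / ε⌉₊ := ⟨_, rfl⟩
  obtain ⟨b, hb⟩ : ∃ b, b = ⌈1 / p⌉₊ := ⟨_, rfl⟩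
  obtain ⟨l, hl⟩ : ∃ l, l = Nat.clog 2 b + 1 := ⟨_, rfl⟩
  rw [← ha, ← hb] at hK ⊢
  have ha1 : 1 ≤ a := by rw [ha]; exact Nat.one_le_ceil_iff.2 (by positivity)
  have hb2 : 2 ≤ b := by
    have : 1 < b := by
      rw [hb, Nat.lt_ceil]
      simpa using h1p
    exact this
  obtain ⟨hw, hbw⟩ := words_of_pow hW ha1 hb2 hl hK
  clear hK
  have hεa : 1 ≤ ε * a := by
    have := Nat.le_ceil (1 / ε)
    rwa [← ha, div_le_iff₀ hε, mul_comm] at this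
  have h2w : 2 < 2 ^ w := by omega
  -- The case a = 1 means ε ≥ 1, where (1 − ε)M ≤ 0 makes the value 0 correct. Both programs test
  -- for it.
  rcases (show a = 1 ∨ 2 ≤ a by omega) with rfl | ha2
  · have hε1 : 1 ≤ ε := by simpa using hεa
    have hprep : ∃ T, Tr w mstAlg.prep (inputStore W 1 b G₀) T
        (fun s => s.reg 0 = 0 ∧ s.reg 6 = 1) (fun _ => 1) 1 := prepCmd_trivial h2w G₀
    have hupd : ∀ s, s.reg 6 = 1 → ∀ u : Update n, Tr w mstAlg.upd (feed s u) 2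
        (fun s => s.reg 0 = 0 ∧ s.reg 6 = 1) (fun _ => 1) 1 := fun s hs u => updCmd_trivial h2w hs u
    refine ⟨hprep.imp fun T hT => hT.haltsWithin, fun A t hA => ?_⟩
    have key := play_invariant (alg := mstAlg) (w := w) hA
      (I := fun _ s => s.reg 0 = 0 ∧ s.reg 6 = 1) (V := fun _ _ _ => 1) (v := 1) hprep
      (fun us s u k hs _ => ⟨2, hupd s hs.2 u⟩)
    refine ⟨fun i hi π hπ u hu => ⟨2, ?_, ?_⟩, ?_⟩
    · exact (hupd _ (((key i hi.le).1 π hπ).2).2 u).haltsWithin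
    · have h1 := htb (max 1 (Update.minNis G₀ (u :: π.upds)))
      have h2 : (2 : ℝ) ≤ (10 ^ 16 + 1) * (tick.cost + 3) +
          (preCmd.cost + postCmd.cost + outCmd.cost + 20) := by
        have h3 : (0 : ℝ) ≤ tick.cost := Nat.cast_nonneg _
        have h4 : (0 : ℝ) ≤ preCmd.cost + postCmd.cost + outCmd.cost := by positivity
        linarith
      push_cast
      exact h2.trans (le_mul_of_one_le_right (by positivity) h1)
    · refine le_trans ?_ (PMF.expect_indicator _ _).le
      refine PMF.le_expect fun π hπ => ?_
      have h0 := (((key t le_rfl).1 π hπ).2).1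
      have hM : (0 : ℝ) ≤ (Update.applyAll G₀ π.upds).msfWeight := Nat.cast_nonneg _
      rw [if_pos]
      · exact ENNReal.ofReal_le_one.2 (by linarith)
      · simp only [Set.mem_ofPred_eq, IsApprox, output, h0]
        push_cast
        rw [zero_div]
        exact ⟨mul_nonpos_of_nonpos_of_nonneg (by linarith) hM, by positivity⟩
  · have hε1 : ε < 1 := by
      by_contra hcon
      have : a ≤ 1 := by
        rw [ha, Nat.ceil_le, div_le_iff₀ hε]
        push_cast
        linarith
      omega
    have hq := exp_bound hp hp' hb hl
    have hprep := fun k => mstAlg_prep (k := k) hw ha2 hbw hl hεa hG hq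
    refine ⟨(hprep 0).imp fun T hT => hT.haltsWithin, fun A t hA => ?_⟩
    have hupd := fun us s (u : Update n) k (hs : PlayInv W a l G₀ us s)
        (hu : u.Legal W (Update.applyAll G₀ us)) =>
      mstAlg_upd (k := k) (ε := ε) hw ha2 hεa hs hu.ok hq
    -- The target is update `t`, and `k` counts the updates left until then.
    have key := play_invariant (alg := mstAlg) (w := w) hA (I := PlayInv W a l G₀)
      (V := fun k us s => potential W a l ε (ENNReal.ofReal (1 - p)) k (Update.applyAll G₀ us) s)
      (hprep t) (fun us s u k hs hu => ⟨_, hupd us s u k hs hu⟩)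
    refine ⟨fun i hi π hπ u hu => ?_, ?_⟩
    · obtain ⟨h1, h2⟩ := (key i hi.le).1 π hπ
      have hleg := hA π.upds π.outs (by omega) u hu
      exact ⟨_, (hupd π.upds π.store u 0 h2 hleg).haltsWithin,
        updTime_le hW hε hε1 hp hp' ha hb hl⟩
    · obtain ⟨h1, h2⟩ := key t le_rfl
      refine h2.trans ((PMF.expect_mono fun π hπ => ?_).trans (PMF.expect_indicator _ _).le)
      obtain ⟨-, -, h3, h4⟩ := h1 π hπ
      rw [Nat.sub_self]
      exact potential_zero_le h3 h4
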